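/- \textbf{Setting.} A \emph{signed graph} $G=(V,E^+)$ on $V=\{0,\dots,n-1\}$, $n\ge 1$, is the complete graph on $V$ in which the pairs in $E^+\subseteq\binom V2$ have label $+1$ and the pairs in $E^-=\binom V2\setminus E^+$ have label $-1$. The cost of a partition (clustering) of $V$ is the number of pairs of $E^+$ whose endpoints lie in different clusters plus the number of pairs of $E^-$ whose endpoints lie in the same cluster. A clustering is a \emph{$c$-approximate correlation clustering} if its cost is at most $c$ times the minimum cost over all partitions of $V$. A \emph{(multi-pass) streaming algorithm} is a single randomized program that is given $n$ and accesses $G$ only by making sequential passes over the list of the edges in $E^+$; in each pass every edge appears exactly once, in an arbitrary order and orientation, and the order may differ from pass to pass (all orders are fixed independently of the random bits of the algorithm). It is \emph{semi-streaming} if there are constants $C,k$ such that on every input with $n$ vertices, for all orders of the edges and all outcomes of its random bits, it never uses more than $C\, n\,(\lfloor\log_2 n\rfloor+1)^k$ bits of memory, that is, $O(n\operatorname{poly}\log n)$ memory. \textbf{Theorem.} There exist a semi-streaming algorithm and absolute constants $p$ and $c$ such that, for every $n\ge 1$, every signed graph $G=(V,E^+)$ with $|V|=n$ and all orders in which its edges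 are presented in the passes, the algorithm always makes at most $p$ passes over the stream, and with probability at least $1-1/n$ (over its random bits) it outputs a $c$-approximate correlation clustering of $G$. -/

import Mathlib

open scoped ENNReal

noncomputable section

namespace CorrClust

/-! ### Correlation clustering (minimum disagreement, complete `±1`-labelled graph)

The signed graph on `Fin n` is given by the simple graph `G` of its `+1` edges; all other pairs of
distinct vertices are labelled `-1`. A clustering is a partition of the vertices, i.e. a
`Setoid (Fin n)`, two vertices being related when they lie in the same cluster. -/

/-- The number of disagreements of the clustering `P`: `+1` edges between different clusters plus
`-1` edges inside a cluster. The unordered pair `{u, v}` is represented by `(u, v)` with `u < v`. -/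
def cost {n : ℕ} (G : SimpleGraph (Fin n)) (P : Setoid (Fin n)) : ℕ :=
  {e : Fin n × Fin n | e.1 < e.2 ∧ G.Adj e.1 e.2 ∧ ¬ P e.1 e.2}.ncard +
  {e : Fin n × Fin n | e.1 < e.2 ∧ ¬ G.Adj e.1 e.2 ∧ P e.1 e.2}.ncard

/-- `P` is a `c`-approximate correlation clustering of `G`. -/
def IsApprox {n : ℕ} (c : ℕ) (G : SimpleGraph (Fin n)) (P : Setoid (Fin n)) : Prop :=
  ∀ Q : Setoid (Fin n), cost G P ≤ c * cost G Q

/-! ### Edge streams -/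

/-- `s` lists every edge of `G` exactly once, in some order, each with some orientation. -/
def IsEdgeStream {n : ℕ} (G : SimpleGraph (Fin n)) (s : List (Fin n × Fin n)) : Prop :=
  (s.map fun p => s(p.1, p.2)).Nodup ∧
  ∀ e : Sym2 (Fin n), e ∈ (s.map fun p => s(p.1, p.2)) ↔ e ∈ G.edgeSet

/-! ### Randomized multi-pass streaming programs

A program is one fixed text of a small imperative language, independent of the input. Its memory
consists of arrays of natural numbers; an array is named by a constant of the program text, while
array indices are computed. All cells are initially zero, except for the cell that holds `n`. -/

/-- The memory: the content of the `i`-th cell of array `a` is `m (a, i)`. -/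
abbrev Mem := ℕ × ℕ →₀ ℕ

/-- The number of bits needed to store the memory: every nonzero cell is charged the binary length
of its content and of its index. -/
def Mem.bits (m : Mem) : ℕ := m.sum fun ai x => Nat.size ai.2 + Nat.size x

/-- Arithmetic expressions. With these operations, the scratch space for evaluating a fixed
expression is at most a constant factor above the number of bits stored in the memory. -/
inductive Expr where
  | const (k : ℕ)
  | read (a : ℕ) (i : Expr)
  | add (x y : Expr)
  | sub (x y : Expr)
  | mul (x y : Expr)
  | div (x y : Expr)

def Expr.eval (m : Mem) : Expr → ℕ
  | const k => k
  | read a i => m (a, i.eval m)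
  | add x y => x.eval m + y.eval m
  | sub x y => x.eval m - y.eval m
  | mul x y => x.eval m * y.eval m
  | div x y => x.eval m / y.eval m

inductive Prog where
  /-- Do nothing. -/
  | skip
  /-- Write the value of `e` into the cell of array `a` with index the value of `i`. -/
  | write (a : ℕ) (i e : Expr)
  /-- Write a fresh fair random bit into the cell of array `a` with index the value of `i`. -/
  | flip (a : ℕ) (i : Expr)
  /-- Start a new pass over the stream, abandoning what is left of the current one. -/
  | startPass
  /-- Read the next edge of the current pass. -/
  | nextEdge
  /-- Sequential composition. -/
  | seq (p q : Prog)
  /-- Execute `p` if the value of `e` is nonzero, and `q` otherwise. -/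
  | ite (e : Expr) (p q : Prog)
  /-- Execute `p` as many times as the value of `e` on entry of the loop. -/
  | loop (e : Expr) (p : Prog)

/-- The memory of a running program, the unread part of the current pass over the stream, and the
number of passes started so far. The program has access to the last two only through `startPass`
and `nextEdge`. -/
structure Config (n : ℕ) where
  mem : Mem
  unread : List (Fin n × Fin n)
  passes : ℕ

/-- A random step or sequence of steps, which returns the new configuration together with the
largest number of bits of memory in use at any moment of it. -/
abbrev Action (n : ℕ) := Config n → PMF (Config n × ℕ)

namespace Action

variable {n : ℕ}

/-- A single step, given by the distribution of the new configuration. -/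
def step (f : Config n → PMF (Config n)) : Action n := fun s =>
  (f s).map fun s' => (s', max s.mem.bits s'.mem.bits)

/-- First `f`, then `g`. -/
def andThen (f g : Action n) : Action n := fun s =>
  (f s).bind fun r => (g r.1).map fun r' => (r'.1, max r.2 r'.2)

/-- `k`-fold repetition. -/
def repeated (f : Action n) : ℕ → Action n
  | 0 => step PMF.pure
  | k + 1 => andThen f (repeated f k)

/-- The same action, during which `b` additional bits of memory are occupied. -/
def withExtra (b : ℕ) (f : Action n) : Action n := fun s =>
  (f s).map fun r => (r.1, r.2 + b)

end Action

/-- Array `0` is used for input: its cell `0` holds the number of vertices initially, and an edge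
that is read is put into the cells `1` and `2`, while cell `3` tells whether there was one left in
the current pass. -/
def readEdge {n : ℕ} (s : Config n) : Config n :=
  match s.unread with
  | [] => { s with mem := s.mem.update (0, 3) 0 }
  | e :: es =>
    { s with
      mem := ((s.mem.update (0, 1) e.1.val).update (0, 2) e.2.val).update (0, 3) 1
      unread := es }

/-- The semantics of programs; `σ j` is the stream as presented in the `j`-th pass (counted from
`0`), so different passes may use different orders. A loop is charged for its counter. -/
def Prog.exec {n : ℕ} (σ : ℕ → List (Fin n × Fin n)) : Prog → Action n
  | skip => Action.step PMF.pure
  | write a i e => Action.step fun s =>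
      PMF.pure { s with mem := s.mem.update (a, i.eval s.mem) (e.eval s.mem) }
  | flip a i => Action.step fun s =>
      (PMF.uniformOfFintype Bool).map fun b =>
        { s with mem := s.mem.update (a, i.eval s.mem) b.toNat }
  | startPass => Action.step fun s =>
      PMF.pure { s with unread := σ s.passes, passes := s.passes + 1 }
  | nextEdge => Action.step fun s => PMF.pure (readEdge s)
  | seq p q => Action.andThen (p.exec σ) (q.exec σ)
  | ite e p q => fun s => if e.eval s.mem ≠ 0 then p.exec σ s else q.exec σ s
  | loop e p => fun s =>
      Action.withExtra (Nat.size (e.eval s.mem))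
        (Action.repeated (p.exec σ) (e.eval s.mem)) s

/-- The distribution of the final configuration and the peak memory (in bits) of the program `A`
on an `n`-vertex graph whose edges are presented in the order `σ j` in pass `j`. -/
def Prog.run (A : Prog) {n : ℕ} (σ : ℕ → List (Fin n × Fin n)) : PMF (Config n × ℕ) :=
  A.exec σ { mem := Finsupp.single (0, 0) n, unread := [], passes := 0 }

/-- The clustering output by a program that has stopped in configuration `s`: array `1` holds the
name of the cluster of each vertex. -/
def Config.clustering {n : ℕ} (s : Config n) : Setoid (Fin n) :=
  Setoid.ker fun v : Fin n => s.mem (1, v.val)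

/-- `A` is a semi-streaming algorithm: on every `n`-vertex graph, for all orders of its edges and
all outcomes of the random bits, it never uses more than `O(n polylog n)` bits of memory. -/
def Prog.IsSemiStreaming (A : Prog) : Prop :=
  ∃ C k : ℕ, ∀ n : ℕ, 1 ≤ n → ∀ (G : SimpleGraph (Fin n)) (σ : ℕ → List (Fin n × Fin n)),
    (∀ j, IsEdgeStream G (σ j)) →
    ∀ r ∈ (A.run σ).support, r.2 ≤ C * n * (Nat.log 2 n + 1) ^ k

end CorrClust

end

/-! The algorithm runs several independent copies of a truncated random pivot process and keeps the
best result. Put L = ⌊log₂ n⌋ + 1 and N = 2^L, so n < N ≤ 2n. A candidate is determined by M = 12LN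
independent uniform draws below N. A draw that is an alive vertex becomes a pivot, and its cluster
consists of itself and its alive neighbours. After j draws every alive vertex u with j(deg u + 1) ≥
M becomes a singleton, so high-degree vertices must be captured early.

Truncation saves memory. An edge can matter only if one endpoint is drawn while the other is within
its time limit (`runLabel_congr`). A vertex of degree d is within its limit for ⌈M/(d+1)⌉ draws,
each of which is a neighbour with probability d/N, so O(nL) edges per candidate suffice in
expectation (`avg_hitsRun_le`). One pass computes degrees, a second stores the relevant edges of all
candidates up to a cap, and a third counts cut edges so that the costs can be compared
(`IsEdgeStream.score_eq`).

The cost has two sources. A disagreement created by a pivot forms a triangle with exactly two +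
edges, and every clustering errs on each such triangle. Charging these errors as pairs leave the
alive set bounds the expected pivot cost by three times the optimum (`sum_pivotCost_le`,
`avg_pivotCostRun_le`). Isolations are paid for by a potential that counts an edge between an alive
and a dead vertex twice: isolating a vertex with at most a third of its neighbours alive does not
increase it (`pot_isolateLabel_le`). An isolation with more alive neighbours means that none of
these was drawn for about M/(deg+1) steps, which has probability at most 1/(8N) (`avg_badRun_le`,
`avg_exists_badRun_le`).

By a union bound and two applications of Markov's inequality a candidate fails with probability at
most 1/2 (`avg_failRun_le`). All L independent candidates fail with probability at most 2^(-L) ≤ 1/n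
(`avg_blocks_le`), and otherwise the best one is 48-approximate.

For the program, facts true for all random outcomes (memory, passes, meaning of the arrays) are
proved on the support of the output distribution with `Ensures` and `Leads`. The only probabilistic
fact needed is that expectations after the drawing phase are bounded by averages over lists of draws
(`Params.expect_drawProg_le`). -/

namespace CorrClust

/-! ### Support-based program logic -/

/-- All nonzero cells lie in the arrays below `30`, at indices below `S`, with contents below `V`. -/
def Mem.Fits (S V : ℕ) (m : Mem) : Prop :=
  ∀ ai, m ai ≠ 0 → ai.1 < 30 ∧ ai.2 < S ∧ m ai < V

/-- The largest number of bits of a memory that fits. -/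
def fitBits (S V : ℕ) : ℕ := 30 * S * (Nat.size S + Nat.size V)

theorem Mem.Fits.bits_le {S V : ℕ} {m : Mem} (h : m.Fits S V) : m.bits ≤ fitBits S V := by
  have hsub : m.support ⊆ Finset.range 30 ×ˢ Finset.range S := by
    intro ai hai
    have := h ai (by simpa using hai)
    simp only [Finset.mem_product, Finset.mem_range]
    exact ⟨this.1, this.2.1⟩
  calc m.bits ≤ ∑ _ai ∈ m.support, (Nat.size S + Nat.size V) := by
        refine Finset.sum_le_sum fun ai hai => ?_
        have := h ai (by simpa using hai)
        exact add_le_add (Nat.size_le_size this.2.1.le) (Nat.size_le_size this.2.2.le)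
    _ = m.support.card * (Nat.size S + Nat.size V) := by simp
    _ ≤ _ := by
        refine Nat.mul_le_mul_right _ ((Finset.card_le_card hsub).trans ?_)
        simp

theorem Mem.Fits.update {S V : ℕ} {m : Mem} (h : m.Fits S V) {a i x : ℕ} (ha : a < 30)
    (hi : i < S) (hx : x < V) : Mem.Fits S V (m.update (a, i) x) := by
  classical
  intro ai hai
  rw [Finsupp.coe_update] at hai ⊢
  by_cases hc : ai = (a, i)
  · subst hc; simpa using ⟨ha, hi, hx⟩
  · rw [Function.update_of_ne hc] at hai ⊢
    exact h ai hai

theorem Mem.update_eq (m : Mem) (a i x b j : ℕ) :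
    (m.update (a, i) x : Mem) (b, j) = if b = a ∧ j = i then x else m (b, j) := by
  classical
  rw [Finsupp.coe_update, Function.update_apply]
  simp only [Prod.mk.injEq]

/-- The nesting depth of loops. -/
def Prog.depth : Prog → ℕ
  | .seq p q => max p.depth q.depth
  | .ite _ p q => max p.depth q.depth
  | .loop _ p => p.depth + 1
  | _ => 0

/-- The arrays that may be modified. -/
def Prog.mods : Prog → List ℕ
  | .write a _ _ => [a]
  | .flip a _ => [a]
  | .nextEdge => [0]
  | .seq p q => p.mods ++ q.mods
  | .ite _ p q => p.mods ++ q.mods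
  | .loop _ p => p.mods
  | _ => []

variable {n : ℕ} {S V : ℕ}

theorem Action.mem_support_step {f : Config n → PMF (Config n)} {s : Config n} {r : Config n × ℕ} :
    r ∈ (Action.step f s).support ↔ ∃ s' ∈ (f s).support, r = (s', max s.mem.bits s'.mem.bits) := by
  simp only [Action.step, PMF.mem_support_map_iff, eq_comm]

theorem Action.mem_support_andThen {f g : Action n} {s : Config n} {r : Config n × ℕ} :
    r ∈ (Action.andThen f g s).support ↔
      ∃ r₁ ∈ (f s).support, ∃ r₂ ∈ (g r₁.1).support, r = (r₂.1, max r₁.2 r₂.2) := by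
  simp only [Action.andThen, PMF.mem_support_bind_iff, PMF.mem_support_map_iff, eq_comm]

theorem Action.mem_support_withExtra {f : Action n} {b : ℕ} {s : Config n} {r : Config n × ℕ} :
    r ∈ (Action.withExtra b f s).support ↔ ∃ r₁ ∈ (f s).support, r = (r₁.1, r₁.2 + b) := by
  simp only [Action.withExtra, PMF.mem_support_map_iff, eq_comm]

/-- An invariant of an action is an invariant of its repetition. -/
theorem Action.repeated_support {f : Action n} {b : ℕ} (I : ℕ → Config n → Prop) (k : ℕ)
    (hb : ∀ i ≤ k, ∀ s, I i s → s.mem.bits ≤ b)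
    (hf : ∀ i < k, ∀ s, I i s → ∀ r ∈ (f s).support, I (i + 1) r.1 ∧ r.2 ≤ b)
    (s : Config n) (hs : I 0 s) : ∀ r ∈ (Action.repeated f k s).support, I k r.1 ∧ r.2 ≤ b := by
  induction k generalizing I s with
  | zero =>
    intro r hr
    rw [Action.repeated, Action.mem_support_step] at hr
    obtain ⟨s', hs', rfl⟩ := hr
    rw [PMF.mem_support_pure_iff] at hs'
    subst hs'
    exact ⟨hs, by simpa using hb 0 le_rfl _ hs⟩
  | succ k ih =>
    intro r hr
    rw [Action.repeated, Action.mem_support_andThen] at hr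
    obtain ⟨r₁, hr₁, r₂, hr₂, rfl⟩ := hr
    have h1 := hf 0 (Nat.succ_pos _) s hs r₁ hr₁
    have h2 := ih (fun i => I (i + 1)) (fun i hi s => hb (i + 1) (by omega) s)
      (fun i hi s => hf (i + 1) (by omega) s) r₁.1 h1.1 r₂ hr₂
    exact ⟨h2.1, max_le h1.2 h2.2⟩

/-- Replaces invariants about untouched arrays by a syntactic check of `mods`, which `decide` can
often settle. -/
theorem Prog.exec_frame (σ : ℕ → List (Fin n × Fin n)) (p : Prog) (s : Config n) :
    ∀ r ∈ (p.exec σ s).support, ∀ a ∉ p.mods, ∀ i, r.1.mem (a, i) = s.mem (a, i) := by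
  induction p generalizing s with
  | skip =>
    intro r hr
    rw [Prog.exec, Action.mem_support_step] at hr
    obtain ⟨s', hs', rfl⟩ := hr
    rw [PMF.mem_support_pure_iff] at hs'
    subst hs'; simp
  | write b j e =>
    intro r hr
    rw [Prog.exec, Action.mem_support_step] at hr
    obtain ⟨s', hs', rfl⟩ := hr
    rw [PMF.mem_support_pure_iff] at hs'
    subst hs'
    intro a ha i
    simp only [Prog.mods, List.mem_singleton] at ha
    simp [Mem.update_eq, ha]
  | flip b j =>
    intro r hr
    rw [Prog.exec, Action.mem_support_step] at hr
    obtain ⟨s', hs', rfl⟩ := hr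
    rw [PMF.mem_support_map_iff] at hs'
    obtain ⟨b, -, rfl⟩ := hs'
    intro a ha i
    simp only [Prog.mods, List.mem_singleton] at ha
    simp [Mem.update_eq, ha]
  | startPass =>
    intro r hr
    rw [Prog.exec, Action.mem_support_step] at hr
    obtain ⟨s', hs', rfl⟩ := hr
    rw [PMF.mem_support_pure_iff] at hs'
    subst hs'; simp
  | nextEdge =>
    intro r hr
    rw [Prog.exec, Action.mem_support_step] at hr
    obtain ⟨s', hs', rfl⟩ := hr
    rw [PMF.mem_support_pure_iff] at hs'
    subst hs'
    intro a ha i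
    simp only [Prog.mods, List.mem_singleton] at ha
    simp only [readEdge]
    split <;> simp [Mem.update_eq, ha]
  | seq p q ihp ihq =>
    intro r hr
    rw [Prog.exec, Action.mem_support_andThen] at hr
    obtain ⟨r₁, hr₁, r₂, hr₂, rfl⟩ := hr
    intro a ha i
    simp only [Prog.mods, List.mem_append, not_or] at ha
    exact (ihq _ _ hr₂ a ha.2 i).trans (ihp _ _ hr₁ a ha.1 i)
  | ite e p q ihp ihq =>
    intro r hr a ha i
    simp only [Prog.mods, List.mem_append, not_or] at ha
    rw [Prog.exec] at hr
    dsimp only at hr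
    split at hr
    · exact ihp _ _ hr a ha.1 i
    · exact ihq _ _ hr a ha.2 i
  | loop e p ih =>
    intro r hr a ha i
    rw [Prog.exec, Action.mem_support_withExtra] at hr
    obtain ⟨r, hr, rfl⟩ := hr
    generalize Expr.eval s.mem e = k at hr
    induction k generalizing s r with
    | zero =>
      rw [Action.repeated, Action.mem_support_step] at hr
      obtain ⟨s', hs', rfl⟩ := hr
      rw [PMF.mem_support_pure_iff] at hs'
      subst hs'; simp
    | succ k ihk =>
      rw [Action.repeated, Action.mem_support_andThen] at hr
      obtain ⟨r₁, hr₁, r₂, hr₂, rfl⟩ := hr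
      exact (ihk _ _ hr₂).trans (ih _ _ hr₁ a ha i)

/-- From every configuration with memory `m`, the program `p` uses the stream in no way, stays
within the memory bounds, and leaves a memory that satisfies `Q`. -/
def Prog.Ensures (S V : ℕ) (p : Prog) (Q : Mem → Prop) (m : Mem) : Prop :=
  m.Fits S V → ∀ (n : ℕ) (σ : ℕ → List (Fin n × Fin n)) (s : Config n), s.mem = m →
    ∀ r ∈ (p.exec σ s).support, r.1.mem.Fits S V ∧ Q r.1.mem ∧ r.1.unread = s.unread ∧
      r.1.passes = s.passes ∧ r.2 ≤ fitBits S V + p.depth * Nat.size V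

namespace Prog.Ensures

variable {m : Mem} {Q Q' : Mem → Prop} {p q : Prog}

theorem mono (h : p.Ensures S V Q m) (hQ : ∀ m', Q m' → Q' m') : p.Ensures S V Q' m :=
  fun hm n σ s hs r hr => by
    obtain ⟨h1, h2, h3⟩ := h hm n σ s hs r hr
    exact ⟨h1, hQ _ h2, h3⟩

theorem frame (h : p.Ensures S V Q m) :
    p.Ensures S V (fun m' => Q m' ∧ ∀ a ∉ p.mods, ∀ i, m' (a, i) = m (a, i)) m :=
  fun hm n σ s hs r hr => by
    obtain ⟨h1, h2, h3⟩ := h hm n σ s hs r hr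
    exact ⟨h1, ⟨h2, fun a ha i => hs ▸ p.exec_frame σ s r hr a ha i⟩, h3⟩

theorem skip (h : Q m) : Prog.skip.Ensures S V Q m := fun hm n σ s hs r hr => by
  rw [Prog.exec, Action.mem_support_step] at hr
  obtain ⟨s', hs', rfl⟩ := hr
  rw [PMF.mem_support_pure_iff] at hs'
  subst hs' hs
  exact ⟨hm, h, rfl, rfl, by simpa using (hm.bits_le).trans (Nat.le_add_right _ _)⟩

theorem write {a : ℕ} {i e : Expr} (ha : a < 30) (hi : i.eval m < S) (he : e.eval m < V)
    (h : Q (m.update (a, i.eval m) (e.eval m))) : (Prog.write a i e).Ensures S V Q m :=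
  fun hm n σ s hs r hr => by
    rw [Prog.exec, Action.mem_support_step] at hr
    obtain ⟨s', hs', rfl⟩ := hr
    rw [PMF.mem_support_pure_iff] at hs'
    subst hs' hs
    have hm' := hm.update ha hi he
    exact ⟨hm', h, rfl, rfl, (max_le hm.bits_le hm'.bits_le).trans (Nat.le_add_right _ _)⟩

theorem flip {a : ℕ} {i : Expr} (ha : a < 30) (hi : i.eval m < S) (hV : 1 < V)
    (h : ∀ b : Bool, Q (m.update (a, i.eval m) b.toNat)) : (Prog.flip a i).Ensures S V Q m :=
  fun hm n σ s hs r hr => by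
    rw [Prog.exec, Action.mem_support_step] at hr
    obtain ⟨s', hs', rfl⟩ := hr
    rw [PMF.mem_support_map_iff] at hs'
    obtain ⟨b, -, rfl⟩ := hs'
    subst hs
    have hm' := hm.update ha hi (x := b.toNat) (by cases b <;> simp <;> omega)
    exact ⟨hm', h b, rfl, rfl, (max_le hm.bits_le hm'.bits_le).trans (Nat.le_add_right _ _)⟩

/-- The postcondition of the first program is itself a triple for the second one, so proofs follow
the program text without naming intermediate assertions. -/
theorem seq (h : p.Ensures S V (q.Ensures S V Q) m) : (Prog.seq p q).Ensures S V Q m :=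
  fun hm n σ s hs r hr => by
    rw [Prog.exec, Action.mem_support_andThen] at hr
    obtain ⟨r₁, hr₁, r₂, hr₂, rfl⟩ := hr
    obtain ⟨a1, a2, a3, a4, a5⟩ := h hm n σ s hs r₁ hr₁
    obtain ⟨b1, b2, b3, b4, b5⟩ := a2 a1 n σ r₁.1 rfl r₂ hr₂
    refine ⟨b1, b2, b3.trans a3, b4.trans a4, max_le (a5.trans ?_) (b5.trans ?_)⟩ <;>
      simp only [Prog.depth] <;> gcongr <;> simp

theorem ite {e : Expr} (hp : e.eval m ≠ 0 → p.Ensures S V Q m)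
    (hq : e.eval m = 0 → q.Ensures S V Q m) : (Prog.ite e p q).Ensures S V Q m :=
  fun hm n σ s hs r hr => by
    rw [Prog.exec] at hr
    subst hs
    dsimp only at hr
    split at hr
    · rename_i he
      obtain ⟨b1, b2, b3, b4, b5⟩ := hp he hm n σ s rfl r hr
      refine ⟨b1, b2, b3, b4, b5.trans ?_⟩
      simp only [Prog.depth]; gcongr; simp
    · rename_i he
      obtain ⟨b1, b2, b3, b4, b5⟩ := hq (by simpa using he) hm n σ s rfl r hr
      refine ⟨b1, b2, b3, b4, b5.trans ?_⟩
      simp only [Prog.depth]; gcongr; simp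

theorem loop {e : Expr} (I : ℕ → Mem → Prop) (he : e.eval m < V) (h0 : I 0 m)
    (hI : ∀ i < e.eval m, ∀ m', I i m' → p.Ensures S V (I (i + 1)) m')
    (hQ : ∀ m', I (e.eval m) m' → Q m') : (Prog.loop e p).Ensures S V Q m :=
  fun hm n σ s hs r hr => by
    rw [Prog.exec, Action.mem_support_withExtra] at hr
    obtain ⟨r, hr, rfl⟩ := hr
    subst hs
    have := Action.repeated_support (f := p.exec σ) (b := fitBits S V + p.depth * Nat.size V)
      (fun i s' => s'.mem.Fits S V ∧ I i s'.mem ∧ s'.unread = s.unread ∧ s'.passes = s.passes)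
      (e.eval s.mem) (fun i _ s' hs' => hs'.1.bits_le.trans (Nat.le_add_right _ _))
      (fun i hi s' hs' r hr => by
        obtain ⟨b1, b2, b3, b4, b5⟩ := hI i hi s'.mem hs'.2.1 hs'.1 n σ s' rfl r hr
        exact ⟨⟨b1, b2, b3.trans hs'.2.2.1, b4.trans hs'.2.2.2⟩, b5⟩)
      s ⟨hm, h0, rfl, rfl⟩ r hr
    refine ⟨this.1.1, hQ _ this.1.2.1, this.1.2.2.1, this.1.2.2.2, ?_⟩
    -- The loop counter occupies at most this many further bits; this is the allowance that `depth`
    -- grants per nested loop.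
    have h2 : Nat.size (e.eval s.mem) ≤ Nat.size V := Nat.size_le_size he.le
    simp only [Prog.depth, add_mul, one_mul]
    omega

end Prog.Ensures

/-! ### Counted loops and passes as derived commands. -/

/-- `for v := 0 to e - 1 do p`; the loop variable is cell `0` of array `v`. -/
def Prog.forTo (v : ℕ) (e : Expr) (p : Prog) : Prog :=
  .seq (.write v (.const 0) (.const 0))
    (.loop e (.seq p (.write v (.const 0) (.add (.read v (.const 0)) (.const 1)))))

/-- The body is asked for the next invariant in the memory where the loop variable has already been
advanced, because the invariant may read any cell. -/
theorem Prog.Ensures.forTo {m : Mem} {Q : Mem → Prop} {p : Prog} {v : ℕ} {e : Expr}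
    (I : ℕ → Mem → Prop) (k : ℕ) (hk : e.eval (m.update (v, 0) 0) = k)
    (hv : v < 30) (hS : 0 < S) (hkV : k < V) (hvp : v ∉ p.mods)
    (h0 : I 0 (m.update (v, 0) 0))
    (hI : ∀ i < k, ∀ m', m' (v, 0) = i →
      (∀ a, a ≠ v → a ∉ p.mods → ∀ j, m' (a, j) = m (a, j)) → I i m' →
      p.Ensures S V (fun m'' => I (i + 1) (m''.update (v, 0) (i + 1))) m')
    (hQ : ∀ m', (∀ a, a ≠ v → a ∉ p.mods → ∀ j, m' (a, j) = m (a, j)) → I k m' → Q m') :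
    (Prog.forTo v e p).Ensures S V Q m := by
  refine .seq (.write hv hS (by simp only [Expr.eval]; omega) ?_)
  refine .loop (fun i m' => m' (v, 0) = i ∧
      (∀ a, a ≠ v → a ∉ p.mods → ∀ j, m' (a, j) = m (a, j)) ∧ I i m') ?_ ?_ ?_ ?_
  · simpa only [Expr.eval, hk] using hkV
  · refine ⟨by simp [Mem.update_eq, Expr.eval], fun a ha _ j => ?_, h0⟩
    simp [Mem.update_eq, ha]
  · simp only [Expr.eval, hk]
    rintro i hi m' ⟨h1, h2, h3⟩
    refine .seq ((hI i hi m' h1 h2 h3).frame.mono ?_)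
    rintro m'' ⟨h4, h5⟩
    have h6 := (h5 v hvp 0).trans h1
    refine .write hv hS (by simp only [Expr.eval, h6]; omega) ⟨?_, ?_, ?_⟩
    · simp [Mem.update_eq, Expr.eval, h6]
    · intro a ha hap j
      simp [Mem.update_eq, Expr.eval, ha, h5 a hap, h2 a ha hap]
    · simpa only [Expr.eval, h6] using h4
  · simp only [Expr.eval, hk]
    rintro m' ⟨-, h2, h3⟩
    exact hQ m' h2 h3

/-- From the configuration `s`, the program stays within the given number of bits, and ends in a
configuration that satisfies `Q` and has a memory within bounds. -/
def Prog.Leads (S V : ℕ) (σ : ℕ → List (Fin n × Fin n)) (p : Prog) (Q : Config n → Prop)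
    (s : Config n) : Prop :=
  s.mem.Fits S V → ∀ r ∈ (p.exec σ s).support,
    r.1.mem.Fits S V ∧ Q r.1 ∧ r.2 ≤ fitBits S V + p.depth * Nat.size V

namespace Prog.Leads

variable {σ : ℕ → List (Fin n × Fin n)} {s : Config n} {Q : Config n → Prop} {p q : Prog}

theorem of_ensures {R : Mem → Prop} (h : p.Ensures S V R s.mem)
    (hQ : ∀ m, R m → (∀ a ∉ p.mods, ∀ i, m (a, i) = s.mem (a, i)) →
      Q { mem := m, unread := s.unread, passes := s.passes }) : p.Leads S V σ Q s :=
  fun hm r hr => by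
    obtain ⟨h1, ⟨h2, h3⟩, h4, h5, h6⟩ := h.frame hm n σ s rfl r hr
    refine ⟨h1, ?_, h6⟩
    rw [← h4, ← h5] at hQ
    exact hQ _ h2 h3

theorem mono {Q' : Config n → Prop} (h : p.Leads S V σ Q s) (hQ : ∀ s', Q s' → Q' s') :
    p.Leads S V σ Q' s := fun hm r hr => by
  obtain ⟨h1, h2, h3⟩ := h hm r hr
  exact ⟨h1, hQ _ h2, h3⟩

theorem seq (h : p.Leads S V σ (q.Leads S V σ Q) s) : (Prog.seq p q).Leads S V σ Q s :=
  fun hm r hr => by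
    rw [Prog.exec, Action.mem_support_andThen] at hr
    obtain ⟨r₁, hr₁, r₂, hr₂, rfl⟩ := hr
    obtain ⟨a1, a2, a3⟩ := h hm r₁ hr₁
    obtain ⟨b1, b2, b3⟩ := a2 a1 r₂ hr₂
    refine ⟨b1, b2, max_le (a3.trans ?_) (b3.trans ?_)⟩ <;>
      simp only [Prog.depth] <;> gcongr <;> simp

end Prog.Leads

/-- Make a pass over the stream, executing `p` for every edge. -/
def Prog.pass (p : Prog) : Prog :=
  -- A stream has at most n² edges, so n² iterations exhaust it. Surplus iterations find a zero in
  -- cell `3` and do nothing.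
  .seq .startPass (.loop (.mul (.read 0 (.const 0)) (.read 0 (.const 0)))
    (.seq .nextEdge (.ite (.read 0 (.const 3)) p .skip)))

/-- The invariant `J l` describes the memory after the prefix `l` of the stream has been processed.
It must be insensitive to array `0`, which reading an edge overwrites. -/
theorem Prog.Leads.pass {σ : ℕ → List (Fin n × Fin n)} {s : Config n} {Q : Config n → Prop}
    {p : Prog} (J : List (Fin n × Fin n) → Mem → Prop) (hS : 3 < S) (hV : 1 < V)
    (hnV : n * n < V) (hp : 0 ∉ p.mods) (hlen : (σ s.passes).length ≤ n * n)
    (hn : s.mem (0, 0) = n) (h0 : J [] s.mem)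
    (hJ : ∀ l m m', (∀ a, a ≠ 0 → ∀ i, m' (a, i) = m (a, i)) → J l m → J l m')
    (hstep : ∀ l u v l', σ s.passes = l ++ (u, v) :: l' → ∀ m, m (0, 0) = n →
      m (0, 1) = u.val → m (0, 2) = v.val →
      (∀ a, a ≠ 0 → a ∉ p.mods → ∀ i, m (a, i) = s.mem (a, i)) → J l m →
      p.Ensures S V (J (l ++ [(u, v)])) m)
    (hQ : ∀ s', s'.passes = s.passes + 1 → s'.mem (0, 0) = n →
      (∀ a, a ≠ 0 → a ∉ p.mods → ∀ i, s'.mem (a, i) = s.mem (a, i)) →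
      J (σ s.passes) s'.mem → Q s') :
    (Prog.pass p).Leads S V σ Q s := by
  have hnn : n ≤ n * n := Nat.le_mul_self n
  have hd : (Prog.pass p).depth = p.depth + 1 := by simp [Prog.pass, Prog.depth]
  intro hm r hr
  rw [hd]
  simp only [Prog.pass, Prog.exec, Action.mem_support_andThen, Action.mem_support_step,
    PMF.mem_support_pure_iff, Action.mem_support_withExtra] at hr
  obtain ⟨_, ⟨_, rfl, rfl⟩, _, ⟨r, hr, rfl⟩, rfl⟩ := hr
  simp only [Expr.eval, hn] at hr ⊢
  have key := Action.repeated_support (b := fitBits S V + p.depth * Nat.size V)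
    (fun i s' => s'.mem.Fits S V ∧ s'.passes = s.passes + 1 ∧ s'.mem (0, 0) = n ∧
      (∀ a, a ≠ 0 → a ∉ p.mods → ∀ i, s'.mem (a, i) = s.mem (a, i)) ∧
      s'.unread = (σ s.passes).drop i ∧ J ((σ s.passes).take i) s'.mem) (n * n)
    (fun i _ s' hs' => hs'.1.bits_le.trans (Nat.le_add_right _ _)) ?_
    { mem := s.mem, unread := σ s.passes, passes := s.passes + 1 }
    ⟨hm, rfl, hn, fun _ _ _ _ => rfl, by simp, by simpa using h0⟩ r hr
  · obtain ⟨⟨k1, k2, k3, k4, k5, k6⟩, k7⟩ := key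
    refine ⟨k1, hQ _ k2 k3 k4 ?_, ?_⟩
    · rwa [List.take_of_length_le hlen] at k6
    · have h2 : Nat.size (n * n) ≤ Nat.size V := Nat.size_le_size hnV.le
      have h3 := hm.bits_le
      simp only [max_self]
      refine max_le (h3.trans (Nat.le_add_right _ _)) ?_
      rw [add_mul, one_mul]
      omega
  · rintro i hi s' ⟨k1, k2, k3, k4, k5, k6⟩ r hr
    simp only [Action.mem_support_andThen, Action.mem_support_step,
      PMF.mem_support_pure_iff] at hr
    obtain ⟨r₁, ⟨s₁, rfl, rfl⟩, r₂, hr₂, rfl⟩ := hr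
    rcases hdrop : (σ s.passes).drop i with _ | ⟨⟨u, v⟩, l'⟩
    · rw [hdrop] at k5
      have hr3 : readEdge s' = { s' with mem := s'.mem.update (0, 3) 0 } := by
        simp [readEdge, k5]
      have hfit := k1.update (a := 0) (i := 3) (x := 0) (by norm_num) hS (by omega)
      -- The stream is exhausted, so the processed prefix is already the whole stream and the
      -- invariant carries over unchanged.
      have htake : (σ s.passes).take (i + 1) = (σ s.passes).take i := by
        rw [List.drop_eq_nil_iff] at hdrop
        rw [List.take_of_length_le hdrop, List.take_of_length_le (by omega)]
      simp only [hr3, Mem.update_eq, and_self, if_true, ne_eq, not_true, if_false,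
        Action.mem_support_step, PMF.mem_support_pure_iff] at hr₂
      obtain ⟨s₂, rfl, rfl⟩ := hr₂
      simp only [hr3, max_self]
      have hb := hfit.bits_le
      have hb' := k1.bits_le
      refine ⟨⟨hfit, k2, ?_, ?_, ?_, ?_⟩, ?_⟩
      · simpa [Mem.update_eq] using k3
      · intro a ha hap j; simpa [Mem.update_eq, ha] using k4 a ha hap j
      · rw [k5, ← List.drop_drop, hdrop]; rfl
      · rw [htake]; exact hJ _ _ _ (fun a ha j => by simp [Mem.update_eq, ha]) k6
      · exact (max_le (max_le hb' hb) hb).trans (Nat.le_add_right _ _)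
    · rw [hdrop] at k5
      have hr3 : readEdge s' = { s' with
          mem := ((s'.mem.update (0, 1) u.val).update (0, 2) v.val).update (0, 3) 1
          unread := l' } := by
        simp [readEdge, k5]
      have hfit := ((k1.update (a := 0) (i := 1) (x := u.val) (by norm_num) (by omega)
        (u.2.trans_le hnn |>.trans hnV)).update (a := 0) (i := 2) (x := v.val) (by norm_num)
        (by omega) (v.2.trans_le hnn |>.trans hnV)).update (a := 0) (i := 3) (x := 1) (by norm_num)
        hS hV
      have htake : (σ s.passes).take (i + 1) = (σ s.passes).take i ++ [(u, v)] := by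
        rw [List.take_add, hdrop]; rfl
      have hsplit : σ s.passes = (σ s.passes).take i ++ (u, v) :: l' := by
        rw [← hdrop, List.take_append_drop]
      simp only [hr3, Mem.update_eq, and_self, if_true, ne_eq, one_ne_zero, not_false_eq_true] at hr₂
      have hJ' : J ((σ s.passes).take i)
          (((s'.mem.update (0, 1) u.val).update (0, 2) v.val).update (0, 3) 1) :=
        hJ _ _ _ (fun a ha j => by simp [Mem.update_eq, ha]) k6
      obtain ⟨b1, ⟨b2, b2'⟩, b3, b4, b5⟩ := (hstep _ u v l' hsplit _
        (by simpa [Mem.update_eq] using k3) (by simp [Mem.update_eq]) (by simp [Mem.update_eq])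
        (fun a ha hap j => by simpa [Mem.update_eq, ha] using k4 a ha hap j) hJ').frame
        hfit n σ _ rfl r₂ hr₂
      have hb := hfit.bits_le
      have hb' := k1.bits_le
      refine ⟨⟨b1, b4.trans k2, ?_, ?_, ?_, ?_⟩, ?_⟩
      · rw [b2' 0 hp]; simpa [Mem.update_eq] using k3
      · intro a ha hap j
        rw [b2' a hap]; simpa [Mem.update_eq, ha] using k4 a ha hap j
      · rw [b3, ← List.drop_drop, hdrop]; rfl
      · rw [htake]; exact b2
      · refine max_le ((max_le hb' ?_).trans (Nat.le_add_right _ _)) b5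
        rw [hr3]; exact hb

/-! ### Expectations -/

/-- The expectation of `F` after the action `f`. -/
noncomputable def Action.expect (f : Action n) (F : Config n → ℝ≥0∞) (s : Config n) : ℝ≥0∞ :=
  ∑' r, f s r * F r.1

theorem PMF.tsum_pure_mul {α : Type*} (a : α) (F : α → ℝ≥0∞) :
    ∑' r, (PMF.pure a) r * F r = F a := by
  rw [tsum_eq_single a]
  · simp
  · intro b hb; simp [hb]

theorem PMF.tsum_bind_mul {α β : Type*} (p : PMF α) (f : α → PMF β) (F : β → ℝ≥0∞) :
    ∑' r, (p.bind f) r * F r = ∑' a, p a * ∑' r, f a r * F r := by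
  simp only [PMF.bind_apply, ← ENNReal.tsum_mul_right, ← ENNReal.tsum_mul_left]
  rw [ENNReal.tsum_comm]
  simp only [mul_assoc]

theorem PMF.tsum_map_mul {α β : Type*} (p : PMF α) (f : α → β) (F : β → ℝ≥0∞) :
    ∑' r, (p.map f) r * F r = ∑' a, p a * F (f a) := by
  rw [← PMF.bind_pure_comp, PMF.tsum_bind_mul]
  simp only [Function.comp, PMF.tsum_pure_mul]

theorem Action.expect_step (f : Config n → PMF (Config n)) (F : Config n → ℝ≥0∞) (s : Config n) :
    (Action.step f).expect F s = ∑' s', f s s' * F s' := by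
  simp only [Action.expect, Action.step, PMF.tsum_map_mul]

theorem Action.expect_pure (f : Config n → Config n) (F : Config n → ℝ≥0∞) (s : Config n) :
    (Action.step fun s => PMF.pure (f s)).expect F s = F (f s) := by
  rw [Action.expect_step, PMF.tsum_pure_mul]

theorem Action.expect_andThen (f g : Action n) (F : Config n → ℝ≥0∞) (s : Config n) :
    (Action.andThen f g).expect F s = f.expect (g.expect F) s := by
  simp only [Action.expect, Action.andThen, PMF.tsum_bind_mul, PMF.tsum_map_mul]

theorem Action.expect_withExtra (b : ℕ) (f : Action n) (F : Config n → ℝ≥0∞) (s : Config n) :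
    (Action.withExtra b f).expect F s = f.expect F s := by
  simp only [Action.expect, Action.withExtra, PMF.tsum_map_mul]

theorem Prog.expect_flip (σ : ℕ → List (Fin n × Fin n)) (a : ℕ) (i : Expr)
    (F : Config n → ℝ≥0∞) (s : Config n) :
    ((Prog.flip a i).exec σ).expect F s =
      (F { s with mem := s.mem.update (a, i.eval s.mem) 0 } +
        F { s with mem := s.mem.update (a, i.eval s.mem) 1 }) / 2 := by
  rw [Prog.exec, Action.expect_step, PMF.tsum_map_mul, tsum_fintype]
  simp [div_eq_mul_inv, mul_add, mul_comm, add_comm]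

theorem Action.expect_le_of_support (f : Action n) (F : Config n → ℝ≥0∞) (s : Config n)
    (c : ℝ≥0∞) (h : ∀ r ∈ (f s).support, F r.1 ≤ c) : f.expect F s ≤ c := by
  calc f.expect F s ≤ ∑' r, f s r * c := by
        refine ENNReal.tsum_le_tsum fun r => ?_
        by_cases hr : r ∈ (f s).support
        · exact mul_le_mul_right (h r hr) _
        · rw [PMF.apply_eq_zero_iff _ _ |>.2 hr]; simp
    _ = c := by rw [ENNReal.tsum_mul_right, PMF.tsum_coe, one_mul]

/-- The average of `F` over all lists of length `k` of numbers below `N`. -/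
noncomputable def avg (N : ℕ) : ℕ → (List ℕ → ℝ≥0∞) → ℝ≥0∞
  | 0, F => F []
  | k + 1, F => (∑ x ∈ Finset.range N, avg N k fun l => F (x :: l)) / N

/-- Couples a loop with a list of draws: `Inv h s` says that `s` has realised the draws `h`.
Quantifying `hf` over all test functions expresses that each iteration adds a uniform draw
independent of the past, with the rest of the configuration left free. The induction peels off the
first draw. -/
theorem Action.expect_repeated_le {f : Action n} {N : ℕ} {F : Config n → ℝ≥0∞}
    (Inv : List ℕ → Config n → Prop) (k : ℕ) (h : List ℕ) (c : List ℕ → ℝ≥0∞)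
    (hf : ∀ h' s (F' : Config n → ℝ≥0∞) (c' : ℕ → ℝ≥0∞), h'.length < h.length + k → Inv h' s →
      (∀ x < N, ∀ s', Inv (h' ++ [x]) s' → F' s' ≤ c' x) →
      f.expect F' s ≤ (∑ x ∈ Finset.range N, c' x) / N)
    (s : Config n) (hs : Inv h s)
    (hF : ∀ l, l.length = k → (∀ x ∈ l, x < N) → ∀ s', Inv (h ++ l) s' → F s' ≤ c l) :
    (Action.repeated f k).expect F s ≤ avg N k c := by
  induction k generalizing h c s with
  | zero =>
    rw [Action.repeated, Action.expect_step, PMF.tsum_pure_mul]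
    exact hF [] rfl (by simp) s (by simpa using hs)
  | succ k ih =>
    rw [Action.repeated, Action.expect_andThen, avg]
    refine hf h s _ _ (by omega) hs fun x hx s' hs' => ?_
    refine ih (h ++ [x]) (fun l => c (x :: l)) ?_ s' hs' ?_
    · intro h' s F' c' hl
      refine hf h' s F' c' ?_
      simp only [List.length_append, List.length_singleton] at hl
      omega
    · intro l hl hlN s'' hs''
      refine hF (x :: l) (by simp [hl]) (by simpa using ⟨hx, hlN⟩) s'' (by simpa using hs'')

end CorrClust

/-! ### The ideal pivot process with full access to the graph: correctness, cost and number of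
relevant edges. -/

namespace CorrClust

/-! ### Averages -/

section Avg

variable {N : ℕ}

theorem avg_mono {k : ℕ} {F H : List ℕ → ℝ≥0∞} (h : ∀ l, l.length = k → F l ≤ H l) :
    avg N k F ≤ avg N k H := by
  induction k generalizing F H with
  | zero => exact h [] rfl
  | succ k ih =>
    refine ENNReal.div_le_div_right (Finset.sum_le_sum fun x _ => ih fun l hl => ?_) _
    exact h _ (by simp [hl])

theorem avg_add (k : ℕ) (F H : List ℕ → ℝ≥0∞) :
    avg N k (fun l => F l + H l) = avg N k F + avg N k H := by
  induction k generalizing F H with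
  | zero => rfl
  | succ k ih => simp only [avg, ih, Finset.sum_add_distrib, ENNReal.add_div]

theorem avg_const_mul (k : ℕ) (c : ℝ≥0∞) (F : List ℕ → ℝ≥0∞) :
    avg N k (fun l => c * F l) = c * avg N k F := by
  induction k generalizing F with
  | zero => rfl
  | succ k ih => simp only [avg, ih, ← Finset.mul_sum, mul_div_assoc]

theorem avg_const (hN : 0 < N) (k : ℕ) (c : ℝ≥0∞) : avg N k (fun _ => c) = c := by
  induction k with
  | zero => rfl
  | succ k ih =>
    simp only [avg, ih, Finset.sum_const, Finset.card_range, nsmul_eq_mul]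
    rw [mul_comm]
    exact ENNReal.mul_div_cancel_right (by simp [hN.ne']) (by simp)

theorem avg_sum {ι : Type*} (s : Finset ι) (k : ℕ) (F : ι → List ℕ → ℝ≥0∞) :
    avg N k (fun l => ∑ i ∈ s, F i l) = ∑ i ∈ s, avg N k (F i) := by
  classical
  induction s using Finset.induction_on with
  | empty =>
    simp only [Finset.sum_empty]
    simpa using avg_const_mul (N := N) k 0 (fun _ => 0)
  | insert a s ha ih => simp only [Finset.sum_insert ha, avg_add, ih]

theorem avg_append (a b : ℕ) (F : List ℕ → ℝ≥0∞) :
    avg N (a + b) F = avg N a fun l => avg N b fun l' => F (l ++ l') := by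
  induction a generalizing F with
  | zero => simp [avg]
  | succ a ih =>
    rw [Nat.succ_add]
    simp only [avg, ih, List.cons_append]

open Classical in
/-- Independent blocks of draws all fail with at most the product of the probabilities. -/
theorem avg_blocks_le {M : ℕ} (fail : List ℕ → Prop) (c : ℝ≥0∞)
    (h : avg N M (fun l => if fail l then 1 else 0) ≤ c) (T : ℕ) :
    avg N (T * M) (fun l => if ∀ t < T, fail ((l.drop (t * M)).take M) then 1 else 0) ≤ c ^ T := by
  induction T with
  | zero => simp [avg]
  | succ T ih =>
    rw [Nat.succ_mul, add_comm, avg_append]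
    -- Condition on the first block. If it succeeds the indicator vanishes; if it fails the
    -- remaining blocks are handled by induction.
    calc _ ≤ avg N M (fun l => c ^ T * if fail l then 1 else 0) := by
          refine avg_mono fun l hl => ?_
          by_cases hf : fail l
          · simp only [hf, if_true, mul_one]
            refine le_trans (avg_mono fun l' _ => ?_) ih
            split_ifs with h1 h2
            · exact le_rfl
            · refine absurd (fun t ht => ?_) h2
              have := h1 (t + 1) (by omega)
              rwa [Nat.succ_mul, add_comm, ← hl, List.drop_length_add_append, hl] at this
            · exact zero_le
            · exact le_rfl
          · simp only [hf, if_false, mul_zero]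
            -- Zero is written as a product so that its average can be evaluated without assuming `0
            -- < N`.
            refine le_trans (avg_mono (H := fun _ => 0 * 0) fun l' _ => ?_)
              (by rw [avg_const_mul, zero_mul])
            rw [if_neg]
            · simp
            · intro h1
              have := h1 0 (by omega)
              rw [Nat.zero_mul, List.drop_zero, ← hl, List.take_left] at this
              exact hf this
      _ ≤ _ := by
          rw [avg_const_mul, pow_succ]
          exact mul_le_mul_right h _

end Avg

/-! ### The truncated pivot process

A label `0` means that a vertex is alive, a label `w + 1` that it has been put into the cluster
named after the vertex `w`. -/

section Pivots

variable {n : ℕ}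

/-- The drawn number `x` is an alive vertex, and `u` is alive and equal or related to it. -/
def Captured (R : Fin n → Fin n → Prop) (x : ℕ) (lab : Fin n → ℕ) (u : Fin n) : Prop :=
  lab u = 0 ∧ ∃ w : Fin n, w.val = x ∧ lab w = 0 ∧ (u = w ∨ R w u)

open Classical in
noncomputable def pivotLabel (R : Fin n → Fin n → Prop) (x : ℕ) (lab : Fin n → ℕ) : Fin n → ℕ :=
  fun u => if Captured R x lab u then x + 1 else lab u

/-- Make every alive vertex of degree `d` with `M ≤ j * (d + 1)` a singleton. -/
def isolateLabel (d : Fin n → ℕ) (M j : ℕ) (lab : Fin n → ℕ) : Fin n → ℕ :=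
  fun u => if lab u = 0 ∧ M ≤ j * (d u + 1) then u.val + 1 else lab u

noncomputable def stepLabel (R : Fin n → Fin n → Prop) (d : Fin n → ℕ) (M j x : ℕ)
    (lab : Fin n → ℕ) : Fin n → ℕ :=
  isolateLabel d M (j + 1) (pivotLabel R x lab)

noncomputable def runLabel (R : Fin n → Fin n → Prop) (d : Fin n → ℕ) (M : ℕ) :
    ℕ → List ℕ → (Fin n → ℕ) → (Fin n → ℕ)
  | _, [], lab => lab
  | j, x :: l, lab => runLabel R d M (j + 1) l (stepLabel R d M j x lab)

/-- `runLabel` consumes its list from the front, whereas the program extends the processed draws at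
the end; this is the bridge. -/
theorem runLabel_append_singleton (R : Fin n → Fin n → Prop) (d : Fin n → ℕ) (M j : ℕ) (l : List ℕ)
    (x : ℕ) (lab : Fin n → ℕ) :
    runLabel R d M j (l ++ [x]) lab = stepLabel R d M (j + l.length) x (runLabel R d M j l lab) := by
  induction l generalizing j lab with
  | nil => rfl
  | cons y l ih =>
    simp only [List.cons_append, runLabel, ih, List.length_cons]
    congr 1
    omega

/-- Every cluster contains the vertex it is named after. -/
def Proper (lab : Fin n → ℕ) : Prop := ∀ u, lab u ≠ 0 → ∃ w : Fin n, lab u = w.val + 1 ∧ lab w = lab u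

/-- Alive vertices of degree `d` are within their time limit. -/
def Timely (d : Fin n → ℕ) (M j : ℕ) (lab : Fin n → ℕ) : Prop :=
  ∀ u, lab u = 0 → j * (d u + 1) < M

theorem pivotLabel_eq_zero {R : Fin n → Fin n → Prop} {x : ℕ} {lab : Fin n → ℕ} {u : Fin n} :
    pivotLabel R x lab u = 0 ↔ lab u = 0 ∧ ¬ Captured R x lab u := by
  unfold pivotLabel
  split_ifs with h <;> simp [h]

theorem stepLabel_eq_zero {R : Fin n → Fin n → Prop} {d : Fin n → ℕ} {M j x : ℕ}
    {lab : Fin n → ℕ} {u : Fin n} :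
    stepLabel R d M j x lab u = 0 ↔
      pivotLabel R x lab u = 0 ∧ (j + 1) * (d u + 1) < M := by
  unfold stepLabel isolateLabel
  split_ifs with h
  · simp [h.2]
  · constructor
    · intro h0; exact ⟨h0, by by_contra hc; exact h ⟨h0, not_lt.1 hc⟩⟩
    · exact fun h0 => h0.1

/-- Nothing is assumed about the previous labels: the isolation itself removes all vertices that are
over their limit. -/
theorem Timely.stepLabel {R : Fin n → Fin n → Prop} {d : Fin n → ℕ} {M j x : ℕ}
    {lab : Fin n → ℕ} : Timely d M (j + 1) (stepLabel R d M j x lab) :=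
  fun _ hu => (stepLabel_eq_zero.1 hu).2

/-- The pivot captures itself, so the new cluster contains its name-giver. The name-giver of an
older cluster is not alive and so never changes its label. -/
theorem Proper.pivotLabel {R : Fin n → Fin n → Prop} {x : ℕ} {lab : Fin n → ℕ} (h : Proper lab) :
    Proper (pivotLabel R x lab) := by
  intro u hu
  by_cases hc : Captured R x lab u
  · obtain ⟨w, hw, hw0, -⟩ := hc.2
    refine ⟨w, by simp [CorrClust.pivotLabel, hc, hw], ?_⟩
    have : Captured R x lab w := ⟨hw0, w, hw, hw0, Or.inl rfl⟩
    simp [CorrClust.pivotLabel, hc, this]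
  · have e : CorrClust.pivotLabel R x lab u = lab u := by simp [CorrClust.pivotLabel, hc]
    rw [e] at hu ⊢
    obtain ⟨w, hw, hw'⟩ := h u hu
    refine ⟨w, hw, ?_⟩
    have : ¬ Captured R x lab w := fun hcw => hu (hw' ▸ hcw.1)
    simp [CorrClust.pivotLabel, this, hw']

theorem Proper.isolateLabel {d : Fin n → ℕ} {M j : ℕ} {lab : Fin n → ℕ} (h : Proper lab) :
    Proper (isolateLabel d M j lab) := by
  intro u hu
  unfold CorrClust.isolateLabel at hu ⊢
  split_ifs at hu ⊢ with hc
  · exact ⟨u, rfl, by rw [if_pos hc]⟩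
  · obtain ⟨w, hw, hw'⟩ := h u hu
    refine ⟨w, hw, ?_⟩
    rw [if_neg, hw']
    exact fun hcw => hu (hw' ▸ hcw.1)

theorem Proper.stepLabel {R : Fin n → Fin n → Prop} {d : Fin n → ℕ} {M j x : ℕ}
    {lab : Fin n → ℕ} (h : Proper lab) : Proper (stepLabel R d M j x lab) :=
  h.pivotLabel.isolateLabel

theorem Timely.runLabel {R : Fin n → Fin n → Prop} {d : Fin n → ℕ} {M j : ℕ} {l : List ℕ}
    {lab : Fin n → ℕ} (h : Timely d M j lab) : Timely d M (j + l.length) (runLabel R d M j l lab) := by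
  induction l generalizing j lab with
  | nil => exact h
  | cons x l ih =>
    have := ih (j := j + 1) (Timely.stepLabel (R := R) (d := d) (M := M) (j := j) (x := x) (lab := lab))
    rw [List.length_cons]
    rwa [show j + (l.length + 1) = j + 1 + l.length by omega]

/-- Only relations between a drawn vertex and a vertex within its time limit matter. -/
theorem runLabel_congr {R R' : Fin n → Fin n → Prop} {d : Fin n → ℕ} {M j : ℕ} {l : List ℕ}
    {lab : Fin n → ℕ} (ht : Timely d M j lab)
    (h : ∀ i (hi : i < l.length), ∀ w u : Fin n, w.val = l[i] → (j + i) * (d u + 1) < M →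
      (R w u ↔ R' w u)) :
    runLabel R d M j l lab = runLabel R' d M j l lab := by
  induction l generalizing j lab with
  | nil => rfl
  | cons x l ih =>
    have hC : ∀ u, Captured R x lab u ↔ Captured R' x lab u := by
      intro u
      refine and_congr_right fun hu => exists_congr fun w => and_congr_right fun hw =>
        and_congr_right fun _ => or_congr Iff.rfl ?_
      -- An alive vertex is within its time limit, so the agreement of the two relations covers it.
      exact h 0 (by simp) w u (by simpa using hw) (by simpa using ht u hu)
    have hp : pivotLabel R x lab = pivotLabel R' x lab := by
      funext u; by_cases h1 : Captured R' x lab u <;> simp [pivotLabel, h1, hC u]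
    have hs : stepLabel R d M j x lab = stepLabel R' d M j x lab := by
      simp only [stepLabel, hp]
    simp only [runLabel, hs]
    refine ih Timely.stepLabel fun i hi w u hw hlt => ?_
    refine h (i + 1) (by simpa using hi) w u (by simpa using hw) ?_
    rwa [show j + (i + 1) = j + 1 + i by omega]

end Pivots

/-! ### The cost of the process -/

section Cost

open scoped Classical

variable {n : ℕ} (G : SimpleGraph (Fin n))

/-- The number of neighbours of `u`. -/
noncomputable def deg (u : Fin n) : ℕ := ∑ v, if G.Adj u v then 1 else 0

noncomputable def aliveDeg (lab : Fin n → ℕ) (u : Fin n) : ℕ :=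
  ∑ v, if G.Adj u v ∧ lab v = 0 then 1 else 0

/-- The pair `u`, `v` of alive vertices becomes a disagreement when `x` is drawn as pivot. -/
def PivotPair (x : ℕ) (lab : Fin n → ℕ) (u v : Fin n) : Prop :=
  (G.Adj u v ∧ lab u = 0 ∧ lab v = 0 ∧ ¬ (Captured G.Adj x lab u ↔ Captured G.Adj x lab v)) ∨
  (u ≠ v ∧ ¬ G.Adj u v ∧ Captured G.Adj x lab u ∧ Captured G.Adj x lab v)

noncomputable def pivotCost (x : ℕ) (lab : Fin n → ℕ) : ℕ :=
  ∑ u, ∑ v, if PivotPair G x lab u v then 1 else 0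

noncomputable def pairPot (lab : Fin n → ℕ) (u v : Fin n) : ℕ :=
  if G.Adj u v then (if lab u = lab v then 0 else if lab u = 0 ∨ lab v = 0 then 2 else 1)
  else if u ≠ v ∧ lab u = lab v ∧ lab u ≠ 0 then 1 else 0

/-- Twice the number of disagreements so far, plus twice the number of edges between alive and
other vertices. -/
noncomputable def pot (lab : Fin n → ℕ) : ℕ := ∑ u, ∑ v, pairPot G lab u v

variable {G}

theorem pairPot_pivotLabel_le {x : ℕ} {lab : Fin n → ℕ} (h : Proper lab) (u v : Fin n) :
    pairPot G (pivotLabel G.Adj x lab) u v ≤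
      pairPot G lab u v + 2 * if PivotPair G x lab u v then 1 else 0 := by
  -- The label of the new cluster is fresh: a vertex already carrying it would force the pivot to
  -- carry it too, but the pivot is alive.
  have key : ∀ u v : Fin n, Captured G.Adj x lab u → lab v ≠ x + 1 := by
    rintro u v ⟨-, w, hw, hw0, -⟩ hv
    obtain ⟨w', hw', hw''⟩ := h v (by omega)
    have : w' = w := Fin.ext (by omega)
    subst this
    omega
  by_cases hu : Captured G.Adj x lab u <;> by_cases hv : Captured G.Adj x lab v
  · by_cases ha : G.Adj u v
    · simp [pairPot, pivotLabel, hu, hv, ha]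
    · by_cases he : u = v <;> simp [pairPot, pivotLabel, hu, hv, ha, PivotPair, he]
  · have h1 := key u v hu
    have h2 := hu.1
    by_cases ha : G.Adj u v
    · by_cases h0 : lab v = 0
      · simp [pairPot, pivotLabel, hu, hv, ha, PivotPair, h0, h2]
      · simp [pairPot, pivotLabel, hu, hv, ha, h0, h2, h1.symm, Ne.symm h0]
        omega
    · simp [pairPot, pivotLabel, hu, hv, ha, h1.symm]
  · have h1 := key v u hv
    have h2 := hv.1
    by_cases ha : G.Adj u v
    · by_cases h0 : lab u = 0
      · simp [pairPot, pivotLabel, hu, hv, ha, PivotPair, h0, h2]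
      · simp [pairPot, pivotLabel, hu, hv, ha, h0, h2, h1]
        omega
    · simp [pairPot, pivotLabel, hu, hv, ha, h1]
  · simp [pairPot, pivotLabel, hu, hv]

theorem pot_pivotLabel_le {x : ℕ} {lab : Fin n → ℕ} (h : Proper lab) :
    pot G (pivotLabel G.Adj x lab) ≤ pot G lab + 2 * pivotCost G x lab := by
  simp only [pot, pivotCost, Finset.mul_sum, ← Finset.sum_add_distrib]
  exact Finset.sum_le_sum fun u _ => Finset.sum_le_sum fun v _ => by
    simpa using pairPot_pivotLabel_le h u v

/-- Isolating an endpoint settles an edge to a dead vertex, lowering its potential from 2 to 1. It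
raises that of an edge to an alive vertex from 0 to at most 2. The gains are kept on the left so
that they can be summed separately. -/
theorem pairPot_isolateLabel_le {d : Fin n → ℕ} {M j : ℕ} {lab : Fin n → ℕ} (h : Proper lab)
    (u v : Fin n) :
    pairPot G (isolateLabel d M j lab) u v +
      (if G.Adj u v ∧ (lab u = 0 ∧ M ≤ j * (d u + 1)) ∧ lab v ≠ 0 then 1 else 0) +
      (if G.Adj u v ∧ (lab v = 0 ∧ M ≤ j * (d v + 1)) ∧ lab u ≠ 0 then 1 else 0) ≤
    pairPot G lab u v +
      2 * (if G.Adj u v ∧ (lab u = 0 ∧ M ≤ j * (d u + 1)) ∧ lab v = 0 then 1 else 0) +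
      2 * (if G.Adj u v ∧ (lab v = 0 ∧ M ≤ j * (d v + 1)) ∧ lab u = 0 then 1 else 0) := by
  have key : ∀ u v : Fin n, lab u = 0 → lab v ≠ u + 1 := by
    intro u v hu hv
    obtain ⟨w', hw', hw''⟩ := h v (by omega)
    have : w' = u := Fin.ext (by omega)
    subst this
    omega
  have k1 := key u v
  have k2 := key v u
  have hext : (u : ℕ) = v → u = v := Fin.ext
  by_cases ha : G.Adj u v
  · have hne' : (u : ℕ) ≠ v := fun h => ha.ne (hext h)
    simp only [pairPot, isolateLabel, ha, if_true, true_and]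
    by_cases hA : M ≤ j * (d u + 1) <;> by_cases hB : M ≤ j * (d v + 1) <;>
      by_cases hu : lab u = 0 <;> by_cases hv : lab v = 0 <;>
      simp [hA, hB, hu, hv, hne'] <;> grind
  · simp only [pairPot, isolateLabel, ha, if_false, false_and]
    by_cases hA : M ≤ j * (d u + 1) <;> by_cases hB : M ≤ j * (d v + 1) <;>
      by_cases hu : lab u = 0 <;> by_cases hv : lab v = 0 <;>
      simp [hA, hB, hu, hv] <;> grind

theorem deg_eq_aliveDeg_add (lab : Fin n → ℕ) (u : Fin n) :
    deg G u = aliveDeg G lab u + ∑ v, if G.Adj u v ∧ lab v ≠ 0 then 1 else 0 := by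
  simp only [deg, aliveDeg, ← Finset.sum_add_distrib]
  refine Finset.sum_congr rfl fun v _ => ?_
  by_cases h1 : G.Adj u v <;> by_cases h2 : lab v = 0 <;> simp [h1, h2]

/-- If at most a third of the neighbours are alive, the dead ones are at least twice as many. The
unit gained on each edge to them pays the two units lost on each edge to an alive one. -/
theorem pot_isolateLabel_le {d : Fin n → ℕ} {M j : ℕ} {lab : Fin n → ℕ} (h : Proper lab)
    (hb : ∀ u, lab u = 0 → M ≤ j * (d u + 1) → 3 * aliveDeg G lab u ≤ deg G u) :
    pot G (isolateLabel d M j lab) ≤ pot G lab := by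
  -- Exchanging the two vertices turns the terms for the second endpoint into those for the first.
  have h0 : (∑ u, ∑ v, if G.Adj u v ∧ (lab v = 0 ∧ M ≤ j * (d v + 1)) ∧ lab u ≠ 0
      then 1 else 0) = ∑ u, ∑ v, if G.Adj u v ∧ (lab u = 0 ∧ M ≤ j * (d u + 1)) ∧ lab v ≠ 0
      then 1 else 0 := by
    rw [Finset.sum_comm]
    simp only [G.adj_comm]
  have h1 : (∑ u, ∑ v, if G.Adj u v ∧ (lab v = 0 ∧ M ≤ j * (d v + 1)) ∧ lab u = 0
      then 1 else 0) = ∑ u, ∑ v, if G.Adj u v ∧ (lab u = 0 ∧ M ≤ j * (d u + 1)) ∧ lab v = 0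
      then 1 else 0 := by
    rw [Finset.sum_comm]
    simp only [G.adj_comm]
  have h2 := Finset.sum_le_sum fun u (_ : u ∈ Finset.univ) =>
    Finset.sum_le_sum fun v (_ : v ∈ Finset.univ) =>
      pairPot_isolateLabel_le (G := G) (d := d) (M := M) (j := j) h u v
  simp only [Finset.sum_add_distrib, ← Finset.mul_sum] at h2
  rw [h0, h1] at h2
  have h3 : 2 * (∑ u, ∑ v, if G.Adj u v ∧ (lab u = 0 ∧ M ≤ j * (d u + 1)) ∧ lab v = 0
      then 1 else 0) ≤ ∑ u, ∑ v, if G.Adj u v ∧ (lab u = 0 ∧ M ≤ j * (d u + 1)) ∧ lab v ≠ 0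
      then 1 else 0 := by
    rw [Finset.mul_sum]
    refine Finset.sum_le_sum fun u _ => ?_
    by_cases hu : lab u = 0 ∧ M ≤ j * (d u + 1)
    · have h4 := hb u hu.1 hu.2
      have h5 := deg_eq_aliveDeg_add (G := G) lab u
      simp only [hu, true_and, and_true]
      simp only [aliveDeg] at h4 h5
      omega
    · simp [hu]
  simp only [pot]
  omega

variable (G) in
/-- The total cost of the pivot steps. -/
noncomputable def pivotCostRun (M : ℕ) : ℕ → List ℕ → (Fin n → ℕ) → ℕ
  | _, [], _ => 0
  | j, x :: l, lab =>
    pivotCost G x lab + pivotCostRun M (j + 1) l (stepLabel G.Adj (deg G) M j x lab)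

variable (G) in
/-- In the `j`-th step, the vertex `u` is isolated although many of its neighbours are alive. -/
def BadAt (M : ℕ) (u : Fin n) (j x : ℕ) (lab : Fin n → ℕ) : Prop :=
  pivotLabel G.Adj x lab u = 0 ∧ M ≤ (j + 1) * (deg G u + 1) ∧
    deg G u < 3 * aliveDeg G (pivotLabel G.Adj x lab) u

variable (G) in
def BadRun (M : ℕ) (u : Fin n) : ℕ → List ℕ → (Fin n → ℕ) → Prop
  | _, [], _ => False
  | j, x :: l, lab =>
    BadAt G M u j x lab ∨ BadRun M u (j + 1) l (stepLabel G.Adj (deg G) M j x lab)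

/-- Without bad isolations only the pivots raise the potential. -/
theorem pot_runLabel_le {M j : ℕ} {l : List ℕ} {lab : Fin n → ℕ} (h : Proper lab)
    (hb : ∀ u, ¬ BadRun G M u j l lab) :
    pot G (runLabel G.Adj (deg G) M j l lab) ≤ pot G lab + 2 * pivotCostRun G M j l lab := by
  induction l generalizing j lab with
  | nil => simp [runLabel, pivotCostRun]
  | cons x l ih =>
    simp only [BadRun, not_or] at hb
    have h1 := ih (j := j + 1) (h.stepLabel (R := G.Adj) (d := deg G) (M := M) (j := j) (x := x))
      fun u => (hb u).2
    have h2 : pot G (stepLabel G.Adj (deg G) M j x lab) ≤ pot G (pivotLabel G.Adj x lab) := by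
      refine pot_isolateLabel_le h.pivotLabel fun u hu hM => ?_
      by_contra hc
      exact (hb u).1 ⟨hu, hM, not_le.1 hc⟩
    have h3 := pot_pivotLabel_le (G := G) (x := x) h
    simp only [runLabel, pivotCostRun]
    omega

theorem sum_sum_eq_two_mul_ncard (D : Fin n → Fin n → Prop) [∀ u v, Decidable (D u v)] (hs : ∀ u v, D u v → D v u)
    (hi : ∀ u, ¬ D u u) :
    (∑ u, ∑ v, if D u v then 1 else 0) = 2 * {e : Fin n × Fin n | e.1 < e.2 ∧ D e.1 e.2}.ncard := by
  have h1 : {e : Fin n × Fin n | e.1 < e.2 ∧ D e.1 e.2}.ncard =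
      ∑ u, ∑ v, if u < v ∧ D u v then 1 else 0 := by
    rw [← Fintype.sum_prod_type' (f := fun u v => if u < v ∧ D u v then 1 else 0),
      Finset.sum_boole, Nat.cast_id, Set.ncard_eq_toFinset_card']
    congr 1
    ext e; simp
  have h2 : (∑ u, ∑ v, if D u v then 1 else 0) =
      (∑ u, ∑ v, if u < v ∧ D u v then 1 else 0) + ∑ u, ∑ v, if v < u ∧ D v u then 1 else 0 := by
    simp only [← Finset.sum_add_distrib]
    refine Finset.sum_congr rfl fun u _ => Finset.sum_congr rfl fun v _ => ?_
    have hiff : D v u ↔ D u v := ⟨hs v u, hs u v⟩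
    rcases lt_trichotomy u v with h | h | h
    · simp [h, h.not_gt]
    · subst h; simp [hi]
    · simp [h, h.not_gt, hiff]
  rw [h2, Finset.sum_comm (f := fun u v => if v < u ∧ D v u then 1 else 0), h1]
  omega

variable (G) in
def Disagree (P : Setoid (Fin n)) (u v : Fin n) : Prop :=
  u ≠ v ∧ ((G.Adj u v ∧ ¬ P u v) ∨ (¬ G.Adj u v ∧ P u v))

/-- Sums over ordered pairs are symmetric and easier to rearrange than sums over u < v; the price is
a factor 2 throughout. -/
theorem sum_disagree (P : Setoid (Fin n)) :
    (∑ u, ∑ v, if Disagree G P u v then 1 else 0) = 2 * cost G P := by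
  have e : (∑ u, ∑ v, if Disagree G P u v then 1 else 0) =
      (∑ u, ∑ v, if G.Adj u v ∧ ¬ P u v then 1 else 0) +
        ∑ u, ∑ v, if u ≠ v ∧ ¬ G.Adj u v ∧ P u v then 1 else 0 := by
    simp only [← Finset.sum_add_distrib]
    refine Finset.sum_congr rfl fun u _ => Finset.sum_congr rfl fun v _ => ?_
    by_cases ha : G.Adj u v
    · simp [Disagree, ha, ha.ne]
    · simp [Disagree, ha]
  have hP : ∀ u v, P u v → P v u := fun u v h => P.symm h
  rw [e, sum_sum_eq_two_mul_ncard _ (fun u v h => ⟨h.1.symm, fun h' => h.2 (hP _ _ h')⟩) (by simp),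
    sum_sum_eq_two_mul_ncard _ (fun u v h => ⟨h.1.symm, fun h' => h.2.1 h'.symm, hP _ _ h.2.2⟩)
      (by simp), cost, mul_add]
  congr 4
  ext ⟨u, v⟩
  exact ⟨fun h => ⟨h.1, h.2.2⟩, fun h => ⟨h.1, h.1.ne, h.2⟩⟩

theorem pot_eq_two_mul_cost {lab : Fin n → ℕ} (h : ∀ u, lab u ≠ 0) :
    pot G lab = 2 * cost G (Setoid.ker lab) := by
  rw [← sum_disagree]
  refine Finset.sum_congr rfl fun u _ => Finset.sum_congr rfl fun v _ => ?_
  by_cases ha : G.Adj u v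
  · have hne := ha.ne
    by_cases he : lab u = lab v <;>
      simp [pairPot, Disagree, ha, hne, Setoid.ker_def, h, he]
  · by_cases he : lab u = lab v <;> simp [pairPot, Disagree, ha, Setoid.ker_def, h, he]

/-! ### The expected cost of the pivots -/

variable (G) in
/-- The number of ordered pairs of alive vertices that are disagreements of `Q`. -/
noncomputable def aliveDisagree (Q : Setoid (Fin n)) (lab : Fin n → ℕ) : ℕ :=
  ∑ u, ∑ v, if lab u = 0 ∧ lab v = 0 ∧ Disagree G Q u v then 1 else 0

theorem sum_range_eq_sum_fin {α : Type*} [AddCommMonoid α] {N : ℕ} (hN : n ≤ N) (F : ℕ → α)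
    (hF : ∀ x, n ≤ x → F x = 0) : ∑ x ∈ Finset.range N, F x = ∑ w : Fin n, F w := by
  rw [← Finset.sum_range]
  symm
  refine Finset.sum_subset (Finset.range_mono hN) fun x _ hx => hF x ?_
  simpa using hx

variable (G) in
/-- The alive vertices `u`, `v`, `w` span exactly two edges. -/
def BadTriangle (lab : Fin n → ℕ) (w u v : Fin n) : Prop :=
  (lab w = 0 ∧ lab u = 0 ∧ lab v = 0) ∧
  ((G.Adj w u ∧ G.Adj u v ∧ ¬ G.Adj w v ∧ w ≠ v) ∨ (G.Adj w u ∧ G.Adj w v ∧ ¬ G.Adj u v ∧ u ≠ v) ∨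
    (G.Adj w v ∧ G.Adj u v ∧ ¬ G.Adj w u ∧ w ≠ u))

theorem BadTriangle.rotate {lab : Fin n → ℕ} {w u v : Fin n} (h : BadTriangle G lab w u v) :
    BadTriangle G lab v w u := by
  obtain ⟨⟨h1, h2, h3⟩, ⟨a, b, c, e⟩ | ⟨a, b, c, e⟩ | ⟨a, b, c, e⟩⟩ := h
  · exact ⟨⟨h3, h1, h2⟩, Or.inr (Or.inr ⟨b.symm, a, fun h => c h.symm, e.symm⟩)⟩
  · exact ⟨⟨h3, h1, h2⟩, Or.inl ⟨b.symm, a, fun h => c h.symm, e.symm⟩⟩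
  · exact ⟨⟨h3, h1, h2⟩, Or.inr (Or.inl ⟨a.symm, b.symm, c, e⟩)⟩

theorem badTriangle_rotate {lab : Fin n → ℕ} {w u v : Fin n} :
    BadTriangle G lab v w u ↔ BadTriangle G lab w u v :=
  ⟨fun h => h.rotate.rotate, BadTriangle.rotate⟩

theorem captured_fin {R : Fin n → Fin n → Prop} {lab : Fin n → ℕ} {w u : Fin n} :
    Captured R w.val lab u ↔ lab u = 0 ∧ lab w = 0 ∧ (u = w ∨ R w u) := by
  constructor
  · rintro ⟨h, w', hw, h'⟩
    obtain rfl := Fin.ext hw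
    exact ⟨h, h'⟩
  · rintro ⟨h, h'⟩
    exact ⟨h, w, rfl, h'⟩

theorem not_captured_of_le {R : Fin n → Fin n → Prop} {lab : Fin n → ℕ} {x : ℕ} (hx : n ≤ x)
    (u : Fin n) : ¬ Captured R x lab u := by
  rintro ⟨-, w, hw, -⟩
  have := w.2
  omega

/-- A pair containing the pivot is never charged, as the pivot takes exactly its alive neighbours.
So the three vertices are distinct: either the pivot is joined to exactly one end of an edge, or to
both ends of a non-edge. -/
theorem PivotPair.badTriangle {lab : Fin n → ℕ} {w u v : Fin n} (h : PivotPair G w.val lab u v) :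
    BadTriangle G lab w u v := by
  simp only [PivotPair, captured_fin] at h
  have h1 := G.adj_comm u v
  have h2 := G.adj_comm w v
  have h3 := G.adj_comm w u
  have h4 : ∀ x, ¬ G.Adj x x := fun x => G.irrefl
  unfold BadTriangle
  by_cases e1 : u = w
  · subst e1; by_cases e2 : v = u <;> grind
  · by_cases e2 : v = w
    · subst e2; grind
    · grind

/-- A clustering that respects both edges puts all three vertices together and then errs on the
missing edge. -/
theorem BadTriangle.disagree {lab : Fin n → ℕ} {w u v : Fin n} (h : BadTriangle G lab w u v)
    (Q : Setoid (Fin n)) : Disagree G Q u v ∨ Disagree G Q w u ∨ Disagree G Q v w := by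
  have q4 : Q w v → Q v w := fun h => Q.symm h
  obtain ⟨-, ⟨a, b, c, e⟩ | ⟨a, b, c, e⟩ | ⟨a, b, c, e⟩⟩ := h
  · by_cases h1 : Q u v
    · by_cases h2 : Q w u
      · exact Or.inr (Or.inr ⟨e.symm, Or.inr ⟨fun h => c h.symm, q4 (Q.trans h2 h1)⟩⟩)
      · exact Or.inr (Or.inl ⟨a.ne, Or.inl ⟨a, h2⟩⟩)
    · exact Or.inl ⟨b.ne, Or.inl ⟨b, h1⟩⟩
  · by_cases h1 : Q w u
    · by_cases h2 : Q v w
      · exact Or.inl ⟨e, Or.inr ⟨c, Q.symm (Q.trans h2 h1)⟩⟩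
      · exact Or.inr (Or.inr ⟨b.ne', Or.inl ⟨b.symm, h2⟩⟩)
    · exact Or.inr (Or.inl ⟨a.ne, Or.inl ⟨a, h1⟩⟩)
  · by_cases h1 : Q u v
    · by_cases h2 : Q v w
      · exact Or.inr (Or.inl ⟨e, Or.inr ⟨c, Q.symm (Q.trans h1 h2)⟩⟩)
      · exact Or.inr (Or.inr ⟨a.ne', Or.inl ⟨a.symm, h2⟩⟩)
    · exact Or.inl ⟨b.ne, Or.inl ⟨b, h1⟩⟩

theorem BadTriangle.captured {lab : Fin n → ℕ} {w u v : Fin n} (h : BadTriangle G lab w u v) :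
    Captured G.Adj w.val lab u ∨ Captured G.Adj w.val lab v := by
  simp only [captured_fin]
  unfold BadTriangle at h
  tauto

/-- Charge each triangle to a pair on which `Q` errs. Since bad triangles are invariant under
rotation, the three possible positions of that pair contribute equally once summed over all pivots,
so it may be taken opposite to the pivot at the price of a factor 3. The pivot then captures an
endpoint of it. -/
theorem sum_pivotCost_le (Q : Setoid (Fin n)) (lab : Fin n → ℕ) :
    ∑ w : Fin n, pivotCost G w lab ≤ 3 * ∑ w : Fin n, ∑ u, ∑ v,
      if (lab u = 0 ∧ lab v = 0 ∧ Disagree G Q u v) ∧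
        (Captured G.Adj w.val lab u ∨ Captured G.Adj w.val lab v) then 1 else 0 := by
  calc ∑ w : Fin n, pivotCost G w lab
      ≤ ∑ w, ∑ u, ∑ v, ((if BadTriangle G lab w u v ∧ Disagree G Q u v then 1 else 0) +
        (if BadTriangle G lab w u v ∧ Disagree G Q w u then 1 else 0) +
        if BadTriangle G lab w u v ∧ Disagree G Q v w then 1 else 0) := by
        refine Finset.sum_le_sum fun w _ => Finset.sum_le_sum fun u _ =>
          Finset.sum_le_sum fun v _ => ?_
        by_cases h : PivotPair G w.val lab u v
        · have h1 := h.badTriangle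
          rcases h1.disagree Q with h2 | h2 | h2 <;> simp [h, h1, h2] <;> omega
        · simp [h]
    _ = 3 * ∑ w, ∑ u, ∑ v, (if BadTriangle G lab w u v ∧ Disagree G Q u v then 1 else 0) := by
        simp only [Finset.sum_add_distrib]
        have e1 : (∑ w, ∑ u, ∑ v, if BadTriangle G lab w u v ∧ Disagree G Q w u then 1 else 0) =
            ∑ w, ∑ u, ∑ v, (if BadTriangle G lab w u v ∧ Disagree G Q u v then 1 else 0) := by
          calc _ = ∑ w, ∑ v, ∑ u, (if BadTriangle G lab w u v ∧ Disagree G Q w u then 1 else 0) :=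
                Finset.sum_congr rfl fun w _ => Finset.sum_comm
            _ = ∑ v, ∑ w, ∑ u, (if BadTriangle G lab w u v ∧ Disagree G Q w u then 1 else 0) :=
                Finset.sum_comm
            _ = _ := by simp only [← badTriangle_rotate (G := G)]
        have e2 : (∑ w, ∑ u, ∑ v, if BadTriangle G lab w u v ∧ Disagree G Q v w then 1 else 0) =
            ∑ w, ∑ u, ∑ v, (if BadTriangle G lab w u v ∧ Disagree G Q u v then 1 else 0) := by
          calc _ = ∑ u, ∑ w, ∑ v, (if BadTriangle G lab w u v ∧ Disagree G Q v w then 1 else 0) :=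
                Finset.sum_comm
            _ = ∑ u, ∑ v, ∑ w, (if BadTriangle G lab w u v ∧ Disagree G Q v w then 1 else 0) :=
                Finset.sum_congr rfl fun w _ => Finset.sum_comm
            _ = _ := by simp only [badTriangle_rotate (G := G)]
        rw [e1, e2]
        ring
    _ ≤ _ := by
        refine Nat.mul_le_mul_left _ (Finset.sum_le_sum fun w _ => Finset.sum_le_sum fun u _ =>
          Finset.sum_le_sum fun v _ => ?_)
        by_cases h : BadTriangle G lab w u v ∧ Disagree G Q u v
        · have h1 := h.1.captured
          have h2 := h.1.1
          simp [h, h1, h2]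
        · simp [h]

/-- A pair with a captured endpoint leaves the alive set, so each disagreement of `Q` can be charged
at most once over the whole run. -/
theorem aliveDisagree_stepLabel_add_le (Q : Setoid (Fin n)) (lab : Fin n → ℕ) (M j x : ℕ) :
    aliveDisagree G Q (stepLabel G.Adj (deg G) M j x lab) +
      (∑ u, ∑ v, if (lab u = 0 ∧ lab v = 0 ∧ Disagree G Q u v) ∧
        (Captured G.Adj x lab u ∨ Captured G.Adj x lab v) then 1 else 0) ≤
      aliveDisagree G Q lab := by
  simp only [aliveDisagree, ← Finset.sum_add_distrib]
  refine Finset.sum_le_sum fun u _ => Finset.sum_le_sum fun v _ => ?_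
  simp only [stepLabel_eq_zero, pivotLabel_eq_zero]
  by_cases hd : Disagree G Q u v <;> by_cases hu : lab u = 0 <;> by_cases hv : lab v = 0 <;>
    by_cases cu : Captured G.Adj x lab u <;> by_cases cv : Captured G.Adj x lab v <;>
    simp [hd, hu, hv, cu, cv]
  split_ifs <;> simp

/-- Drawing a uniformly random number below `N`, the expected cost of the pivot step is at most
three times the expected decrease of `aliveDisagree`. -/
theorem sum_pivotCost_add_le (Q : Setoid (Fin n)) (lab : Fin n → ℕ) (M j : ℕ) {N : ℕ} (hN : n ≤ N) :
    ∑ x ∈ Finset.range N, (pivotCost G x lab +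
      3 * aliveDisagree G Q (stepLabel G.Adj (deg G) M j x lab)) ≤
      N * (3 * aliveDisagree G Q lab) := by
  have h1 : ∑ x ∈ Finset.range N, pivotCost G x lab = ∑ w : Fin n, pivotCost G w lab := by
    refine sum_range_eq_sum_fin hN _ fun x hx => ?_
    simp [pivotCost, PivotPair, not_captured_of_le hx]
  have h2 : ∑ x ∈ Finset.range N, (∑ u, ∑ v, if (lab u = 0 ∧ lab v = 0 ∧ Disagree G Q u v) ∧
        (Captured G.Adj x lab u ∨ Captured G.Adj x lab v) then 1 else 0) =
      ∑ w : Fin n, ∑ u, ∑ v, if (lab u = 0 ∧ lab v = 0 ∧ Disagree G Q u v) ∧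
        (Captured G.Adj w.val lab u ∨ Captured G.Adj w.val lab v) then 1 else 0 := by
    refine sum_range_eq_sum_fin hN (fun x => ∑ u, ∑ v, if (lab u = 0 ∧ lab v = 0 ∧
      Disagree G Q u v) ∧ (Captured G.Adj x lab u ∨ Captured G.Adj x lab v) then 1 else 0)
      fun x hx => ?_
    simp [not_captured_of_le hx]
  have h3 := sum_pivotCost_le (G := G) Q lab
  have h4 := Finset.sum_le_sum fun x (_ : x ∈ Finset.range N) =>
    aliveDisagree_stepLabel_add_le (G := G) Q lab M j x
  rw [Finset.sum_add_distrib, h2, Finset.sum_const, Finset.card_range, smul_eq_mul] at h4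
  rw [Finset.sum_add_distrib, h1, ← Finset.mul_sum]
  have h5 : N * (3 * aliveDisagree G Q lab) = 3 * (N * aliveDisagree G Q lab) := by ring
  omega

/-- The cost so far plus three times the alive disagreements of `Q` is a supermartingale. -/
theorem avg_pivotCostRun_le (Q : Setoid (Fin n)) (M : ℕ) {N : ℕ} (hN : n ≤ N) (k j : ℕ)
    (lab : Fin n → ℕ) :
    avg N k (fun l => (pivotCostRun G M j l lab : ℝ≥0∞)) ≤
      ((3 * aliveDisagree G Q lab : ℕ) : ℝ≥0∞) := by
  induction k generalizing j lab with
  | zero => simp [avg, pivotCostRun]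
  | succ k ih =>
    rw [avg]
    refine ENNReal.div_le_of_le_mul ?_
    refine le_trans (b := ((∑ x ∈ Finset.range N, (pivotCost G x lab +
      3 * aliveDisagree G Q (stepLabel G.Adj (deg G) M j x lab)) : ℕ) : ℝ≥0∞)) ?_ ?_
    · rw [Nat.cast_sum]
      refine Finset.sum_le_sum fun x hx => ?_
      have hN0 : 0 < N := by have := Finset.mem_range.1 hx; omega
      simp only [pivotCostRun, Nat.cast_add (pivotCost G x lab), avg_add, avg_const hN0]
      exact add_le_add le_rfl (ih _ _)
    · rw [mul_comm, ← Nat.cast_mul]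
      exact_mod_cast sum_pivotCost_add_le Q lab M j hN

/-! ### Bad isolations are unlikely -/

theorem aliveDeg_mono {lab lab' : Fin n → ℕ} (h : ∀ v, lab' v = 0 → lab v = 0) (u : Fin n) :
    aliveDeg G lab' u ≤ aliveDeg G lab u := by
  refine Finset.sum_le_sum fun v _ => ?_
  by_cases h1 : G.Adj u v ∧ lab' v = 0
  · simp [h1, h v h1.2]
  · simp [h1]

theorem card_range_filter_add_aliveDeg_le {N : ℕ} (hN : n ≤ N) (lab : Fin n → ℕ) (u : Fin n) :
    ((Finset.range N).filter fun x => ¬ ∃ w : Fin n, w.val = x ∧ G.Adj u w ∧ lab w = 0).card +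
      aliveDeg G lab u ≤ N := by
  have h1 : aliveDeg G lab u =
      ((Finset.range N).filter fun x => ∃ w : Fin n, w.val = x ∧ G.Adj u w ∧ lab w = 0).card := by
    rw [aliveDeg, Finset.sum_boole, Nat.cast_id]
    refine Finset.card_bij (fun w _ => w.val) ?_ (fun a _ b _ h => Fin.ext h) ?_
    · intro w hw
      simp only [Finset.mem_filter, Finset.mem_univ, true_and, Finset.mem_range] at hw ⊢
      exact ⟨w.2.trans_le hN, w, rfl, hw⟩
    · intro x hx
      simp only [Finset.mem_filter, Finset.mem_univ, true_and] at hx ⊢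
      obtain ⟨w, h1, h2⟩ := hx.2
      exact ⟨w, h2, h1⟩
  rw [h1, add_comm, Finset.card_filter_add_card_filter_not, Finset.card_range]

/-- The number of alive neighbours only decreases, so a vertex isolated badly had more than a third
of its neighbours alive at all earlier times. Each earlier draw must have missed them, since a hit
would have captured the vertex. A miss has probability at most `r`, and there are `τ - j` draws left
before the isolation. -/
theorem avg_badRun_le {M N τ : ℕ} (hN : n ≤ N) (u : Fin n) (r : ℝ≥0∞)
    (hτ : ∀ j, j * (deg G u + 1) < M ↔ j < τ)
    (hr : ∀ c : ℕ, 3 * c + (deg G u + 1) ≤ 3 * N → (c : ℝ≥0∞) ≤ r * N) (k j : ℕ)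
    (lab : Fin n → ℕ) (ht : Timely (deg G) M j lab) :
    avg N k (fun l => if BadRun G M u j l lab then 1 else 0) ≤
      if lab u = 0 ∧ deg G u < 3 * aliveDeg G lab u then r ^ (τ - j) else 0 := by
  induction k generalizing j lab with
  | zero => simp [avg, BadRun]
  | succ k ih =>
    rw [avg]
    refine ENNReal.div_le_of_le_mul ?_
    have hx : ∀ x ∈ Finset.range N, avg N k (fun l => if BadRun G M u j (x :: l) lab then 1 else 0)
        ≤ if (lab u = 0 ∧ deg G u < 3 * aliveDeg G lab u) ∧
            ¬ ∃ w : Fin n, w.val = x ∧ G.Adj u w ∧ lab w = 0 then r ^ (τ - (j + 1)) else 0 := by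
      intro x hx
      have hN0 : 0 < N := by have := Finset.mem_range.1 hx; omega
      set lab' := stepLabel G.Adj (deg G) M j x lab with hlab'
      have hpiv : ∀ v, pivotLabel G.Adj x lab v = 0 → lab v = 0 := fun v hv =>
        (pivotLabel_eq_zero.1 hv).1
      have hstep : ∀ v, lab' v = 0 → lab v = 0 := fun v hv => hpiv v (stepLabel_eq_zero.1 hv).1
      have hkill : pivotLabel G.Adj x lab u = 0 →
          ¬ ∃ w : Fin n, w.val = x ∧ G.Adj u w ∧ lab w = 0 := by
        rintro hu ⟨w, h1, h2, h3⟩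
        have h4 := pivotLabel_eq_zero.1 hu
        exact h4.2 ⟨h4.1, w, h1, h3, Or.inr h2.symm⟩
      by_cases hb : BadAt G M u j x lab
      · have hcond : (lab u = 0 ∧ deg G u < 3 * aliveDeg G lab u) ∧
            ¬ ∃ w : Fin n, w.val = x ∧ G.Adj u w ∧ lab w = 0 :=
          ⟨⟨hpiv u hb.1, hb.2.2.trans_le (Nat.mul_le_mul_left _ (aliveDeg_mono hpiv u))⟩,
            hkill hb.1⟩
        -- Isolation means that the time limit is reached, so no factor remains and the trivial
        -- bound 1 suffices.
        have hτj : τ - (j + 1) = 0 := by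
          have h1 := hb.2.1
          have h2 := hτ (j + 1)
          omega
        rw [if_pos hcond, hτj, pow_zero]
        refine (avg_mono (H := fun _ => 1) fun l _ => ?_).trans (avg_const hN0 _ _).le
        split_ifs <;> simp
      · simp only [BadRun, hb, false_or]
        refine (ih (j + 1) lab' Timely.stepLabel).trans ?_
        by_cases hc : lab' u = 0 ∧ deg G u < 3 * aliveDeg G lab' u
        · rw [if_pos hc, if_pos]
          exact ⟨⟨hstep u hc.1, hc.2.trans_le (Nat.mul_le_mul_left _ (aliveDeg_mono hstep u))⟩,
            hkill (stepLabel_eq_zero.1 hc.1).1⟩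
        · rw [if_neg hc]; exact zero_le
    refine (Finset.sum_le_sum hx).trans ?_
    by_cases hc : lab u = 0 ∧ deg G u < 3 * aliveDeg G lab u
    · simp only [hc, true_and, if_true]
      have h1 := card_range_filter_add_aliveDeg_le (G := G) hN lab u
      have hj : j < τ := (hτ j).1 (ht u hc.1)
      rw [← Finset.sum_filter, Finset.sum_const, nsmul_eq_mul]
      refine (mul_le_mul_left (hr _ (by omega)) _).trans (le_of_eq ?_)
      rw [show τ - j = (τ - (j + 1)) + 1 by omega, pow_succ]
      ring
    · simp [hc]

/-! ### The number of stored edges -/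

variable (G) in
/-- The number of neighbours of `x` that are within their time limit at time `j`. -/
noncomputable def hitsAt (M j x : ℕ) : ℕ :=
  ∑ u, if ∃ w : Fin n, w.val = x ∧ G.Adj w u ∧ j * (deg G u + 1) < M then 1 else 0

variable (G) in
noncomputable def hitsRun (M : ℕ) : ℕ → List ℕ → ℕ
  | _, [] => 0
  | j, x :: l => hitsAt G M j x + hitsRun M (j + 1) l

theorem sum_hitsAt {N : ℕ} (hN : n ≤ N) (M j : ℕ) :
    ∑ x ∈ Finset.range N, hitsAt G M j x =
      ∑ u, if j * (deg G u + 1) < M then deg G u else 0 := by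
  rw [sum_range_eq_sum_fin hN]
  · simp only [hitsAt]
    rw [Finset.sum_comm]
    refine Finset.sum_congr rfl fun u _ => ?_
    have : ∀ w : Fin n, (∃ w' : Fin n, w'.val = w.val ∧ G.Adj w' u ∧ j * (deg G u + 1) < M) ↔
        G.Adj u w ∧ j * (deg G u + 1) < M := by
      intro w
      constructor
      · rintro ⟨w', h, h1, h2⟩
        obtain rfl := Fin.ext h
        exact ⟨h1.symm, h2⟩
      · rintro ⟨h1, h2⟩
        exact ⟨w, rfl, h1.symm, h2⟩
    simp only [this]
    by_cases h : j * (deg G u + 1) < M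
    · rw [if_pos h]
      exact Finset.sum_congr rfl fun w _ => by simp [h]
    · simp [h]
  · intro x hx
    refine Finset.sum_eq_zero fun u _ => if_neg ?_
    rintro ⟨w, hw, -⟩
    have := w.2
    omega

theorem avg_hitsRun_eq {N : ℕ} (hN : n ≤ N) (hN0 : 0 < N) (M k j : ℕ) :
    avg N k (fun l => (hitsRun G M j l : ℝ≥0∞)) =
      ((∑ i ∈ Finset.range k, ∑ u, if (j + i) * (deg G u + 1) < M then deg G u else 0 : ℕ) :
        ℝ≥0∞) / N := by
  induction k generalizing j with
  | zero => simp [avg, hitsRun]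
  | succ k ih =>
    have hk : ∀ x, avg N k (fun l => (hitsRun G M j (x :: l) : ℝ≥0∞)) =
        hitsAt G M j x + avg N k (fun l => (hitsRun G M (j + 1) l : ℝ≥0∞)) := by
      intro x
      simp only [hitsRun, Nat.cast_add, avg_add, avg_const hN0]
    simp only [avg, hk, Finset.sum_add_distrib, ENNReal.add_div, ← Nat.cast_sum, sum_hitsAt hN]
    rw [Finset.sum_range_succ', Nat.cast_add, ENNReal.add_div, add_comm]
    congr 1
    rw [Finset.sum_const, Finset.card_range, nsmul_eq_mul, mul_comm,
      ENNReal.mul_div_cancel_right (by simp [hN0.ne']) (by simp), ih]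
    congr 2
    refine Finset.sum_congr rfl fun i _ => ?_
    rw [show j + 1 + i = j + (i + 1) by omega]

/-- The number of `i` within the limit is the ceiling of M/(d+1), here written (M+d)/(d+1). -/
theorem sum_limit_mul_le (M d : ℕ) :
    ∑ i ∈ Finset.range M, (if i * (d + 1) < M then d else 0) ≤ M + d := by
  rw [← Finset.sum_filter, Finset.sum_const, smul_eq_mul]
  have h1 : ((Finset.range M).filter fun i => i * (d + 1) < M).card ≤ (M + d) / (d + 1) := by
    rw [← Finset.card_range ((M + d) / (d + 1))]
    refine Finset.card_le_card fun i hi => ?_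
    simp only [Finset.mem_filter, Finset.mem_range] at hi ⊢
    rw [Nat.lt_iff_add_one_le, Nat.le_div_iff_mul_le (by omega), add_mul]
    omega
  calc _ ≤ (M + d) / (d + 1) * (d + 1) := Nat.mul_le_mul h1 (by omega)
    _ ≤ _ := Nat.div_mul_le_self _ _

theorem deg_lt (u : Fin n) : deg G u < n := by
  have : deg G u < ∑ _v : Fin n, 1 := by
    refine Finset.sum_lt_sum (fun v _ => by split_ifs <;> simp) ⟨u, Finset.mem_univ _, by simp⟩
  simpa using this

theorem avg_hitsRun_le {N : ℕ} (hN : n ≤ N) (hN0 : 0 < N) (K : ℕ) :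
    avg N (K * N) (fun l => (hitsRun G (K * N) 0 l : ℝ≥0∞)) ≤ ((n * (K + 1) : ℕ) : ℝ≥0∞) := by
  rw [avg_hitsRun_eq hN hN0]
  refine ENNReal.div_le_of_le_mul ?_
  rw [← Nat.cast_mul, Nat.cast_le, Finset.sum_comm]
  simp only [zero_add]
  calc _ ≤ ∑ u : Fin n, (K * N + N) := Finset.sum_le_sum fun u _ =>
        (sum_limit_mul_le _ _).trans (Nat.add_le_add_left ((deg_lt u).le.trans hN) _)
    _ = _ := by simp; ring

end Cost

end CorrClust

/-! ### Failure probability of one candidate, and sums over edge streams. -/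

namespace CorrClust

/-! ### Success probability of one candidate -/

section Success

open scoped Classical

variable {n : ℕ} {G : SimpleGraph (Fin n)}

theorem aliveDisagree_zero (Q : Setoid (Fin n)) :
    aliveDisagree G Q (fun _ => 0) = 2 * cost G Q := by
  rw [← sum_disagree]
  refine Finset.sum_congr rfl fun u _ => Finset.sum_congr rfl fun v _ => ?_
  by_cases h : Disagree G Q u v <;> simp [h]

variable (G) in
/-- The sequence of draws `l` leads to a vertex that is isolated although many of its neighbours
are alive, to pivots that cost more than `b`, or to more than `cap` stored edges. -/
def FailRun (M b cap : ℕ) (l : List ℕ) : Prop :=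
  (∃ u, BadRun G M u 0 l fun _ => 0) ∨ b < pivotCostRun G M 0 l (fun _ => 0) ∨
    cap < hitsRun G M 0 l

/-- After M steps every time limit is over, so all vertices are labelled and the potential is twice
the cost. It starts at zero and grows by at most twice the pivot cost. -/
theorem cost_ker_runLabel_le {M b cap : ℕ} (hM : 0 < M) {l : List ℕ} (hl : l.length = M)
    (h : ¬ FailRun G M b cap l) :
    cost G (Setoid.ker (runLabel G.Adj (deg G) M 0 l fun _ => 0)) ≤ b := by
  simp only [FailRun, not_or, not_exists, not_lt] at h
  have h0 : Proper (fun _ : Fin n => 0) := fun u hu => absurd rfl hu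
  have ht : Timely (deg G) M 0 (fun _ : Fin n => 0) := fun u _ => by simpa using hM
  have h1 := pot_runLabel_le h0 h.1
  have h2 : ∀ u, runLabel G.Adj (deg G) M 0 l (fun _ => 0) u ≠ 0 := by
    intro u hu
    have h3 := (ht.runLabel (R := G.Adj) (l := l)) u hu
    rw [hl, zero_add] at h3
    have : M * 1 ≤ M * (deg G u + 1) := Nat.mul_le_mul_left _ (by omega)
    omega
  have h3 : pot G (fun _ => 0) = 0 := by simp [pot, pairPot]
  rw [pot_eq_two_mul_cost h2, h3] at h1
  have := h.2.1
  omega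

/-- Uses e ≥ 2 and 4L ≥ L + 3. -/
theorem exp_neg_four_mul_le {L : ℕ} (hL : 1 ≤ L) :
    Real.exp (-(4 * L : ℝ)) ≤ (8 * (2 : ℝ) ^ L)⁻¹ := by
  have h1 : (2 : ℝ) ≤ Real.exp 1 := by
    have := Real.add_one_le_exp (1 : ℝ); linarith
  have h2 : (2 : ℝ) ^ (4 * L) ≤ Real.exp (4 * L) := by
    calc (2 : ℝ) ^ (4 * L) ≤ Real.exp 1 ^ (4 * L) := by gcongr
      _ = Real.exp (4 * L) := by rw [← Real.exp_nat_mul]; simp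
  rw [Real.exp_neg]
  refine inv_anti₀ (by positivity) (le_trans ?_ h2)
  calc (8 : ℝ) * 2 ^ L = 2 ^ (3 + L) := by rw [pow_add]; norm_num
    _ ≤ _ := pow_le_pow_right₀ (by norm_num) (by omega)

/-- With q = (d+1)/(3N) and τ = ⌈M/(d+1)⌉ the bound is (1-q)^τ ≤ exp(-qτ) ≤ exp(-M/(3N)) = exp(-4L).
This is what the factor 12 in the number of draws is for. -/
theorem avg_exists_badRun_le {L N M : ℕ} (hL : 1 ≤ L) (hNL : N = 2 ^ L) (hN : n ≤ N)
    (hM : M = 12 * L * N) (u : Fin n) :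
    avg N M (fun l => if BadRun G M u 0 l (fun _ => 0) then 1 else 0) ≤
      ENNReal.ofReal ((8 * (2 : ℝ) ^ L)⁻¹) := by
  have hN0 : 0 < N := by rw [hNL]; positivity
  have hM0 : 0 < M := by rw [hM]; positivity
  set d := deg G u with hd
  have hdN : d + 1 ≤ N := (deg_lt u).trans_le hN
  have hNr : (0 : ℝ) < N := by exact_mod_cast hN0
  have hdr : ((d : ℝ) + 1) ≤ N := by exact_mod_cast hdN
  set q : ℝ := (d + 1) / (3 * N) with hq
  have hq1 : q ≤ 1 := by
    rw [hq, div_le_one (by positivity)]; linarith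
  have h := avg_badRun_le (G := G) (M := M) (τ := (M + d) / (d + 1)) hN u (ENNReal.ofReal (1 - q))
    (fun j => by
      rw [← hd, Nat.lt_iff_add_one_le (m := j), Nat.le_div_iff_mul_le (by omega), add_mul]
      omega)
    (fun c hc => by
      rw [← ENNReal.ofReal_natCast c, ← ENNReal.ofReal_natCast N, ← ENNReal.ofReal_mul (by linarith)]
      refine ENNReal.ofReal_le_ofReal ?_
      have hc' : 3 * (c : ℝ) + (d + 1) ≤ 3 * N := by exact_mod_cast hc
      have : (1 - q) * N = N - (d + 1) / 3 := by rw [hq]; field_simp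
      rw [this]; linarith) M 0 (fun _ => 0) (fun v _ => by simpa using hM0)
  refine h.trans ?_
  split_ifs
  swap
  · exact zero_le
  rw [← ENNReal.ofReal_pow (by linarith), Nat.sub_zero]
  refine ENNReal.ofReal_le_ofReal (le_trans ?_ (exp_neg_four_mul_le hL))
  have h1 : 1 - q ≤ Real.exp (-q) := by have := Real.add_one_le_exp (-q); linarith
  refine (pow_le_pow_left₀ (by linarith) h1 _).trans ?_
  rw [← Real.exp_nat_mul]
  refine Real.exp_le_exp.2 ?_
  have h2 : M ≤ (M + d) / (d + 1) * (d + 1) := by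
    have := Nat.lt_div_mul_add (a := M + d) (b := d + 1) (by omega)
    omega
  have h3 : (M : ℝ) ≤ ((M + d) / (d + 1) : ℕ) * (d + 1) := by exact_mod_cast h2
  have h4 : (M : ℝ) = 12 * L * N := by rw [hM]; push_cast; ring
  have h5 : ((M + d) / (d + 1) : ℕ) * q = ((M + d) / (d + 1) : ℕ) * ((d : ℝ) + 1) / (3 * N) := by
    rw [hq, mul_div_assoc]
  have h6 : (4 * L : ℝ) ≤ ((M + d) / (d + 1) : ℕ) * q := by
    rw [h5, le_div_iff₀ (by positivity)]
    linarith
  linarith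

/-- The pointwise form of Markov's inequality. -/
theorem ite_le_inv_mul {a b : ℕ} (hb : 0 < b) :
    (if b ≤ a then 1 else 0 : ℝ≥0∞) ≤ (b : ℝ≥0∞)⁻¹ * a := by
  split_ifs with h
  · rw [← ENNReal.inv_mul_cancel (a := (b : ℝ≥0∞)) (by simp [hb.ne']) (by simp)]
    gcongr
  · exact zero_le

theorem inv_mul_natCast_le {a b c : ℕ} (hc : 0 < c) (h : c * a ≤ b) :
    (b : ℝ≥0∞)⁻¹ * a ≤ (c : ℝ≥0∞)⁻¹ := by
  rw [mul_comm, ← div_eq_mul_inv]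
  refine ENNReal.div_le_of_le_mul ?_
  rw [mul_comm, ← div_eq_mul_inv, ENNReal.le_div_iff_mul_le (by simp [hc.ne']) (by simp), mul_comm]
  exact_mod_cast h

/-- A candidate fails with probability at most one half. -/
theorem avg_failRun_le {L N M : ℕ} (hn : 1 ≤ n) (hL : 1 ≤ L) (hNL : N = 2 ^ L) (hN : n ≤ N)
    (hM : M = 12 * L * N) (Q : Setoid (Fin n)) :
    avg N M (fun l => if FailRun G M (48 * cost G Q) (8 * n * (12 * L + 1)) l then 1 else 0) ≤
      2⁻¹ := by
  have hN0 : 0 < N := by omega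
  set b := 48 * cost G Q with hb
  set cap := 8 * n * (12 * L + 1) with hcap
  have hcap0 : 0 < cap := by rw [hcap]; positivity
  -- Union bound over the n ≤ 2^L vertices.
  have h1 : avg N M (fun l => ∑ u : Fin n, if BadRun G M u 0 l (fun _ => 0) then 1 else 0) ≤
      ((8 : ℕ) : ℝ≥0∞)⁻¹ := by
    rw [avg_sum]
    refine (Finset.sum_le_sum fun u _ => avg_exists_badRun_le hL hNL hN hM u).trans ?_
    rw [Finset.sum_const, Finset.card_univ, Fintype.card_fin, nsmul_eq_mul,
      ← ENNReal.ofReal_natCast n, ← ENNReal.ofReal_mul (by positivity),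
      ← ENNReal.ofReal_natCast 8, ← ENNReal.ofReal_inv_of_pos (by norm_num)]
    refine ENNReal.ofReal_le_ofReal ?_
    have h2 : (n : ℝ) ≤ 2 ^ L := by rw [hNL] at hN; exact_mod_cast hN
    rw [← div_eq_mul_inv, div_le_iff₀ (by positivity)]
    norm_num
    linarith
  -- Markov: the expected pivot cost, over ordered pairs, is at most 6 · cost Q. The threshold is b
  -- + 1 because b vanishes when the optimum is zero.
  have h2 : avg N M (fun l => ((b + 1 : ℕ) : ℝ≥0∞)⁻¹ * pivotCostRun G M 0 l (fun _ => 0)) ≤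
      ((8 : ℕ) : ℝ≥0∞)⁻¹ := by
    rw [avg_const_mul]
    refine (mul_le_mul_right (avg_pivotCostRun_le Q M hN M 0 _) _).trans ?_
    refine inv_mul_natCast_le (by omega) ?_
    rw [aliveDisagree_zero]
    omega
  -- Markov again: the expected number of hits is at most n(12L + 1), an eighth of the cap.
  have h3 : avg N M (fun l => (cap : ℝ≥0∞)⁻¹ * hitsRun G M 0 l) ≤ ((8 : ℕ) : ℝ≥0∞)⁻¹ := by
    rw [avg_const_mul]
    have := avg_hitsRun_le (G := G) hN hN0 (12 * L)
    rw [← hM] at this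
    refine (mul_le_mul_right this _).trans ?_
    refine inv_mul_natCast_le (by omega) ?_
    rw [hcap, mul_assoc]
  have h4 := add_le_add (add_le_add h1 h2) h3
  rw [← avg_add, ← avg_add] at h4
  refine (avg_mono fun l _ => ?_).trans (h4.trans ?_)
  · split_ifs with hf
    · rcases hf with ⟨u, hu⟩ | hp | hh
      · refine le_trans ?_ (le_add_right (le_add_right (Finset.single_le_sum
          (f := fun u : Fin n => if BadRun G M u 0 l (fun _ => 0) then (1 : ℝ≥0∞) else 0)
          (fun _ _ => zero_le) (Finset.mem_univ u))))
        simp [hu]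
      · refine le_trans ?_ (le_add_right (le_add_left (ite_le_inv_mul (Nat.succ_pos b))))
        simp [Nat.succ_le_of_lt hp]
      · refine le_trans ?_ (le_add_left (ite_le_inv_mul hcap0))
        simp [hh.le]
    · exact zero_le
  · calc ((8 : ℕ) : ℝ≥0∞)⁻¹ + ((8 : ℕ) : ℝ≥0∞)⁻¹ + ((8 : ℕ) : ℝ≥0∞)⁻¹
        ≤ ((8 : ℕ) : ℝ≥0∞)⁻¹ + ((8 : ℕ) : ℝ≥0∞)⁻¹ +
          (((8 : ℕ) : ℝ≥0∞)⁻¹ + ((8 : ℕ) : ℝ≥0∞)⁻¹) := by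
          gcongr; exact le_self_add
      _ = 2⁻¹ := by
          rw [← two_mul, ← two_mul, show ((8 : ℕ) : ℝ≥0∞) = 2 * (2 * 2) by norm_num,
            ENNReal.mul_inv (by simp) (by simp), ENNReal.mul_inv (by simp) (by simp),
            ← mul_assoc, ← mul_assoc, mul_assoc 2 2 2⁻¹, ENNReal.mul_inv_cancel (by simp) (by simp),
            mul_one, ← mul_assoc, ENNReal.mul_inv_cancel (by simp) (by simp), one_mul]

/-! ### Sums over edge streams -/

theorem IsEdgeStream.adj_iff {s : List (Fin n × Fin n)} (hs : IsEdgeStream G s) (u v : Fin n) :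
    G.Adj u v ↔ (u, v) ∈ s ∨ (v, u) ∈ s := by
  rw [← SimpleGraph.mem_edgeSet, ← hs.2, List.mem_map]
  constructor
  · rintro ⟨⟨a, b⟩, h, h'⟩
    simp only [Sym2.eq_iff] at h'
    rcases h' with ⟨rfl, rfl⟩ | ⟨rfl, rfl⟩
    · exact Or.inl h
    · exact Or.inr h
  · rintro (h | h)
    · exact ⟨_, h, rfl⟩
    · exact ⟨_, h, Sym2.eq_swap⟩

/-- Symmetrising the summand removes the dependence on the orientation in which each edge is
presented. -/
theorem IsEdgeStream.sum_map {s : List (Fin n × Fin n)} (hs : IsEdgeStream G s)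
    (f : Fin n → Fin n → ℕ) :
    (s.map fun e => f e.1 e.2 + f e.2 e.1).sum = ∑ u, ∑ v, if G.Adj u v then f u v else 0 := by
  have hnd : s.Nodup := hs.1.of_map _
  have hmem := hs.adj_iff
  have hdisj : ∀ u v, (u, v) ∈ s → (v, u) ∉ s := by
    intro u v h h'
    have := List.inj_on_of_nodup_map hs.1 h h' Sym2.eq_swap
    have huv : u = v := by simpa using congrArg Prod.fst this
    subst huv
    exact G.irrefl ((hmem u u).2 (Or.inl h))
  have h1 : ∀ F : Fin n × Fin n → ℕ, (s.map F).sum = ∑ u, ∑ v, if (u, v) ∈ s then F (u, v) else 0 := by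
    intro F
    rw [← List.sum_toFinset _ hnd, ← Fintype.sum_prod_type' (f := fun u v => if (u, v) ∈ s then
      F (u, v) else 0), ← Finset.sum_filter]
    refine Finset.sum_congr ?_ fun _ _ => rfl
    ext e; simp
  rw [h1]
  have h2 : (∑ u, ∑ v, if (u, v) ∈ s then f u v + f v u else 0) =
      (∑ u, ∑ v, if (u, v) ∈ s then f u v else 0) + ∑ u, ∑ v, if (v, u) ∈ s then f u v else 0 := by
    rw [Finset.sum_comm (f := fun u v => if (v, u) ∈ s then f u v else 0)]
    simp only [← Finset.sum_add_distrib]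
    refine Finset.sum_congr rfl fun u _ => Finset.sum_congr rfl fun v _ => ?_
    split_ifs <;> rfl
  rw [h2]
  simp only [← Finset.sum_add_distrib]
  refine Finset.sum_congr rfl fun u _ => Finset.sum_congr rfl fun v _ => ?_
  by_cases h : (u, v) ∈ s
  · simp [hmem, h, hdisj u v h]
  · simp [hmem, h]

theorem IsEdgeStream.length_le {s : List (Fin n × Fin n)} (hs : IsEdgeStream G s) :
    s.length ≤ n * n := by
  have hnd : s.Nodup := hs.1.of_map _
  simpa using hnd.length_le_card

end Success

end CorrClust

/-! ### The program text, its parameters, and the degree pass. -/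

namespace CorrClust

/-! ### Expressions of the program -/

namespace Expr

/-- The scalar variable in cell `0` of array `a`. -/
def var (a : ℕ) : Expr := .read a (.const 0)

/-- `1` if `x` and `y` are equal, and `0` otherwise. -/
def eqv (x y : Expr) : Expr := .sub (.const 1) (.add (.sub x y) (.sub y x))

/-- `1` if `x` is zero, and `0` otherwise. -/
def isZero (x : Expr) : Expr := .sub (.const 1) x

/-- The cell in row `t` and column `i` of a table with `k` columns. -/
def cell (t k i : Expr) : Expr := .add (.mul t k) i

variable {m : Mem}

theorem eval_const (k : ℕ) : (const k).eval m = k := rfl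
theorem eval_read (a : ℕ) (i : Expr) : (read a i).eval m = m (a, i.eval m) := rfl
theorem eval_add (x y : Expr) : (add x y).eval m = x.eval m + y.eval m := rfl
theorem eval_sub (x y : Expr) : (sub x y).eval m = x.eval m - y.eval m := rfl
theorem eval_mul (x y : Expr) : (mul x y).eval m = x.eval m * y.eval m := rfl
theorem eval_var (a : ℕ) : (var a).eval m = m (a, 0) := rfl
theorem eval_cell (t k i : Expr) : (cell t k i).eval m = t.eval m * k.eval m + i.eval m := rfl

/-- Subtraction is truncated, so both differences vanish only for equal values. -/
theorem eval_eqv (x y : Expr) : (eqv x y).eval m = if x.eval m = y.eval m then 1 else 0 := by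
  simp only [eqv, eval_sub, eval_add, eval_const]
  split_ifs <;> omega

theorem eval_isZero (x : Expr) : (isZero x).eval m = if x.eval m = 0 then 1 else 0 := by
  simp only [isZero, eval_sub, eval_const]
  split_ifs <;> omega

/-- The number of draws of one candidate. -/
def draws : Expr := .mul (.mul (.const 12) (var 2)) (var 3)

/-- The largest number of edges stored for one candidate. -/
def capacity : Expr := .mul (.mul (.const 8) (var 0)) (.add (.mul (.const 12) (var 2)) (.const 1))

end Expr

/-! ### The program

The arrays are used as follows: `2`: the number `L` of candidates; `3`: the number `N = 2 ^ L`;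
`4`: the draws; `5`: the degrees; `6`: the number of stored edges of each candidate; `7`, `8`: the
endpoints of the stored edges; `9`: the labels; `10`: the scores; `17`: the best candidate;
`11`-`14` and `18`: loop variables; `15`: a flag; `16`: a random bit. -/

namespace Prog

open CorrClust.Expr

/-- Find a power of two above the number of vertices. -/
def initProg : Prog :=
  .seq (.write 3 (.const 0) (.const 1))
    (.loop (var 0) (.ite (.sub (.add (var 0) (.const 1)) (var 3))
      (.seq (.write 3 (.const 0) (.mul (.const 2) (var 3)))
        (.write 2 (.const 0) (.add (var 2) (.const 1)))) .skip))

/-- Append a random bit to the binary representation of a draw. -/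
def bitProg : Prog :=
  .seq (.flip 16 (.const 0))
    (.write 4 (var 18) (.add (.mul (.const 2) (.read 4 (var 18))) (var 16)))

/-- Make all draws. -/
def drawProg : Prog :=
  forTo 18 (.mul (var 2) draws) (.seq (.write 4 (var 18) (.const 0)) (.loop (var 2) bitProg))

/-- Count the degree of the vertex in cell `i` of the input array. -/
def degreeWrite (i : ℕ) : Prog :=
  .write 5 (.read 0 (.const i)) (.add (.read 5 (.read 0 (.const i))) (.const 1))

def degreeProg : Prog := .pass (.seq (degreeWrite 1) (degreeWrite 2))

/-- Whether the `j`-th draw is the vertex in cell `a` of the input array, and the vertex in cell `b`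
is within its time limit. -/
def hitExpr (a b : ℕ) : Expr :=
  .mul (eqv (.read 4 (cell (var 11) draws (var 12))) (.read 0 (.const a)))
    (.sub draws (.mul (var 12) (.add (.read 5 (.read 0 (.const b))) (.const 1))))

def appendProg : Prog :=
  .seq (.write 7 (cell (var 11) capacity (.read 6 (var 11))) (.read 0 (.const 1)))
    (.seq (.write 8 (cell (var 11) capacity (.read 6 (var 11))) (.read 0 (.const 2)))
      (.write 6 (var 11) (.add (.read 6 (var 11)) (.const 1))))

/-- Store an edge for all candidates for which it may matter. -/
def storeBody : Prog :=
  forTo 11 (var 2) (.seq (.write 15 (.const 0) (.const 0))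
    (.seq (forTo 12 draws (.write 15 (.const 0) (.add (var 15) (.add (hitExpr 2 1) (hitExpr 1 2)))))
      (.ite (var 15) (.ite (.sub capacity (.read 6 (var 11))) appendProg .skip) .skip)))

def storeProg : Prog := .pass storeBody

/-- The label of the vertex `u` for the current candidate. -/
def labelExpr (u : Expr) : Expr := .read 9 (cell (var 11) (var 0) u)

/-- The current draw. -/
def drawExpr : Expr := .read 4 (cell (var 11) draws (var 12))

/-- If the vertex `u` is alive and the condition `c` holds, give it the label `x + 1`. -/
def labelWrite (u c x : Expr) : Prog :=
  .write 9 (cell (var 11) (var 0) u)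
    (.add (labelExpr u) (.mul (.mul (isZero (labelExpr u)) c) (.add x (.const 1))))

/-- The `i`-th endpoint of the current stored edge, for `i = 7, 8`. -/
def storedExpr (i : ℕ) : Expr := .read i (cell (var 11) capacity (var 14))

/-- Capture the alive vertices that are joined to the pivot by a stored edge. -/
def captureProg : Prog :=
  forTo 14 (.read 6 (var 11))
    (.seq (labelWrite (storedExpr 8) (eqv (storedExpr 7) drawExpr) drawExpr)
      (labelWrite (storedExpr 7) (eqv (storedExpr 8) drawExpr) drawExpr))

def pivotProg : Prog :=
  .ite (.mul (.sub (var 0) drawExpr) (isZero (labelExpr drawExpr)))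
    (.seq (labelWrite drawExpr (.const 1) drawExpr) captureProg) .skip

/-- Isolate the alive vertices that have reached their time limit. -/
def isolateProg : Prog :=
  forTo 13 (var 0) (labelWrite (var 13)
    (isZero (isZero (.sub (.add (.mul (.add (var 12) (.const 1))
      (.add (.read 5 (var 13)) (.const 1))) (.const 1)) draws))) (var 13))

def simulateProg : Prog :=
  forTo 11 (var 2) (forTo 12 draws (.seq pivotProg isolateProg))

def cutProg : Prog :=
  .pass (forTo 11 (var 2) (.write 10 (var 11) (.add (.read 10 (var 11)) (.mul (.const 4)
    (isZero (eqv (labelExpr (.read 0 (.const 1))) (labelExpr (.read 0 (.const 2)))))))))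

def insideProg : Prog :=
  forTo 11 (var 2) (forTo 13 (var 0) (forTo 14 (var 0) (.write 10 (var 11)
    (.add (.read 10 (var 11)) (eqv (labelExpr (var 13)) (labelExpr (var 14)))))))

def bestProg : Prog :=
  forTo 11 (var 2) (.ite (.sub (.read 10 (var 17)) (.read 10 (var 11)))
    (.write 17 (.const 0) (var 11)) .skip)

def outputProg : Prog :=
  forTo 13 (var 0) (.write 1 (var 13) (.read 9 (cell (var 17) (var 0) (var 13))))

def restProg : Prog :=
  .seq degreeProg (.seq storeProg (.seq simulateProg (.seq cutProg (.seq insideProg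
    (.seq bestProg outputProg)))))

/-- The best of several truncated pivot clusterings. -/
def clusterProg : Prog := .seq initProg (.seq drawProg restProg)

end Prog

/-- The number of draws of one candidate. -/
def numDraws (L N : ℕ) : ℕ := 12 * L * N

/-- The largest number of edges stored for one candidate. -/
def maxStored (n L : ℕ) : ℕ := 8 * n * (12 * L + 1)

/-- Relations between the parameters. -/
structure Params (n L N S V : ℕ) : Prop where
  n_pos : 0 < n
  L_pos : 0 < L
  N_eq : N = 2 ^ L
  n_le : n ≤ N
  four_le_S : 4 ≤ S
  n_le_S : n ≤ S
  L_le_S : L ≤ S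
  draws_le_S : L * numDraws L N ≤ S
  stored_le_S : L * maxStored n L ≤ S
  labels_le_S : L * n ≤ S
  -- Room for a score: at most 4n² from cut edges and n² from pairs inside clusters.
  sq_lt_V : 5 * (n * n) + 2 < V
  N_lt_V : 2 * N + 1 < V
  L_lt_V : L + 1 < V
  draws_lt_V : L * numDraws L N < V
  -- Room for the flag, which accumulates at most 2M over each of M draws.
  draws_sq_lt_V : 2 * (numDraws L N * numDraws L N) < V
  stored_lt_V : L * maxStored n L < V

theorem cell_lt {L k t i B : ℕ} (ht : t < L) (hi : i < k) (hB : L * k ≤ B) : t * k + i < B := by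
  have h1 : (t + 1) * k ≤ L * k := Nat.mul_le_mul_right _ ht
  rw [add_mul, one_mul] at h1
  omega

theorem cell_inj {k t t' i i' : ℕ} (hi : i < k) (hi' : i' < k) :
    t * k + i = t' * k + i' ↔ t = t' ∧ i = i' := by
  constructor
  · intro h
    have h1 : t = t' := by
      have a := congrArg (· / k) h
      simp only [mul_comm _ k] at a
      rwa [Nat.mul_add_div (by omega), Nat.mul_add_div (by omega), Nat.div_eq_of_lt hi,
        Nat.div_eq_of_lt hi', add_zero, add_zero] at a
    subst h1
    exact ⟨rfl, by omega⟩
  · rintro ⟨rfl, rfl⟩; rfl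

/-- The memory holds the parameters. -/
structure Header (n L N : ℕ) (m : Mem) : Prop where
  n_eq : m (0, 0) = n
  L_eq : m (2, 0) = L
  N_eq : m (3, 0) = N

theorem Header.congr {n L N : ℕ} {m m' : Mem} (h : Header n L N m) (h0 : m' (0, 0) = m (0, 0))
    (h2 : m' (2, 0) = m (2, 0)) (h3 : m' (3, 0) = m (3, 0)) : Header n L N m' :=
  ⟨h0.trans h.n_eq, h2.trans h.L_eq, h3.trans h.N_eq⟩

theorem Header.eval_draws {n L N : ℕ} {m : Mem} (h : Header n L N m) :
    Expr.draws.eval m = numDraws L N := by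
  simp [Expr.draws, Expr.eval_mul, Expr.eval_const, Expr.eval_var, h.L_eq, h.N_eq, numDraws]

theorem Header.eval_capacity {n L N : ℕ} {m : Mem} (h : Header n L N m) :
    Expr.capacity.eval m = maxStored n L := by
  simp [Expr.capacity, Expr.eval_mul, Expr.eval_add, Expr.eval_const, Expr.eval_var, h.L_eq,
    h.n_eq, maxStored]

variable {n L N S V : ℕ}

/-! ### Degrees -/

theorem Params.leads_degreeProg (P : Params n L N S V) {G : SimpleGraph (Fin n)}
    {σ : ℕ → List (Fin n × Fin n)} {s : Config n} (hσ : IsEdgeStream G (σ s.passes))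
    (hH : Header n L N s.mem) (h5 : ∀ i, s.mem (5, i) = 0) :
    Prog.degreeProg.Leads S V σ (fun s' => s'.passes = s.passes + 1 ∧ Header n L N s'.mem ∧
      (∀ w : Fin n, s'.mem (5, w.val) = deg G w) ∧
      ∀ a, a ≠ 0 → a ≠ 5 → ∀ i, s'.mem (a, i) = s.mem (a, i)) s := by
  have hV := P.sq_lt_V
  have hS := P.four_le_S
  refine Prog.Leads.pass (fun l m => ∀ w : Fin n, m (5, w.val) =
    (l.map fun e => (if e.1 = w then 1 else 0) + if e.2 = w then 1 else 0).sum) (by omega)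
    (by omega) (by omega) (by decide) hσ.length_le hH.n_eq (by simp [h5]) ?_ ?_ ?_
  · intro l m m' h hJ w
    rw [h 5 (by decide), hJ]
  · intro l u v l' hl m _ h1 h2 _ hJ
    have hb : ∀ w : Fin n, m (5, w.val) + 2 < V := by
      intro w
      have h3 : l.length ≤ n * n := by
        have := hσ.length_le
        rw [hl, List.length_append] at this
        omega
      -- Each stream entry adds at most 2 to a cell, which bounds every intermediate content by 2n².
      have h4 := List.sum_le_card_nsmul (l.map fun e => (if e.1 = w then 1 else 0) +
        if e.2 = w then 1 else 0) 2 (by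
          intro x hx
          obtain ⟨e, -, rfl⟩ := List.mem_map.1 hx
          split_ifs <;> omega)
      rw [← hJ w, List.length_map, smul_eq_mul] at h4
      omega
    have hu := u.2.trans_le P.n_le_S
    have hv := v.2.trans_le P.n_le_S
    have hbu := hb u
    have hbv := hb v
    refine .seq (.write (by decide) (by simpa [Expr.eval, h1] using hu) ?_
      (.write (by decide) ?_ ?_ ?_))
    · simp only [Expr.eval, h1]; omega
    · simpa [Expr.eval, h1, h2, Mem.update_eq] using hv
    · simp only [Expr.eval, h1, h2, Mem.update_eq]
      simp
      split_ifs <;> omega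
    · intro w
      simp only [Expr.eval, h1, h2, Mem.update_eq, List.map_append, List.sum_append, ← hJ w]
      simp only [Fin.ext_iff]
      simp
      by_cases e1 : (w : ℕ) = u <;> by_cases e2 : (w : ℕ) = v <;>
        by_cases e3 : (u : ℕ) = v <;> simp_all [eq_comm]
  · intro s' h1 h2 h3 hJ
    refine ⟨h1, hH.congr (h2.trans hH.n_eq.symm) (h3 2 (by decide) (by decide) 0)
      (h3 3 (by decide) (by decide) 0), fun w => ?_, fun a ha ha5 i => h3 a ha ?_ i⟩
    · rw [hJ w]
      have := hσ.sum_map (fun a _ => if a = w then 1 else 0)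
      rw [this, deg]
      rw [Finset.sum_eq_single w]
      · simp
      · intro b _ hb; simp [hb]
      · simp
    · simpa [Prog.degreeWrite, Prog.mods] using ha5

end CorrClust

/-! ### The second pass: keeping the relevant edges. -/

namespace CorrClust

variable {n L N S V : ℕ}

/-! ### Storing edges -/

/-- An endpoint of `e` is drawn while the other endpoint is within its time limit. -/
def Relevant (M : ℕ) (X d : ℕ → ℕ) (e : Fin n × Fin n) : Prop :=
  ∃ j < M, (X j = e.2 ∧ j * (d e.1 + 1) < M) ∨ (X j = e.1 ∧ j * (d e.2 + 1) < M)

open Classical in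
/-- The relevant edges of `l`, up to the capacity. -/
noncomputable def keptEdges (M cap : ℕ) (X d : ℕ → ℕ) (l : List (Fin n × Fin n)) :
    List (Fin n × Fin n) :=
  (l.filter fun e => Relevant M X d e).take cap

theorem keptEdges_append_singleton (M cap : ℕ) (X d : ℕ → ℕ) (l : List (Fin n × Fin n))
    (e : Fin n × Fin n) [Decidable (Relevant M X d e)] :
    keptEdges M cap X d (l ++ [e]) =
      if Relevant M X d e ∧ (keptEdges M cap X d l).length < cap then keptEdges M cap X d l ++ [e]
      else keptEdges M cap X d l := by
  classical
  by_cases h : Relevant M X d e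
  · simp only [keptEdges, List.filter_append, h, decide_true, List.filter_cons_of_pos,
      List.filter_nil, List.length_take, true_and]
    split_ifs with hc
    · rw [List.take_append, List.take_of_length_le (l := List.filter _ l) (by omega),
        List.take_of_length_le (l := [e]) (by simp; omega)]
    · rw [List.take_append_of_le_length (by omega)]
  · simp [keptEdges, List.filter_append, h]

theorem keptEdges_length_le (M cap : ℕ) (X d : ℕ → ℕ) (l : List (Fin n × Fin n)) :
    (keptEdges M cap X d l).length ≤ cap := by
  simp [keptEdges]

/-- The memory holds the list `l` of edges for the candidate `t`. -/
def StoredEdges (cap t : ℕ) (l : List (Fin n × Fin n)) (m : Mem) : Prop :=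
  m (6, t) = l.length ∧ ∀ (i : ℕ) (hi : i < l.length),
    m (7, t * cap + i) = (l[i]).1.val ∧ m (8, t * cap + i) = (l[i]).2.val

theorem StoredEdges.congr {cap t : ℕ} {l : List (Fin n × Fin n)} {m m' : Mem}
    (h : StoredEdges cap t l m) (h6 : ∀ i, m' (6, i) = m (6, i)) (h7 : ∀ i, m' (7, i) = m (7, i))
    (h8 : ∀ i, m' (8, i) = m (8, i)) : StoredEdges cap t l m' :=
  ⟨(h6 _).trans h.1, fun i hi => ⟨(h7 _).trans (h.2 i hi).1, (h8 _).trans (h.2 i hi).2⟩⟩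

/-- What the j-th draw adds to the flag. Truncated subtraction makes it positive exactly when one
endpoint is drawn and the other is within its limit, so a sum plays the role of a disjunction. -/
def hitWeight (M : ℕ) (X d : ℕ → ℕ) (u v j : ℕ) : ℕ :=
  (if X j = v then 1 else 0) * (M - j * (d u + 1)) + (if X j = u then 1 else 0) * (M - j * (d v + 1))

theorem sum_hitWeight_ne_zero {M : ℕ} {X d : ℕ → ℕ} {e : Fin n × Fin n} :
    ∑ j ∈ Finset.range M, hitWeight M X d e.1 e.2 j ≠ 0 ↔ Relevant M X d e := by
  rw [ne_eq, Finset.sum_eq_zero_iff, not_forall]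
  refine exists_congr fun j => ?_
  rw [Classical.not_imp, Finset.mem_range]
  refine and_congr_right fun _ => ?_
  unfold hitWeight
  split_ifs with h1 h2 h2 <;> simp [h1, h2] <;> omega

theorem sum_hitWeight_le (M : ℕ) (X d : ℕ → ℕ) (u v : ℕ) {k : ℕ} (hk : k ≤ M) :
    ∑ j ∈ Finset.range k, hitWeight M X d u v j ≤ 2 * (M * M) := by
  calc _ ≤ ∑ _j ∈ Finset.range k, 2 * M := by
        refine Finset.sum_le_sum fun j _ => ?_
        unfold hitWeight
        split_ifs <;> omega
    _ = k * (2 * M) := by simp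
    _ ≤ M * (2 * M) := Nat.mul_le_mul_right _ hk
    _ = _ := by ring

/-- The outer invariant says that the candidates below `t` have already seen the new edge and the
others have not. Rows of the tables are disjoint by `cell_inj`, so appending for one candidate
leaves the others intact. -/
theorem Params.ensures_storeBody (P : Params n L N S V) {m : Mem} (hH : Header n L N m)
    {u v : Fin n} (h1 : m (0, 1) = u.val) (h2 : m (0, 2) = v.val) {l : List (Fin n × Fin n)}
    (hs : ∀ t < L, StoredEdges (maxStored n L) t (keptEdges (numDraws L N) (maxStored n L)
      (fun j => m (4, t * numDraws L N + j)) (fun i => m (5, i)) l) m) :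
    Prog.storeBody.Ensures S V (fun m' => ∀ t < L, StoredEdges (maxStored n L) t
      (keptEdges (numDraws L N) (maxStored n L) (fun j => m (4, t * numDraws L N + j))
        (fun i => m (5, i)) (l ++ [(u, v)])) m') m := by
  classical
  have hV := P.sq_lt_V
  have hS := P.four_le_S
  have hnn := Nat.le_mul_self n
  set M := numDraws L N with hM
  set cap := maxStored n L with hcap
  set K : ℕ → List (Fin n × Fin n) → List (Fin n × Fin n) := fun t l =>
    keptEdges M cap (fun j => m (4, t * M + j)) (fun i => m (5, i)) l with hK
  have hKlen : ∀ t l, (K t l).length ≤ cap := fun t l => keptEdges_length_le _ _ _ _ _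
  refine .forTo (fun t m' => ∀ t' < L, StoredEdges cap t' (K t' (if t' < t then l ++ [(u, v)] else l))
    m') L (by simp [Expr.eval_var, Mem.update_eq, hH.L_eq]) (by decide) (by omega)
    (by have := P.L_lt_V; omega) (by decide) ?_ ?_ ?_
  · intro t ht
    simpa using (hs t ht).congr (by simp [Mem.update_eq]) (by simp [Mem.update_eq])
      (by simp [Mem.update_eq])
  · intro t ht m' h11 hfr hI
    have f0 := hfr 0 (by decide) (by decide)
    have f2 := hfr 2 (by decide) (by decide)
    have f3 := hfr 3 (by decide) (by decide)
    have f4 := hfr 4 (by decide) (by decide)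
    have f5 := hfr 5 (by decide) (by decide)
    have hH' : Header n L N m' := hH.congr (f0 0) (f2 0) (f3 0)
    refine .seq (.write (by decide) (by simp [Expr.eval]; omega) (by simp [Expr.eval]; omega) ?_)
    simp only [Expr.eval_const]
    refine .seq (.forTo (fun k m'' => m'' (15, 0) = ∑ j ∈ Finset.range k,
      hitWeight M (fun j => m (4, t * M + j)) (fun i => m (5, i)) u v j) M ?_ (by decide) (by omega)
      ?_ (by decide) ?_ ?_ ?_)
    · exact (hH'.congr (by simp [Mem.update_eq]) (by simp [Mem.update_eq])
        (by simp [Mem.update_eq])).eval_draws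
    · have h3 : L * M < V := P.draws_lt_V
      have h4 : 1 * M ≤ L * M := Nat.mul_le_mul_right _ P.L_pos
      omega
    · simp [Mem.update_eq]
    · intro j hj m'' h12 hfr' hI'
      have g (a : ℕ) (h : a ≠ 12) (h' : a ≠ 15) (i : ℕ) : m'' (a, i) = m' (a, i) := by
        rw [hfr' a h (by simpa [Prog.mods] using h')]
        simp [Mem.update_eq, h']
      have hH'' : Header n L N m'' := hH'.congr (g 0 (by decide) (by decide) 0)
        (g 2 (by decide) (by decide) 0) (g 3 (by decide) (by decide) 0)
      have hev : (Expr.add (Expr.var 15) (.add (Prog.hitExpr 2 1) (Prog.hitExpr 1 2))).eval m'' =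
          ∑ j ∈ Finset.range (j + 1),
            hitWeight M (fun j => m (4, t * M + j)) (fun i => m (5, i)) u v j := by
        rw [Finset.sum_range_succ, ← hI']
        simp only [Expr.eval_add, Expr.eval_mul, Expr.eval_sub, Expr.eval_eqv, Expr.eval_var,
          Expr.eval_cell, Expr.eval_read, Expr.eval_const, Prog.hitExpr, hH''.eval_draws, h12, hitWeight]
        simp only [g 0 (by decide) (by decide), g 4 (by decide) (by decide),
          g 5 (by decide) (by decide), g 11 (by decide) (by decide), f0, f4, f5, h11, h1, h2, hM]
      refine .write (by decide) (by simp [Expr.eval]; omega) ?_ ?_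
      · rw [hev]
        exact (sum_hitWeight_le _ _ _ _ _ (by omega)).trans_lt P.draws_sq_lt_V
      · rw [hev]
        simp [Mem.update_eq, Expr.eval]
    · intro m'' hfr' hI'
      have g (a : ℕ) (h : a ≠ 12) (h' : a ≠ 15) (i : ℕ) : m'' (a, i) = m' (a, i) := by
        rw [hfr' a h (by simpa [Prog.mods] using h')]
        simp [Mem.update_eq, h']
      have hH'' : Header n L N m'' := hH'.congr (g 0 (by decide) (by decide) 0)
        (g 2 (by decide) (by decide) 0) (g 3 (by decide) (by decide) 0)
      have g6 := g 6 (by decide) (by decide)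
      have g7 := g 7 (by decide) (by decide)
      have g8 := g 8 (by decide) (by decide)
      have g11 := (g 11 (by decide) (by decide) 0).trans h11
      have g01 := ((g 0 (by decide) (by decide) 1).trans (f0 1)).trans h1
      have g02 := ((g 0 (by decide) (by decide) 2).trans (f0 2)).trans h2
      have hst : ∀ t' < L, StoredEdges cap t' (K t' (if t' < t then l ++ [(u, v)] else l)) m'' :=
        fun t' ht' => (hI t' ht').congr g6 g7 g8
      have hrel := sum_hitWeight_ne_zero (M := M) (X := fun j => m (4, t * M + j))
        (d := fun i => m (5, i)) (e := (u, v))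
      rw [← hI'] at hrel
      have happ : K t (l ++ [(u, v)]) = if Relevant M (fun j => m (4, t * M + j)) (fun i => m (5, i))
          (u, v) ∧ (K t l).length < cap then K t l ++ [(u, v)] else K t l :=
        keptEdges_append_singleton _ _ _ _ _ _
      have hcnt : m'' (6, t) = (K t l).length := by simpa using (hst t ht).1
      have hother : ∀ t' < L, t' ≠ t → (if t' < t + 1 then l ++ [(u, v)] else l) =
          if t' < t then l ++ [(u, v)] else l := by
        intro t' _ hne
        have : t' < t + 1 ↔ t' < t := by omega
        simp only [this]
      have hskip : ¬ (Relevant M (fun j => m (4, t * M + j)) (fun i => m (5, i)) (u, v) ∧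
          (K t l).length < cap) → ∀ t' < L, StoredEdges cap t'
            (K t' (if t' < t + 1 then l ++ [(u, v)] else l)) (m''.update (11, 0) (t + 1)) := by
        intro hn t' ht'
        refine StoredEdges.congr (m := m'') ?_ (by simp [Mem.update_eq]) (by simp [Mem.update_eq])
          (by simp [Mem.update_eq])
        by_cases he : t' = t
        · subst he
          rw [if_pos (Nat.lt_succ_self _), happ, if_neg hn]
          simpa using hst t' ht'
        · rw [hother t' ht' he]
          exact hst t' ht'
      refine .ite (fun hr => .ite (fun hc => ?_) fun hc => .skip ?_) fun hr => .skip ?_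
      · rw [Expr.eval_var] at hr
        simp only [Expr.eval_sub, hH''.eval_capacity, Expr.eval_read, Expr.eval_var, g11, hcnt,
          ← hcap] at hc
        have hlt : (K t l).length < cap := by omega
        rw [if_pos ⟨hrel.1 hr, hlt⟩] at happ
        have hb : t * cap + (K t l).length < S := cell_lt ht hlt P.stored_le_S
        have hbV : cap < V := by
          have h3 : L * cap < V := P.stored_lt_V
          have h4 : 1 * cap ≤ L * cap := Nat.mul_le_mul_right _ P.L_pos
          omega
        have hu := u.2
        have hv := v.2
        have hevc : ∀ m₀ : Mem, Header n L N m₀ → m₀ (11, 0) = t → m₀ (6, t) = (K t l).length →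
            (Expr.cell (.var 11) Expr.capacity (.read 6 (.var 11))).eval m₀ =
              t * cap + (K t l).length := by
          intro m₀ a b c
          simp only [Expr.eval_cell, Expr.eval_var, a.eval_capacity, Expr.eval_read, b, c, hcap]
        have e1 := hevc m'' hH'' g11 hcnt
        have e2 := hevc (m''.update (7, t * cap + (K t l).length) u)
          (hH''.congr (by simp [Mem.update_eq]) (by simp [Mem.update_eq]) (by simp [Mem.update_eq]))
          (by simpa [Mem.update_eq] using g11) (by simpa [Mem.update_eq] using hcnt)
        have e3 : (Expr.read 0 (Expr.const 1)).eval m'' = u := g01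
        have e4 : (Expr.read 0 (Expr.const 2)).eval (m''.update (7, t * cap + (K t l).length) u) =
            v := by simpa [Expr.eval, Mem.update_eq] using g02
        refine .seq (.write (by decide) (by rw [e1]; exact hb) (by rw [e3]; omega) ?_)
        rw [e1, e3]
        refine .seq (.write (by decide) (by rw [e2]; exact hb) (by rw [e4]; omega) ?_)
        rw [e2, e4]
        refine .write (by decide) ?_ ?_ ?_
        · simp only [Expr.eval, Expr.var, Mem.update_eq, g11]
          simp
          have := P.L_le_S
          omega
        · simp only [Expr.eval, Expr.var, Mem.update_eq, g11]
          simp [hcnt]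
          omega
        · intro t' ht'
          have e5 : (Expr.var 11).eval ((m''.update (7, t * cap + (K t l).length) u).update
              (8, t * cap + (K t l).length) v) = t := by
            simpa [Expr.eval, Expr.var, Mem.update_eq] using g11
          have e6 : ((Expr.read 6 (Expr.var 11)).add (Expr.const 1)).eval
              ((m''.update (7, t * cap + (K t l).length) u).update
              (8, t * cap + (K t l).length) v) = (K t l).length + 1 := by
            rw [Expr.eval_add, Expr.eval_read, e5]
            simpa [Expr.eval, Mem.update_eq] using hcnt
          rw [e5, e6]
          by_cases he : t' = t
          · subst he
            rw [if_pos (Nat.lt_succ_self _), happ]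
            refine ⟨by simp [Mem.update_eq], fun i hi => ?_⟩
            rw [List.length_append, List.length_singleton] at hi
            have hst' := hst t' ht'
            simp only [lt_irrefl, if_false] at hst'
            rcases Nat.lt_succ_iff_lt_or_eq.1 hi with hi' | rfl
            · have := hst'.2 i hi'
              simp [Mem.update_eq, List.getElem_append_left hi', this, hi'.ne]
            · simp [Mem.update_eq]
          · rw [hother t' ht' he]
            have hst' := hst t' ht'
            refine ⟨by simpa [Mem.update_eq, he] using hst'.1, fun i hi => ?_⟩
            have h3 : ¬ (t' * cap + i = t * cap + (K t l).length) := fun h =>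
              he ((cell_inj (hi.trans_le (hKlen _ _)) hlt).1 h).1
            simpa [Mem.update_eq, h3] using hst'.2 i hi
      · refine hskip fun h => ?_
        simp only [Expr.eval_sub, hH''.eval_capacity, Expr.eval_read, Expr.eval_var, g11, hcnt,
          ← hcap] at hc
        omega
      · refine hskip fun h => hrel.2 h.1 ?_
        simpa [Expr.eval_var] using hr
  · intro m' _ hI t ht
    simpa [ht] using hI t ht

theorem Params.leads_storeProg (P : Params n L N S V) {G : SimpleGraph (Fin n)}
    {σ : ℕ → List (Fin n × Fin n)} {s : Config n} (hσ : IsEdgeStream G (σ s.passes))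
    (hH : Header n L N s.mem) (h6 : ∀ i, s.mem (6, i) = 0) :
    Prog.storeProg.Leads S V σ (fun s' => s'.passes = s.passes + 1 ∧ Header n L N s'.mem ∧
      (∀ t < L, StoredEdges (maxStored n L) t (keptEdges (numDraws L N) (maxStored n L)
        (fun j => s.mem (4, t * numDraws L N + j)) (fun i => s.mem (5, i)) (σ s.passes)) s'.mem) ∧
      ∀ a, a ∉ [0, 6, 7, 8, 11, 12, 15] → ∀ i, s'.mem (a, i) = s.mem (a, i)) s := by
  have hV := P.sq_lt_V
  have hS := P.four_le_S
  refine Prog.Leads.pass (fun l m => ∀ t < L, StoredEdges (maxStored n L) t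
    (keptEdges (numDraws L N) (maxStored n L)
        (fun j => s.mem (4, t * numDraws L N + j)) (fun i => s.mem (5, i)) l) m) (by omega)
    (by omega) (by omega) (by decide) hσ.length_le hH.n_eq ?_ ?_ ?_ ?_
  · intro t _
    simp [keptEdges, StoredEdges, h6]
  · intro l m m' h hJ t ht
    exact (hJ t ht).congr (h 6 (by decide)) (h 7 (by decide)) (h 8 (by decide))
  · intro l u v l' _ m h0 h1 h2 hfr hJ
    have f4 := hfr 4 (by decide) (by decide)
    have f5 := hfr 5 (by decide) (by decide)
    have := P.ensures_storeBody (m := m) (hH.congr (h0.trans hH.n_eq.symm)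
      (hfr 2 (by decide) (by decide) 0) (hfr 3 (by decide) (by decide) 0)) h1 h2 (l := l)
      (by simpa only [f4, f5] using hJ)
    simpa only [f4, f5] using this
  · intro s' h1 h2 h3 hJ
    refine ⟨h1, hH.congr (h2.trans hH.n_eq.symm) (h3 2 (by decide) (by decide) 0)
      (h3 3 (by decide) (by decide) 0), hJ, fun a ha i => h3 a ?_ ?_ i⟩
    · rintro rfl; simp at ha
    · intro hm
      refine ha ?_
      simp [Prog.storeBody, Prog.forTo, Prog.mods, Prog.appendProg] at hm
      simp
      tauto

end CorrClust

/-! ### The program's simulation of the pivot process on the stored edges. -/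

namespace CorrClust

variable {n L N S V : ℕ}

/-- Makes the memory bound available inside a proof; it is needed when a stored value is written
back and its size is known only from the bound. -/
theorem Prog.Ensures.of_fits {m : Mem} {Q : Mem → Prop} {p : Prog}
    (h : m.Fits S V → p.Ensures S V Q m) : p.Ensures S V Q m :=
  fun hm => h hm hm

/-! ### Simulation of the process -/

/-- The memory holds the labels of all candidates. -/
def Table (L : ℕ) (tbl : ℕ → Fin n → ℕ) (m : Mem) : Prop :=
  ∀ t < L, ∀ u : Fin n, m (9, t * n + u) = tbl t u

theorem Table.congr {tbl : ℕ → Fin n → ℕ} {m m' : Mem} (h : Table L tbl m)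
    (h9 : ∀ i, m' (9, i) = m (9, i)) : Table L tbl m' :=
  fun t ht u => (h9 _).trans (h t ht u)

theorem Table.update {tbl : ℕ → Fin n → ℕ} {m : Mem} (h : Table L tbl m) (t : ℕ) (w : Fin n)
    (x : ℕ) : Table L (Function.update tbl t (Function.update (tbl t) w x))
      (m.update (9, t * n + w) x) := by
  intro t' ht' u
  rw [Mem.update_eq]
  simp only [true_and, cell_inj u.2 w.2]
  by_cases h1 : t' = t
  · subst h1
    rw [Function.update_self]
    by_cases h2 : u = w
    · subst h2; simp
    · have : (u : ℕ) ≠ w := fun h => h2 (Fin.ext h)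
      simp [h2, this, h t' ht']
  · simp [h1, h t' ht']

/-- The conditional assignment is done arithmetically, by adding (x+1) times the two conditions to
the old label. The written number is hidden behind `y`, so later steps only see the updated table.
-/
theorem Params.ensures_labelWrite (P : Params n L N S V) {m : Mem} (hH : Header n L N m) {t : ℕ}
    (ht : t < L) (h11 : m (11, 0) = t) {tbl : ℕ → Fin n → ℕ} {lab : Fin n → ℕ}
    (hT : Table L (Function.update tbl t lab) m)
    {u c x : Expr} {w : Fin n} (hu : u.eval m = w) {C : Prop} [Decidable C]
    (hc : c.eval m = if C then 1 else 0) {xv : ℕ} (hx : x.eval m = xv) (hxn : C → xv < n)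
    {Q : Mem → Prop}
    (hQ : ∀ y, Table L (Function.update tbl t (Function.update lab w
      (if lab w = 0 ∧ C then xv + 1 else lab w))) (m.update (9, t * n + w) y) →
        Q (m.update (9, t * n + w) y)) :
    (Prog.labelWrite u c x).Ensures S V Q m := by
  refine .of_fits fun hm => ?_
  have hV := P.sq_lt_V
  have hnn := Nat.le_mul_self n
  have hcell : (Expr.cell (.var 11) (.var 0) u).eval m = t * n + w := by
    simp only [Expr.eval_cell, Expr.eval_var, h11, hH.n_eq, hu]
  have hlab : m (9, t * n + w) = lab w := by
    have := hT t ht w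
    rwa [Function.update_self] at this
  have hlV : lab w < V := by
    by_cases h0 : m (9, t * n + w) = 0
    · omega
    · have := (hm _ h0).2.2
      omega
  have hval : (Expr.add (Prog.labelExpr u) (.mul (.mul (.isZero (Prog.labelExpr u)) c)
      (.add x (.const 1)))).eval m = if lab w = 0 ∧ C then xv + 1 else lab w := by
    simp only [Expr.eval_add, Expr.eval_mul, Expr.eval_isZero, Prog.labelExpr, Expr.eval_read, hcell,
      Expr.eval_const, hlab, hc, hx]
    by_cases h0 : lab w = 0 <;> by_cases hC : C <;> simp [h0, hC]
  refine .write (by decide) ?_ ?_ ?_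
  · rw [hcell]
    exact cell_lt ht w.2 P.labels_le_S
  · rw [hval]
    split_ifs with h
    · have := hxn h.2; omega
    · exact hlV
  · rw [hcell, hval]
    refine hQ _ ?_
    have := hT.update t w (if lab w = 0 ∧ C then xv + 1 else lab w)
    rwa [Function.update_self, Function.update_idem] at this

/-- The effect of one stored edge on the labels when `x` is the pivot. -/
def captureStep (x : ℕ) (lab : Fin n → ℕ) (e : Fin n × Fin n) : Fin n → ℕ :=
  let lab' := Function.update lab e.2 (if lab e.2 = 0 ∧ e.1.val = x then x + 1 else lab e.2)
  Function.update lab' e.1 (if lab' e.1 = 0 ∧ e.2.val = x then x + 1 else lab' e.1)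

open Classical in
theorem captureStep_eq (x : ℕ) (lab : Fin n → ℕ) (e : Fin n × Fin n) (u : Fin n) :
    captureStep x lab e u =
      if lab u = 0 ∧ ((e.1.val = x ∧ e.2 = u) ∨ (e.2.val = x ∧ e.1 = u)) then x + 1 else lab u := by
  obtain ⟨a, b⟩ := e
  simp only [captureStep, Function.update_apply]
  by_cases h1 : u = a <;> by_cases h2 : u = b
  · subst h1; subst h2; by_cases h3 : lab u = 0 <;> by_cases h4 : u.val = x <;> simp [h3, h4]
  · subst h1; simp [h2, Ne.symm h2]
  · subst h2; simp [h1, Ne.symm h1]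
  · simp [h1, h2, Ne.symm h1, Ne.symm h2]

-- A labelled vertex is never relabelled, so the order of the edges is irrelevant.
open Classical in
theorem foldl_captureStep (x : ℕ) (l : List (Fin n × Fin n)) (lab : Fin n → ℕ) (u : Fin n) :
    l.foldl (captureStep x) lab u = if lab u = 0 ∧
      ∃ e ∈ l, (e.1.val = x ∧ e.2 = u) ∨ (e.2.val = x ∧ e.1 = u) then x + 1 else lab u := by
  induction l generalizing lab with
  | nil => simp
  | cons e l ih =>
    rw [List.foldl_cons, ih, captureStep_eq]
    simp only [List.exists_mem_cons_iff]
    by_cases h0 : lab u = 0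
    · by_cases h1 : (e.1.val = x ∧ e.2 = u) ∨ (e.2.val = x ∧ e.1 = u)
      · simp [h0, h1]
      · simp [h0, h1]
    · simp [h0]

theorem Params.ensures_captureProg (P : Params n L N S V) {m : Mem} (hH : Header n L N m) {t j x : ℕ}
    (ht : t < L) (h11 : m (11, 0) = t) (h12 : m (12, 0) = j)
    (hx : m (4, t * numDraws L N + j) = x) (hxn : x < n) {tbl : ℕ → Fin n → ℕ} {lab : Fin n → ℕ}
    (hT : Table L (Function.update tbl t lab) m) {F : List (Fin n × Fin n)}
    (hF : StoredEdges (maxStored n L) t F m) (hFc : F.length ≤ maxStored n L) :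
    Prog.captureProg.Ensures S V
      (Table L (Function.update tbl t (F.foldl (captureStep x) lab))) m := by
  have hS := P.four_le_S
  refine .forTo (fun i m' => Table L (Function.update tbl t ((F.take i).foldl (captureStep x) lab)) m')
    F.length ?_ (by decide) (by omega) ?_ (by decide) ?_ ?_ ?_
  · simpa [Expr.eval, Expr.var, Mem.update_eq, h11] using hF.1
  · have h3 := P.stored_lt_V
    have h4 : 1 * maxStored n L ≤ L * maxStored n L := Nat.mul_le_mul_right _ P.L_pos
    omega
  · simpa using hT.congr (by simp [Mem.update_eq])
  · intro i hi m' h14 hfr hI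
    have f (a : ℕ) (h : a ≠ 14) (h' : a ≠ 9) (i : ℕ) : m' (a, i) = m (a, i) :=
      hfr a h (by simpa [Prog.mods, Prog.labelWrite] using h') i
    have hH' : Header n L N m' := hH.congr (f 0 (by decide) (by decide) 0)
      (f 2 (by decide) (by decide) 0) (f 3 (by decide) (by decide) 0)
    have g11 := (f 11 (by decide) (by decide) 0).trans h11
    have g12 := (f 12 (by decide) (by decide) 0).trans h12
    have gx := (f 4 (by decide) (by decide) _).trans hx
    have g7 := (f 7 (by decide) (by decide) _).trans (hF.2 i hi).1
    have g8 := (f 8 (by decide) (by decide) _).trans (hF.2 i hi).2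
    have hd : ∀ m₀ : Mem, Header n L N m₀ → m₀ (11, 0) = t → m₀ (12, 0) = j →
        m₀ (4, t * numDraws L N + j) = x → Prog.drawExpr.eval m₀ = x := by
      intro m₀ a b c d
      simp only [Prog.drawExpr, Expr.eval_read, Expr.eval_cell, Expr.eval_var, a.eval_draws, b, c, d]
    have hst : ∀ (m₀ : Mem) (k y : ℕ), Header n L N m₀ → m₀ (11, 0) = t → m₀ (14, 0) = i →
        m₀ (k, t * maxStored n L + i) = y → (Prog.storedExpr k).eval m₀ = y := by
      intro m₀ k y a b c d
      simp only [Prog.storedExpr, Expr.eval_read, Expr.eval_cell, Expr.eval_var, a.eval_capacity, b,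
        c, d]
    refine .seq (P.ensures_labelWrite hH' ht g11 hI (hst m' 8 _ hH' g11 h14 g8)
      (C := (F[i]).1.val = x) ?_ (hd m' hH' g11 g12 gx) (fun _ => hxn) fun y hT' => ?_)
    · rw [Expr.eval_eqv, hst m' 7 _ hH' g11 h14 g7, hd m' hH' g11 g12 gx]
    have hH'' : Header n L N (m'.update (9, t * n + (F[i]).2) y) :=
      hH'.congr (by simp [Mem.update_eq]) (by simp [Mem.update_eq]) (by simp [Mem.update_eq])
    have k11 : (m'.update (9, t * n + (F[i]).2) y) (11, 0) = t := by simpa [Mem.update_eq] using g11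
    have k12 : (m'.update (9, t * n + (F[i]).2) y) (12, 0) = j := by simpa [Mem.update_eq] using g12
    have k14 : (m'.update (9, t * n + (F[i]).2) y) (14, 0) = i := by simpa [Mem.update_eq] using h14
    have kx : (m'.update (9, t * n + (F[i]).2) y) (4, t * numDraws L N + j) = x := by
      simpa [Mem.update_eq] using gx
    have k7 : (m'.update (9, t * n + (F[i]).2) y) (7, t * maxStored n L + i) = (F[i]).1 := by
      simpa [Mem.update_eq] using g7
    have k8 : (m'.update (9, t * n + (F[i]).2) y) (8, t * maxStored n L + i) = (F[i]).2 := by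
      simpa [Mem.update_eq] using g8
    refine P.ensures_labelWrite hH'' ht k11 hT' (hst _ 7 _ hH'' k11 k14 k7)
      (C := (F[i]).2.val = x) ?_ (hd _ hH'' k11 k12 kx) (fun _ => hxn) fun y' hT'' => ?_
    · rw [Expr.eval_eqv, hst _ 8 _ hH'' k11 k14 k8, hd _ hH'' k11 k12 kx]
    · refine Table.congr ?_ (by simp [Mem.update_eq])
        (m := (m'.update (9, t * n + (F[i]).2) y).update (9, t * n + (F[i]).1) y')
      rw [List.take_add_one, List.getElem?_eq_getElem hi, Option.toList_some, List.foldl_append]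
      exact hT''
  · intro m' _ hI
    simpa using hI

/-- Two vertices are joined by a listed edge. -/
def Joined (F : List (Fin n × Fin n)) (w u : Fin n) : Prop := (w, u) ∈ F ∨ (u, w) ∈ F

/-- Labelling the pivot first accounts for its own capture; the edges then account for its alive
neighbours. -/
theorem foldl_captureStep_eq_pivotLabel (F : List (Fin n × Fin n)) (lab : Fin n → ℕ) (w : Fin n)
    (hw : lab w = 0) :
    F.foldl (captureStep w) (Function.update lab w (w + 1)) = pivotLabel (Joined F) w lab := by
  classical
  funext u
  rw [foldl_captureStep]
  have hE : (∃ e ∈ F, (e.1.val = w ∧ e.2 = u) ∨ (e.2.val = w ∧ e.1 = u)) ↔ Joined F w u := by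
    constructor
    · rintro ⟨⟨a, b⟩, he, ⟨h1, rfl⟩ | ⟨h1, rfl⟩⟩
      · obtain rfl := Fin.ext h1; exact Or.inl he
      · obtain rfl := Fin.ext h1; exact Or.inr he
    · rintro (h | h)
      · exact ⟨_, h, Or.inl ⟨rfl, rfl⟩⟩
      · exact ⟨_, h, Or.inr ⟨rfl, rfl⟩⟩
  simp only [hE, pivotLabel, captured_fin, hw, true_and]
  by_cases h : u = w
  · subst h; simp [hw]
  · simp [h]

theorem Params.ensures_pivotProg (P : Params n L N S V) {m : Mem} (hH : Header n L N m) {t j x : ℕ}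
    (ht : t < L) (h11 : m (11, 0) = t) (h12 : m (12, 0) = j)
    (hx : m (4, t * numDraws L N + j) = x) {tbl : ℕ → Fin n → ℕ} {lab : Fin n → ℕ}
    (hT : Table L (Function.update tbl t lab) m) {F : List (Fin n × Fin n)}
    (hF : StoredEdges (maxStored n L) t F m) (hFc : F.length ≤ maxStored n L) :
    Prog.pivotProg.Ensures S V
      (Table L (Function.update tbl t (pivotLabel (Joined F) x lab))) m := by
  have hd : Prog.drawExpr.eval m = x := by
    simp only [Prog.drawExpr, Expr.eval_read, Expr.eval_cell, Expr.eval_var, hH.eval_draws, h11, h12,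
      hx]
  -- The product is nonzero exactly when the draw is a vertex and that vertex is alive. For x ≥ n
  -- the label read may belong to another row, but the first factor is then zero.
  have hcond : (Expr.mul (.sub (.var 0) Prog.drawExpr)
      (.isZero (Prog.labelExpr Prog.drawExpr))).eval m = (n - x) *
        if m (9, t * n + x) = 0 then 1 else 0 := by
    simp only [Expr.eval_mul, Expr.eval_sub, Expr.eval_isZero, Prog.labelExpr, Expr.eval_read,
      Expr.eval_cell, Expr.eval_var, hH.n_eq, hd, h11]
  refine .ite (fun h => ?_) fun h => .skip ?_
  · rw [hcond] at h
    have hxn : x < n := by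
      by_contra hc
      rw [Nat.sub_eq_zero_of_le (not_lt.1 hc), zero_mul] at h
      exact h rfl
    have h0 : lab ⟨x, hxn⟩ = 0 := by
      have h1 := hT t ht ⟨x, hxn⟩
      rw [Function.update_self] at h1
      rw [← h1]
      by_contra hc
      exact h (by simp [hc])
    refine .seq (P.ensures_labelWrite hH ht h11 hT (w := ⟨x, hxn⟩) hd (C := True) (by simp [Expr.eval])
      hd (fun _ => hxn) fun y hT' => ?_)
    simp only [h0, and_self, if_true] at hT'
    have := P.ensures_captureProg (j := j) (x := x) (F := F)
      (hH.congr (by simp [Mem.update_eq]) (by simp [Mem.update_eq]) (by simp [Mem.update_eq])) ht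
      (by simpa [Mem.update_eq] using h11) (by simpa [Mem.update_eq] using h12)
      (by simpa [Mem.update_eq] using hx) hxn hT'
      (hF.congr (by simp [Mem.update_eq]) (by simp [Mem.update_eq]) (by simp [Mem.update_eq])) hFc
    rwa [foldl_captureStep_eq_pivotLabel F lab ⟨x, hxn⟩ h0] at this
  · rw [hcond] at h
    have : pivotLabel (Joined F) x lab = lab := by
      funext u
      refine if_neg ?_
      rintro ⟨-, w, rfl, hw, -⟩
      have h1 := hT t ht w
      rw [Function.update_self, hw] at h1
      have := w.2
      simp only [h1, if_true, mul_one] at h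
      omega
    rwa [this]

/-- Whether a vertex is isolated depends only on its own label and degree, so a sequential sweep has
the effect of the simultaneous update. -/
theorem Params.ensures_isolateProg (P : Params n L N S V) {m : Mem} (hH : Header n L N m) {t j : ℕ}
    (ht : t < L) (h11 : m (11, 0) = t) (h12 : m (12, 0) = j)
    {tbl : ℕ → Fin n → ℕ} {lab : Fin n → ℕ} (hT : Table L (Function.update tbl t lab) m) :
    Prog.isolateProg.Ensures S V (Table L (Function.update tbl t
      (isolateLabel (fun u => m (5, u.val)) (numDraws L N) (j + 1) lab))) m := by
  have hS := P.four_le_S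
  have hV := P.sq_lt_V
  have hnn := Nat.le_mul_self n
  refine .forTo (fun i m' => Table L (Function.update tbl t (fun u => if u.val < i then
    isolateLabel (fun u => m (5, u.val)) (numDraws L N) (j + 1) lab u else lab u)) m')
    n (by simpa [Expr.eval_var, Mem.update_eq] using hH.n_eq) (by decide) (by omega) (by omega)
    (by decide) ?_ ?_ ?_
  · simpa using hT.congr (by simp [Mem.update_eq])
  · intro i hi m' h13 hfr hI
    have f (a : ℕ) (h : a ≠ 13) (h' : a ≠ 9) (i : ℕ) : m' (a, i) = m (a, i) :=
      hfr a h (by simpa [Prog.mods, Prog.labelWrite] using h') i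
    have hH' : Header n L N m' := hH.congr (f 0 (by decide) (by decide) 0)
      (f 2 (by decide) (by decide) 0) (f 3 (by decide) (by decide) 0)
    have g11 := (f 11 (by decide) (by decide) 0).trans h11
    have g12 := (f 12 (by decide) (by decide) 0).trans h12
    refine P.ensures_labelWrite hH' ht g11 hI (u := .var 13) (x := .var 13) (w := ⟨i, hi⟩) h13
      (C := numDraws L N ≤ (j + 1) * (m (5, i) + 1)) ?_ h13 (fun _ => hi) fun y hT' => ?_
    · simp only [Expr.eval_isZero, Expr.eval_sub, Expr.eval_add, Expr.eval_mul, Expr.eval_const,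
        Expr.eval_read, Expr.eval_var, hH'.eval_draws, g12, h13, f 5 (by decide) (by decide)]
      split_ifs <;> first | rfl | omega
    · have e : (fun u : Fin n => if u.val < i + 1 then
          isolateLabel (fun u => m (5, u.val)) (numDraws L N) (j + 1) lab u else lab u) =
          Function.update (fun u : Fin n => if u.val < i then
          isolateLabel (fun u => m (5, u.val)) (numDraws L N) (j + 1) lab u else lab u) ⟨i, hi⟩
          (if lab ⟨i, hi⟩ = 0 ∧ numDraws L N ≤ (j + 1) * (m (5, i) + 1) then i + 1
            else lab ⟨i, hi⟩) := by
        funext u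
        by_cases hu : u = ⟨i, hi⟩
        · subst hu; simp [isolateLabel]
        · have h1 : (u : ℕ) ≠ i := fun h => hu (Fin.ext h)
          have h2 : (u : ℕ) < i + 1 ↔ (u : ℕ) < i := by omega
          simp only [Function.update_of_ne hu, h2]
      rw [e]
      simp only [lt_irrefl, if_false] at hT'
      exact hT'.congr (by simp [Mem.update_eq])
  · intro m' _ hI
    simpa using hI

/-- The final labels of the candidate `t`, given its stored edges. -/
noncomputable def finalLabel (L N : ℕ) (m : Mem) (F : ℕ → List (Fin n × Fin n)) (t : ℕ) : Fin n → ℕ :=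
  runLabel (Joined (F t)) (fun u => m (5, u.val)) (numDraws L N) 0
    ((List.range (numDraws L N)).map fun j => m (4, t * numDraws L N + j)) fun _ => 0

theorem Params.ensures_simulateProg (P : Params n L N S V) {m : Mem} (hH : Header n L N m)
    {F : ℕ → List (Fin n × Fin n)} (hF : ∀ t < L, StoredEdges (maxStored n L) t (F t) m)
    (hFc : ∀ t, (F t).length ≤ maxStored n L) (h9 : ∀ i, m (9, i) = 0) :
    Prog.simulateProg.Ensures S V (Table L (finalLabel L N m F)) m := by
  have hS := P.four_le_S
  set M := numDraws L N with hM
  refine .forTo (fun t m' => Table L (fun t' => if t' < t then finalLabel L N m F t' else fun _ => 0) m')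
    L (by simpa [Expr.eval_var, Mem.update_eq] using hH.L_eq) (by decide) (by omega)
    (by have := P.L_lt_V; omega) (by decide) ?_ ?_ ?_
  · intro t _ u
    simp [Mem.update_eq, h9]
  · intro t ht m' h11 hfr hI
    have hmods : ∀ a, a ∉ [9, 11, 12, 13, 14] → ∀ i, m' (a, i) = m (a, i) := by
      intro a ha i
      simp only [List.mem_cons, List.not_mem_nil, or_false, not_or] at ha
      refine hfr a (by tauto) ?_ i
      simp [Prog.forTo, Prog.mods, Prog.pivotProg, Prog.isolateProg, Prog.captureProg,
        Prog.labelWrite]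
      tauto
    have hH' : Header n L N m' := hH.congr (hmods 0 (by decide) 0) (hmods 2 (by decide) 0)
      (hmods 3 (by decide) 0)
    refine .forTo (fun j m'' => Table L (Function.update
      (fun t' => if t' < t then finalLabel L N m F t' else fun _ => 0) t
      (runLabel (Joined (F t)) (fun u => m (5, u.val)) M 0
        ((List.range j).map fun j => m (4, t * M + j)) fun _ => 0)) m'') M ?_ (by decide) (by omega)
      ?_ (by decide) ?_ ?_ ?_
    · exact (hH'.congr (by simp [Mem.update_eq]) (by simp [Mem.update_eq])
        (by simp [Mem.update_eq])).eval_draws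
    · have h3 : L * M < V := P.draws_lt_V
      have h4 : 1 * M ≤ L * M := Nat.mul_le_mul_right _ P.L_pos
      omega
    · have e : Function.update (fun t' => if t' < t then finalLabel L N m F t' else fun _ => 0) t
          (runLabel (Joined (F t)) (fun u => m (5, u.val)) M 0
            ((List.range 0).map fun j => m (4, t * M + j)) fun _ => 0) =
          (fun t' => if t' < t then finalLabel L N m F t' else fun _ => 0) := by
        funext t'
        by_cases h : t' = t
        · subst h; simp [runLabel]
        · simp [h]
      simp only [e]
      exact hI.congr (by simp [Mem.update_eq])
    · intro j hj m'' h12 hfr' hI'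
      have g : ∀ a, a ∉ [9, 12, 13, 14] → ∀ i, m'' (a, i) = m' (a, i) := by
        intro a ha i
        simp only [List.mem_cons, List.not_mem_nil, or_false, not_or] at ha
        refine hfr' a (by tauto) ?_ i
        simp [Prog.forTo, Prog.mods, Prog.pivotProg, Prog.isolateProg, Prog.captureProg,
          Prog.labelWrite]
        tauto
      have hH'' : Header n L N m'' := hH'.congr (g 0 (by decide) 0) (g 2 (by decide) 0)
        (g 3 (by decide) 0)
      have g11 := (g 11 (by decide) 0).trans h11
      have g4 (i) := (g 4 (by decide) i).trans (hmods 4 (by decide) i)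
      have g5 (i) := (g 5 (by decide) i).trans (hmods 5 (by decide) i)
      have g6 (i) := (g 6 (by decide) i).trans (hmods 6 (by decide) i)
      have g7 (i) := (g 7 (by decide) i).trans (hmods 7 (by decide) i)
      have g8 (i) := (g 8 (by decide) i).trans (hmods 8 (by decide) i)
      refine .seq ((P.ensures_pivotProg hH'' ht g11 h12 (g4 _) hI' ((hF t ht).congr g6 g7 g8)
        (hFc t)).frame.mono ?_)
      rintro m₃ ⟨hT₃, hfr₃⟩
      have k : ∀ a, a ∉ [9, 14] → ∀ i, m₃ (a, i) = m'' (a, i) := by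
        intro a ha i
        simp only [List.mem_cons, List.not_mem_nil, or_false, not_or] at ha
        refine hfr₃ a ?_ i
        simp [Prog.forTo, Prog.mods, Prog.pivotProg, Prog.captureProg, Prog.labelWrite]
        tauto
      refine (P.ensures_isolateProg (hH''.congr (k 0 (by decide) 0) (k 2 (by decide) 0)
        (k 3 (by decide) 0)) ht ((k 11 (by decide) 0).trans g11) ((k 12 (by decide) 0).trans h12)
        hT₃).mono ?_
      intro m₄ hT₄
      refine Table.congr ?_ (by simp [Mem.update_eq]) (m := m₄)
      rw [List.range_succ, List.map_append, List.map_singleton, runLabel_append_singleton,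
        List.length_map, List.length_range, zero_add]
      simp only [k 5 (by decide), g5] at hT₄
      exact hT₄
    · intro m'' _ hI'
      refine Table.congr ?_ (by simp [Mem.update_eq]) (m := m'')
      have e : (fun t' => if t' < t + 1 then finalLabel L N m F t' else fun _ => 0) =
          Function.update (fun t' => if t' < t then finalLabel L N m F t' else fun _ => 0) t
          (runLabel (Joined (F t)) (fun u => m (5, u.val)) M 0
            ((List.range M).map fun j => m (4, t * M + j)) fun _ => 0) := by
        funext t'
        by_cases h : t' = t
        · subst h; simp [finalLabel, hM]
        · have h2 : t' < t + 1 ↔ t' < t := by omega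
          simp only [Function.update_of_ne h, h2]
      rw [e]
      exact hI'
  · intro m' _ hI t ht u
    simpa [ht] using hI t ht u

end CorrClust

/-! ### Comparing candidates by score, and why the capped edge lists suffice. -/

namespace CorrClust

variable {n L N S V : ℕ}

/-! ### Scores -/

theorem Params.leads_cutProg (P : Params n L N S V) {G : SimpleGraph (Fin n)}
    {σ : ℕ → List (Fin n × Fin n)} {s : Config n} (hσ : IsEdgeStream G (σ s.passes))
    (hH : Header n L N s.mem) (h10 : ∀ i, s.mem (10, i) = 0) {tbl : ℕ → Fin n → ℕ}
    (hT : Table L tbl s.mem) :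
    Prog.cutProg.Leads S V σ (fun s' => s'.passes = s.passes + 1 ∧ Header n L N s'.mem ∧
      (∀ t < L, s'.mem (10, t) =
        ((σ s.passes).map fun e => if tbl t e.1 = tbl t e.2 then 0 else 4).sum) ∧
      ∀ a, a ∉ [0, 10, 11] → ∀ i, s'.mem (a, i) = s.mem (a, i)) s := by
  have hV := P.sq_lt_V
  have hS := P.four_le_S
  refine Prog.Leads.pass (fun l m => ∀ t < L, m (10, t) =
    (l.map fun e => if tbl t e.1 = tbl t e.2 then 0 else 4).sum) (by omega)
    (by omega) (by omega) (by decide) hσ.length_le hH.n_eq (by simp [h10]) ?_ ?_ ?_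
  · intro l m m' h hJ t ht
    rw [h 10 (by decide), hJ t ht]
  · intro l u v l' hl m h0 h1 h2 hfr hJ
    refine .forTo (fun t m' => ∀ t' < L, m' (10, t') =
      ((if t' < t then l ++ [(u, v)] else l).map fun e => if tbl t' e.1 = tbl t' e.2 then 0 else 4).sum)
      L ?_ (by decide) (by omega) (by have := P.L_lt_V; omega) (by decide) ?_ ?_ ?_
    · simpa [Expr.eval_var, Mem.update_eq] using (hfr 2 (by decide) (by decide) 0).trans hH.L_eq
    · intro t ht
      simpa [Mem.update_eq] using hJ t ht
    · intro t ht m' h11 hfr' hI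
      have f (a : ℕ) (h : a ≠ 11) (h' : a ≠ 10) (i : ℕ) : m' (a, i) = m (a, i) :=
        hfr' a h (by simpa [Prog.mods] using h') i
      have g9 (i : ℕ) := (f 9 (by decide) (by decide) i).trans (hfr 9 (by decide) (by decide) i)
      have g0 := f 0 (by decide) (by decide)
      have hval : (Expr.add (.read 10 (.var 11)) (.mul (.const 4)
          (.isZero (.eqv (Prog.labelExpr (.read 0 (.const 1)))
            (Prog.labelExpr (.read 0 (.const 2))))))).eval m' =
          m' (10, t) + if tbl t u = tbl t v then 0 else 4 := by
        simp only [Expr.eval_add, Expr.eval_read, Expr.eval_mul, Expr.eval_isZero, Expr.eval_eqv,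
          Prog.labelExpr, Expr.eval_cell, Expr.eval_var, Expr.eval_const, h11, g0, h0, h1, h2, g9,
          hT t ht]
        split_ifs <;> simp_all
      refine .write (by decide) ?_ ?_ ?_
      · simp only [Expr.eval_var, h11]
        have := P.L_le_S
        omega
      · have h3 : (l ++ (u, v) :: l').length ≤ n * n := hl ▸ hσ.length_le
        rw [List.length_append, List.length_cons] at h3
        have h4 := List.sum_le_card_nsmul (l.map fun e => if tbl t e.1 = tbl t e.2 then 0 else 4) 4 (by
          intro x hx
          obtain ⟨e, -, rfl⟩ := List.mem_map.1 hx
          split_ifs <;> omega)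
        have h5 := hI t ht
        simp only [lt_irrefl, if_false] at h5
        rw [← h5, List.length_map, smul_eq_mul] at h4
        rw [hval]
        split_ifs <;> omega
      · intro t' ht'
        have h6 := hI t' ht'
        simp only [hval, Expr.eval_var, h11, Mem.update_eq]
        by_cases he : t' = t
        · subst he
          simp only [lt_irrefl, if_false] at h6
          simp [h6]
        · have h7 : t' < t + 1 ↔ t' < t := by omega
          simpa [he, h7] using h6
    · intro m' _ hI t ht
      simpa [ht] using hI t ht
  · intro s' h1 h2 h3 hJ
    refine ⟨h1, hH.congr (h2.trans hH.n_eq.symm) (h3 2 (by decide) (by decide) 0)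
      (h3 3 (by decide) (by decide) 0), hJ, fun a ha i => ?_⟩
    simp only [List.mem_cons, List.not_mem_nil, or_false, not_or] at ha
    refine h3 a ha.1 ?_ i
    simp [Prog.forTo, Prog.mods]
    tauto

theorem Params.ensures_insideProg (P : Params n L N S V) {m : Mem} (hH : Header n L N m)
    (h10 : ∀ t < L, m (10, t) + n * n < V) {tbl : ℕ → Fin n → ℕ} (hT : Table L tbl m) :
    Prog.insideProg.Ensures S V (fun m' => ∀ t < L, m' (10, t) =
      m (10, t) + ∑ u, ∑ v, if tbl t u = tbl t v then 1 else 0) m := by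
  have hV := P.sq_lt_V
  have hS := P.four_le_S
  have hnn := Nat.le_mul_self n
  set same : ℕ → ℕ → ℕ → ℕ := fun t u v => if m (9, t * n + u) = m (9, t * n + v) then 1 else 0
    with hsame
  -- Every partial sum of the double loop is at most n², so no intermediate score exceeds the
  -- content bound.
  have hbound : ∀ t i k, i < n → k < n → ∑ u ∈ Finset.range i, ∑ v ∈ Finset.range n, same t u v +
      ∑ v ∈ Finset.range (k + 1), same t i v ≤ n * n := by
    intro t i k hi hk
    have h1 : ∑ v ∈ Finset.range (k + 1), same t i v ≤ ∑ v ∈ Finset.range n, same t i v :=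
      Finset.sum_le_sum_of_subset (Finset.range_mono hk)
    have h2 : ∑ u ∈ Finset.range (i + 1), ∑ v ∈ Finset.range n, same t u v ≤
        ∑ u ∈ Finset.range n, ∑ v ∈ Finset.range n, same t u v :=
      Finset.sum_le_sum_of_subset (Finset.range_mono hi)
    have h3 : ∑ u ∈ Finset.range n, ∑ v ∈ Finset.range n, same t u v ≤
        ∑ u ∈ Finset.range n, ∑ v ∈ Finset.range n, 1 :=
      Finset.sum_le_sum fun u _ => Finset.sum_le_sum fun v _ => by
        simp only [hsame]; split_ifs <;> simp
    rw [Finset.sum_range_succ] at h2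
    simp only [Finset.sum_const, Finset.card_range, smul_eq_mul, mul_one] at h3
    omega
  have hnV : n < V := by omega
  refine .forTo (fun t m' => ∀ t' < L, m' (10, t') = m (10, t') + if t' < t then
      ∑ u ∈ Finset.range n, ∑ v ∈ Finset.range n, same t' u v else 0) L
    (by simpa [Expr.eval_var, Mem.update_eq] using hH.L_eq) (by decide) (by omega)
    (by have := P.L_lt_V; omega) (by decide) (by simp [Mem.update_eq]) ?_ ?_
  · intro t ht m₁ h11 hfr₁ hI₁
    have f₁ : ∀ a, a ∉ [10, 11, 13, 14] → ∀ i, m₁ (a, i) = m (a, i) := by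
      intro a ha i
      simp only [List.mem_cons, List.not_mem_nil, or_false, not_or] at ha
      refine hfr₁ a (by tauto) ?_ i
      simp [Prog.forTo, Prog.mods]; tauto
    refine .forTo (fun i m' => ∀ t' < L, m' (10, t') = m₁ (10, t') + if t' = t then
        ∑ u ∈ Finset.range i, ∑ v ∈ Finset.range n, same t' u v else 0) n
      (by simpa [Expr.eval_var, Mem.update_eq] using (f₁ 0 (by decide) 0).trans hH.n_eq) (by decide)
      (by omega) hnV (by decide) (by simp [Mem.update_eq]) ?_ ?_
    · intro i hi m₂ h13 hfr₂ hI₂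
      have f₂ : ∀ a, a ∉ [10, 13, 14] → ∀ i, m₂ (a, i) = m₁ (a, i) := by
        intro a ha i
        simp only [List.mem_cons, List.not_mem_nil, or_false, not_or] at ha
        refine hfr₂ a (by tauto) ?_ i
        simp [Prog.forTo, Prog.mods]; tauto
      refine .forTo (fun k m' => ∀ t' < L, m' (10, t') = m₂ (10, t') + if t' = t then
          ∑ v ∈ Finset.range k, same t' i v else 0) n
        (by simpa [Expr.eval_var, Mem.update_eq] using
          ((f₂ 0 (by decide) 0).trans (f₁ 0 (by decide) 0)).trans hH.n_eq) (by decide)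
        (by omega) hnV (by decide) (by simp [Mem.update_eq]) ?_ ?_
      · intro k hk m₃ h14 hfr₃ hI₃
        have f₃ (a : ℕ) (h : a ≠ 14) (h' : a ≠ 10) (i : ℕ) : m₃ (a, i) = m₂ (a, i) :=
          hfr₃ a h (by simpa [Prog.mods] using h') i
        have g9 (i : ℕ) := ((f₃ 9 (by decide) (by decide) i).trans (f₂ 9 (by decide) i)).trans
          (f₁ 9 (by decide) i)
        have g0 := (((f₃ 0 (by decide) (by decide) 0).trans (f₂ 0 (by decide) 0)).trans
          (f₁ 0 (by decide) 0)).trans hH.n_eq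
        have g11 := ((f₃ 11 (by decide) (by decide) 0).trans (f₂ 11 (by decide) 0)).trans h11
        have g13 := (f₃ 13 (by decide) (by decide) 0).trans h13
        have hval : (Expr.add (.read 10 (.var 11)) (.eqv (Prog.labelExpr (.var 13))
            (Prog.labelExpr (.var 14)))).eval m₃ = m₃ (10, t) + same t i k := by
          simp only [Expr.eval_add, Expr.eval_read, Expr.eval_eqv, Prog.labelExpr, Expr.eval_cell,
            Expr.eval_var, g11, g0, g13, h14, g9, hsame]
        refine .write (by decide) ?_ ?_ ?_
        · simp only [Expr.eval_var, g11]
          have := P.L_le_S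
          omega
        · have h1 := hI₁ t ht
          have h2 := hI₂ t ht
          have h3 := hI₃ t ht
          have h4 := hbound t i k hi hk
          have h5 := h10 t ht
          rw [Finset.sum_range_succ] at h4
          simp only [lt_irrefl, if_false, if_true] at h1 h2 h3
          rw [hval]
          omega
        · intro t' ht'
          have h3 := hI₃ t' ht'
          simp only [hval, Expr.eval_var, g11, Mem.update_eq]
          by_cases he : t' = t
          · subst he
            simp only [if_true] at h3
            simp [h3, Finset.sum_range_succ, add_assoc]
          · simpa [he] using h3
      · intro m₃ _ hI₃ t' ht'
        have h2 := hI₂ t' ht'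
        have h3 := hI₃ t' ht'
        simp only [Mem.update_eq]
        by_cases he : t' = t
        · subst he
          simp only [if_true] at h2 h3
          simp [h3, h2, Finset.sum_range_succ, add_assoc]
        · simpa [he, h2] using h3
    · intro m₂ _ hI₂ t' ht'
      have h1 := hI₁ t' ht'
      have h2 := hI₂ t' ht'
      simp only [Mem.update_eq]
      by_cases he : t' = t
      · subst he
        simp only [lt_irrefl, if_false, if_true] at h1 h2
        simp [h1, h2]
      · have h7 : t' < t + 1 ↔ t' < t := by omega
        simpa [he, h7, h1] using h2
  · intro m' _ hI t ht
    rw [hI t ht, if_pos ht, Finset.sum_range]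
    congr 1
    refine Finset.sum_congr rfl fun u _ => ?_
    rw [Finset.sum_range]
    simp only [hsame, hT t ht]

theorem Params.ensures_bestProg (P : Params n L N S V) {m : Mem} (hH : Header n L N m)
    (h17 : m (17, 0) = 0) :
    Prog.bestProg.Ensures S V (fun m' => m' (17, 0) < L ∧
      ∀ t < L, m (10, m' (17, 0)) ≤ m (10, t)) m := by
  have hS := P.four_le_S
  have hL := P.L_lt_V
  have e11 (m₁ : Mem) (y : ℕ) : (m₁.update (11, 0) y : Mem) (17, 0) = m₁ (17, 0) := by
    simp [Mem.update_eq]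
  have e17 (m₁ : Mem) (y : ℕ) : (m₁.update (17, 0) y : Mem) (17, 0) = y := by
    simp [Mem.update_eq]
  refine .forTo (fun t m' => m' (17, 0) < L ∧ ∀ t' < t, m (10, m' (17, 0)) ≤ m (10, t')) L
    (by simpa [Expr.eval_var, Mem.update_eq] using hH.L_eq) (by decide) (by omega)
    (by omega) (by decide) ?_ ?_ ?_
  · simpa [Mem.update_eq, h17] using P.L_pos
  · intro t ht m' h11 hfr hI
    have f10 := hfr 10 (by decide) (by decide)
    have hcond : (Expr.sub (.read 10 (.var 17)) (.read 10 (.var 11))).eval m' =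
        m (10, m' (17, 0)) - m (10, t) := by
      simp only [Expr.eval_sub, Expr.eval_read, Expr.eval_var, h11, f10]
    refine .ite (fun h => ?_) fun h => .skip ?_
    · rw [hcond] at h
      refine .write (by decide) (by simp only [Expr.eval_const]; omega)
        (by rw [Expr.eval_var, h11]; omega) ?_
      simp only [Expr.eval_const, Expr.eval_var, h11, e11, e17]
      refine ⟨ht, fun t' ht' => ?_⟩
      rcases Nat.lt_succ_iff_lt_or_eq.1 ht' with h' | rfl
      · exact (Nat.le_of_lt (by omega)).trans (hI.2 t' h')
      · exact le_rfl
    · rw [hcond] at h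
      simp only [e11]
      refine ⟨hI.1, fun t' ht' => ?_⟩
      rcases Nat.lt_succ_iff_lt_or_eq.1 ht' with h' | rfl
      · exact hI.2 t' h'
      · omega
  · exact fun m' _ hI => hI

theorem Params.ensures_outputProg (P : Params n L N S V) {m : Mem} (hH : Header n L N m)
    {tbl : ℕ → Fin n → ℕ} (hT : Table L tbl m) (h17 : m (17, 0) < L) :
    Prog.outputProg.Ensures S V (fun m' => ∀ u : Fin n, m' (1, u.val) = tbl (m (17, 0)) u) m := by
  refine .of_fits fun hm => ?_
  have hS := P.four_le_S
  have hV := P.sq_lt_V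
  have hnn := Nat.le_mul_self n
  refine .forTo (fun i m' => ∀ u : Fin n, u.val < i → m' (1, u.val) = tbl (m (17, 0)) u) n
    (by simpa [Expr.eval_var, Mem.update_eq] using hH.n_eq) (by decide) (by omega)
    (by omega) (by decide) (by simp) ?_ ?_
  · intro i hi m' h13 hfr hI
    have hval : (Expr.read 9 (.cell (.var 17) (.var 0) (.var 13))).eval m' =
        tbl (m (17, 0)) ⟨i, hi⟩ := by
      simp only [Expr.eval_read, Expr.eval_cell, Expr.eval_var, h13,
        hfr 9 (by decide) (by decide), hfr 0 (by decide) (by decide),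
        hfr 17 (by decide) (by decide), hH.n_eq]
      exact hT _ h17 ⟨i, hi⟩
    refine .write (by decide) ?_ ?_ ?_
    · rw [Expr.eval_var, h13]; exact hi.trans_le P.n_le_S
    · rw [hval, ← hT _ h17 ⟨i, hi⟩]
      by_cases h0 : m (9, m (17, 0) * n + i) = 0
      · simp only [h0]; omega
      · exact (hm _ h0).2.2
    · intro u hu
      rw [hval, Expr.eval_var, h13]
      simp only [Mem.update_eq]
      by_cases he : u.val = i
      · have : u = ⟨i, hi⟩ := Fin.ext he
        subst this
        simp
      · simpa [he] using hI u (by omega)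
  · exact fun m' _ hI u => hI u u.2

/-- The score differs from twice the cost by a number independent of the labels, so minimising it
minimises the cost. A cut edge weighs 4, that is 2 per ordered pair: one unit for the disagreement
and one for the pair missing from the inside count. -/
theorem IsEdgeStream.score_eq {G : SimpleGraph (Fin n)} {s : List (Fin n × Fin n)}
    (hs : IsEdgeStream G s) (lab : Fin n → ℕ) [∀ u v, Decidable (G.Adj u v)] :
    (s.map fun e => if lab e.1 = lab e.2 then 0 else 4).sum +
      ∑ u, ∑ v, (if lab u = lab v then 1 else 0) =
    2 * cost G (Setoid.ker lab) + ∑ u, ∑ v, if G.Adj u v ∨ u = v then 1 else 0 := by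
  classical
  have h1 := hs.sum_map fun u v => if lab u = lab v then 0 else 2
  have h2 : (s.map fun e => if lab e.1 = lab e.2 then 0 else 4) =
      s.map fun e => (if lab e.1 = lab e.2 then 0 else 2) + if lab e.2 = lab e.1 then 0 else 2 := by
    refine List.map_congr_left fun e _ => ?_
    by_cases h : lab e.1 = lab e.2 <;> simp [h, eq_comm]
  rw [h2, h1, ← sum_disagree]
  simp only [← Finset.sum_add_distrib]
  refine Finset.sum_congr rfl fun u _ => Finset.sum_congr rfl fun v _ => ?_
  by_cases ha : G.Adj u v <;> by_cases he : lab u = lab v <;> by_cases huv : u = v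
  · exact absurd huv ha.ne
  · simp [ha, he, Disagree, huv, Setoid.ker_def]
  · exact absurd huv ha.ne
  · simp [ha, he, Disagree, huv, Setoid.ker_def]
  · simp [Disagree, huv]
  · simp [ha, he, Disagree, huv, Setoid.ker_def]
  · exact absurd (congrArg lab huv) he
  · simp [ha, he, Disagree, huv, Setoid.ker_def]

/-! ### The stored edges suffice -/

theorem hitsRun_append_singleton {G : SimpleGraph (Fin n)} (M j x : ℕ) (l : List ℕ) :
    hitsRun G M j (l ++ [x]) = hitsRun G M j l + hitsAt G M (j + l.length) x := by
  induction l generalizing j with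
  | nil => simp [hitsRun]
  | cons y l ih =>
    rw [List.cons_append, hitsRun, ih, hitsRun, List.length_cons,
      show j + 1 + l.length = j + (l.length + 1) by omega, add_assoc]

theorem hitsRun_map_range {G : SimpleGraph (Fin n)} (M : ℕ) (X : ℕ → ℕ) (k : ℕ) :
    hitsRun G M 0 ((List.range k).map X) = ∑ j ∈ Finset.range k, hitsAt G M j (X j) := by
  induction k with
  | zero => rfl
  | succ k ih =>
    rw [List.range_succ, List.map_append, List.map_singleton, hitsRun_append_singleton, ih,
      Finset.sum_range_succ, List.length_map, List.length_range, zero_add]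

-- Each relevant edge yields a hit: a draw equal to one endpoint while the other is within its
-- limit. Hits of distinct edges are distinct.
open Classical in
theorem IsEdgeStream.length_filter_relevant_le {G : SimpleGraph (Fin n)} {s : List (Fin n × Fin n)}
    (hs : IsEdgeStream G s) {M : ℕ} {X d : ℕ → ℕ} (hd : ∀ u : Fin n, d u = deg G u) :
    (s.filter fun e => Relevant M X d e).length ≤ hitsRun G M 0 ((List.range M).map X) := by
  have h1 := hs.sum_map fun u v => ∑ j ∈ Finset.range M,
    if X j = v.val ∧ j * (deg G u + 1) < M then 1 else 0
  have h2 : ∀ l : List (Fin n × Fin n), (l.filter fun e => Relevant M X d e).length =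
      (l.map fun e => if Relevant M X d e then 1 else 0).sum := by
    intro l
    induction l with
    | nil => rfl
    | cons e l ih =>
      by_cases h : Relevant M X d e
      · simp [h, ih, add_comm]
      · simp [h, ih]
  rw [h2, hitsRun_map_range]
  refine (List.sum_le_sum (fun e _ => ?_)).trans (h1.le.trans ?_)
  · split_ifs with hr
    · obtain ⟨j, hj, ⟨h3, h4⟩ | ⟨h3, h4⟩⟩ := hr
      · rw [hd] at h4
        refine le_add_right (le_trans ?_ (Finset.single_le_sum (fun _ _ => Nat.zero_le _)
          (Finset.mem_range.2 hj)))
        simp [h3, h4]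
      · rw [hd] at h4
        refine le_add_left (le_trans ?_ (Finset.single_le_sum (fun _ _ => Nat.zero_le _)
          (Finset.mem_range.2 hj)))
        simp [h3, h4]
    · exact Nat.zero_le _
  · have h3 : ∀ u v : Fin n, (if G.Adj u v then ∑ j ∈ Finset.range M,
        (if X j = v.val ∧ j * (deg G u + 1) < M then 1 else 0) else 0) =
        ∑ j ∈ Finset.range M, if G.Adj u v ∧ X j = v.val ∧ j * (deg G u + 1) < M then 1 else 0 := by
      intro u v
      by_cases h : G.Adj u v <;> simp [h]
    simp only [h3]
    have h4 : ∀ u : Fin n, (∑ v : Fin n, ∑ j ∈ Finset.range M,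
        if G.Adj u v ∧ X j = v.val ∧ j * (deg G u + 1) < M then 1 else 0) =
        ∑ j ∈ Finset.range M, ∑ v : Fin n,
        if G.Adj u v ∧ X j = v.val ∧ j * (deg G u + 1) < M then 1 else 0 :=
      fun u => Finset.sum_comm
    simp only [h4]
    rw [Finset.sum_comm]
    refine Finset.sum_le_sum fun j _ => Finset.sum_le_sum fun u _ => ?_
    split_ifs with h5
    · obtain ⟨w, hw, -⟩ := h5
      rw [Finset.sum_eq_single w]
      · split_ifs <;> simp
      · intro v _ hv
        refine if_neg fun h => hv (Fin.ext (h.2.1.symm.trans hw.symm))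
      · simp
    · rw [Finset.sum_eq_zero]
      intro v _
      refine if_neg fun h => h5 ⟨v, h.2.1.symm, h.1.symm, h.2.2⟩

-- If the cap is not exceeded, all relevant edges are kept. By `runLabel_congr` the run on the kept
-- edges then equals the run on the whole graph.
open Classical in
theorem IsEdgeStream.cost_finalLabel_le {G : SimpleGraph (Fin n)} {s : List (Fin n × Fin n)}
    (hs : IsEdgeStream G s) {M b cap : ℕ} (hM : 0 < M) {X d : ℕ → ℕ}
    (hd : ∀ u : Fin n, d u = deg G u)
    (h : ¬ FailRun G M b cap ((List.range M).map X)) :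
    cost G (Setoid.ker (runLabel (Joined (keptEdges M cap X d s)) (fun u => d u.val) M 0
      ((List.range M).map X) fun _ => 0)) ≤ b := by
  have hlen := hs.length_filter_relevant_le (M := M) (X := X) hd
  have hcap : hitsRun G M 0 ((List.range M).map X) ≤ cap := by
    by_contra hc
    exact h (Or.inr (Or.inr (not_le.1 hc)))
  have hmem : ∀ e, e ∈ keptEdges M cap X d s ↔ e ∈ s ∧ Relevant M X d e := by
    intro e
    rw [keptEdges, List.take_of_length_le (hlen.trans hcap), List.mem_filter, decide_eq_true_iff]
  have hd' : (fun u : Fin n => d u.val) = deg G := funext hd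
  have key := runLabel_congr (R := Joined (keptEdges M cap X d s)) (R' := G.Adj) (d := deg G)
    (M := M) (j := 0) (l := (List.range M).map X) (lab := fun _ => 0)
    (fun u _ => by simpa using hM) (by
      intro i hi w u hw hlt
      simp only [List.length_map, List.length_range] at hi
      simp only [List.getElem_map, List.getElem_range] at hw
      rw [zero_add] at hlt
      rw [hs.adj_iff, Joined, hmem, hmem]
      refine ⟨Or.imp And.left And.left, Or.imp (fun h => ⟨h, i, hi, Or.inr ⟨hw.symm, ?_⟩⟩)
        fun h => ⟨h, i, hi, Or.inl ⟨hw.symm, ?_⟩⟩⟩ <;> simpa only [hd] using hlt)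
  rw [hd', key]
  exact cost_ker_runLabel_le hM (by simp) h

end CorrClust

/-! ### Assembly: initial parameters, distribution of the draws, memory bound and success
probability. -/

namespace CorrClust

variable {n L N S V : ℕ}

/-! ### The deterministic part of the program -/

/-- One good candidate suffices. Scores are computed from the full stream, so a candidate whose edge
list overflowed is still scored by its true cost and can win only by being at least as good. -/
theorem Params.leads_restProg (P : Params n L N S V) {G : SimpleGraph (Fin n)}
    {σ : ℕ → List (Fin n × Fin n)} (hσ : ∀ j, IsEdgeStream G (σ j)) {s : Config n}
    (hH : Header n L N s.mem) (h0 : ∀ a ∈ [5, 6, 9, 10, 17], ∀ i, s.mem (a, i) = 0) :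
    Prog.restProg.Leads S V σ (fun s' => s'.passes = s.passes + 3 ∧
      ∀ b, (∃ t < L, ¬ FailRun G (numDraws L N) b (maxStored n L)
        ((List.range (numDraws L N)).map fun j => s.mem (4, t * numDraws L N + j))) →
        cost G s'.clustering ≤ b) s := by
  classical
  have hV := P.sq_lt_V
  set M := numDraws L N with hM
  have hM0 : 0 < M := by
    have := P.L_pos
    have : 0 < N := P.n_pos.trans_le P.n_le
    rw [hM, numDraws]; positivity
  refine .seq ((P.leads_degreeProg (hσ _) hH (h0 5 (by decide))).mono ?_)
  rintro s₁ ⟨p₁, hH₁, hd, f₁⟩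
  refine .seq ((P.leads_storeProg (hσ _) hH₁
    (fun i => (f₁ 6 (by decide) (by decide) i).trans (h0 6 (by decide) i))).mono ?_)
  rintro s₂ ⟨p₂, hH₂, hF, f₂⟩
  set F : ℕ → List (Fin n × Fin n) := fun t => keptEdges M (maxStored n L)
    (fun j => s₁.mem (4, t * M + j)) (fun i => s₁.mem (5, i)) (σ s₁.passes) with hFdef
  refine .seq (.of_ensures (P.ensures_simulateProg hH₂ (F := F) hF
    (fun t => keptEdges_length_le _ _ _ _ _)
    (fun i => ((f₂ 9 (by decide) i).trans (f₁ 9 (by decide) (by decide) i)).trans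
      (h0 9 (by decide) i))) ?_)
  intro m₃ hT f₃
  set tbl := finalLabel L N s₂.mem F with htbl
  set s₃ : Config n := { mem := m₃, unread := s₂.unread, passes := s₂.passes } with hs₃
  have hH₃ : Header n L N s₃.mem := hH₂.congr (f₃ 0 (by decide) 0) (f₃ 2 (by decide) 0)
    (f₃ 3 (by decide) 0)
  refine .seq ((P.leads_cutProg (s := s₃) (hσ _) hH₃ (fun i => ((f₃ 10 (by decide) i).trans
    ((f₂ 10 (by decide) i).trans (f₁ 10 (by decide) (by decide) i))).trans (h0 10 (by decide) i))
    hT).mono ?_)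
  rintro s₄ ⟨p₄, hH₄, hcut, f₄⟩
  have hT₄ : Table L tbl s₄.mem := hT.congr (f₄ 9 (by decide))
  have hscore := fun t => (hσ s₃.passes).score_eq (tbl t)
  refine .seq (.of_ensures (P.ensures_insideProg hH₄ ?_ hT₄) ?_)
  · intro t ht
    have h1 := List.sum_le_card_nsmul ((σ s₃.passes).map fun e =>
      if tbl t e.1 = tbl t e.2 then 0 else 4) 4 (by
        intro x hx
        obtain ⟨e, -, rfl⟩ := List.mem_map.1 hx
        split_ifs <;> omega)
    have h2 := (hσ s₃.passes).length_le
    rw [hcut t ht]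
    rw [List.length_map, smul_eq_mul] at h1
    omega
  intro m₅ hin f₅
  have hT₅ : Table L tbl m₅ := hT₄.congr (f₅ 9 (by decide))
  have hH₅ : Header n L N m₅ := hH₄.congr (f₅ 0 (by decide) 0) (f₅ 2 (by decide) 0)
    (f₅ 3 (by decide) 0)
  have h17 : m₅ (17, 0) = 0 := by
    rw [f₅ 17 (by decide), f₄ 17 (by decide), f₃ 17 (by decide), f₂ 17 (by decide),
      f₁ 17 (by decide) (by decide), h0 17 (by decide)]
  refine .seq (.of_ensures (P.ensures_bestProg hH₅ h17) ?_)
  rintro m₆ ⟨hb, hbest⟩ f₆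
  refine .of_ensures (P.ensures_outputProg (hH₅.congr (f₆ 0 (by decide) 0) (f₆ 2 (by decide) 0)
    (f₆ 3 (by decide) 0)) (hT₅.congr (f₆ 9 (by decide))) hb) ?_
  intro m₇ hout _
  refine ⟨?_, ?_⟩
  · change s₄.passes = s.passes + 3
    rw [p₄, hs₃, p₂, p₁]
  · rintro b ⟨t, ht, hfail⟩
    have hcl : Config.clustering (n := n) { mem := m₇, unread := s₄.unread, passes := s₄.passes } =
        Setoid.ker (tbl (m₆ (17, 0))) := by
      unfold Config.clustering
      congr 1
      funext u
      exact hout u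
    rw [hcl]
    have h1 := hbest t ht
    rw [hin _ hb, hin _ ht, hcut _ hb, hcut _ ht, hscore, hscore] at h1
    have h4 : ∀ i, s₁.mem (4, i) = s.mem (4, i) := f₁ 4 (by decide) (by decide)
    have h2 := (hσ s₁.passes).cost_finalLabel_le (b := b) (cap := maxStored n L) hM0
      (X := fun j => s₁.mem (4, t * M + j)) (d := fun i => s₁.mem (5, i)) hd
      (by simpa only [h4] using hfail)
    have h3 : tbl t = runLabel (Joined (F t)) (fun u => s₁.mem (5, u.val)) M 0
        ((List.range M).map fun j => s₁.mem (4, t * M + j)) fun _ => 0 := by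
      simp only [htbl, finalLabel, f₂ 5 (by decide), f₂ 4 (by decide), hM]
    rw [← h3] at h2
    omega

/-! ### Initialization -/

/-- The number of candidates. -/
def levels (n : ℕ) : ℕ := Nat.log 2 n + 1

/-- A bound for the indices. -/
def indexBound (n : ℕ) : ℕ := 200 * n * levels n ^ 2

/-- A bound for the contents of cells. -/
def valueBound (n : ℕ) : ℕ := 2000 * (n * levels n) ^ 2

/-- Since N ≤ 2n, there are at most 24nl draws and 104nl stored edges per candidate, where l is the
number of candidates. The factors 200 and 2000 absorb these constants. -/
theorem params (hn : 1 ≤ n) :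
    Params n (levels n) (2 ^ levels n) (indexBound n) (valueBound n) := by
  have h1 : n < 2 ^ levels n := Nat.lt_pow_succ_log_self (by norm_num) n
  have h2 : 2 ^ levels n ≤ 2 * n := by
    rw [levels, pow_succ, mul_comm]
    exact Nat.mul_le_mul_left _ (Nat.pow_log_le_self 2 (by omega))
  have h3 : 1 ≤ levels n := by simp [levels]
  have h4 : levels n < 2 ^ levels n := Nat.lt_two_pow_self
  have e1 : indexBound n = 200 * (n * levels n * levels n) := by unfold indexBound; ring
  have e2 : valueBound n = 2000 * ((n * levels n) * (n * levels n)) := by unfold valueBound; ring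
  generalize levels n = l at *
  generalize hN : 2 ^ l = N at *
  have hM : numDraws l N ≤ 24 * (n * l) := by
    unfold numDraws; nlinarith
  have hc : maxStored n l ≤ 104 * (n * l) := by
    unfold maxStored; nlinarith
  have hnl : n ≤ n * l := Nat.le_mul_of_pos_right _ h3
  have hll : l ≤ n * l := Nat.le_mul_of_pos_left _ hn
  have hnll : n * l ≤ n * l * l := Nat.le_mul_of_pos_right _ h3
  have hsq : n * l * l ≤ (n * l) * (n * l) := Nat.mul_le_mul_left _ hll
  have hnn : n * n ≤ (n * l) * (n * l) := Nat.mul_le_mul hnl hnl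
  have hlM : l * numDraws l N ≤ 24 * (n * l * l) := by nlinarith
  have hlc : l * maxStored n l ≤ 104 * (n * l * l) := by nlinarith
  have hMM : numDraws l N * numDraws l N ≤ 576 * ((n * l) * (n * l)) := by nlinarith
  have hln : l * n = n * l := mul_comm _ _
  constructor <;> omega

/-- Either the power of two has passed n, or it has doubled in every iteration; n iterations suffice
because n < 2^n. The bound 2^k ≤ 2n shows that doubling stops at k = ⌊log₂ n⌋ + 1. -/
theorem ensures_initProg (hn : 1 ≤ n) {m : Mem} (h0 : m (0, 0) = n) (h2 : m (2, 0) = 0) :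
    Prog.initProg.Ensures (indexBound n) (valueBound n)
      (Header n (levels n) (2 ^ levels n)) m := by
  have P := params hn
  have hS := P.four_le_S
  have hV := P.sq_lt_V
  have hnn := Nat.le_mul_self n
  refine .seq (.write (by decide) (by simp only [Expr.eval_const]; omega)
    (by simp only [Expr.eval_const]; omega) ?_)
  simp only [Expr.eval_const]
  have e0 : (Expr.var 0).eval (m.update (3, 0) 1) = n := by
    simpa [Expr.eval_var, Mem.update_eq] using h0
  refine .loop (fun i m' => m' (0, 0) = n ∧ ∃ k, m' (2, 0) = k ∧ m' (3, 0) = 2 ^ k ∧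
    2 ^ k ≤ 2 * n ∧ (n < 2 ^ k ∨ k = i)) (by omega) ?_ ?_ ?_
  · exact ⟨by simpa [Mem.update_eq] using h0, 0, by simpa [Mem.update_eq] using h2,
      by simp [Mem.update_eq], by omega, Or.inr rfl⟩
  · rintro i - m' ⟨a0, k, a2, a3, hk, hki⟩
    have hc : (Expr.sub (.add (.var 0) (.const 1)) (.var 3)).eval m' = n + 1 - 2 ^ k := by
      simp only [Expr.eval_sub, Expr.eval_add, Expr.eval_var, Expr.eval_const, a0, a3]
    have hk2 : k < 2 ^ k := Nat.lt_two_pow_self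
    refine .ite (fun h => ?_) fun h => .skip ?_
    · rw [hc] at h
      refine .seq (.write (by decide) (by simp only [Expr.eval_const]; omega)
        (by simp only [Expr.eval_mul, Expr.eval_const, Expr.eval_var, a3]; omega) ?_)
      simp only [Expr.eval_mul, Expr.eval_const, Expr.eval_var, a3]
      have e2 : (Expr.add (.var 2) (.const 1)).eval (m'.update (3, 0) (2 * 2 ^ k)) = k + 1 := by
        simp [Expr.eval_add, Expr.eval_const, Expr.eval_var, Mem.update_eq, a2]
      refine .write (by decide) (by simp only [Expr.eval_const]; omega) (by rw [e2]; omega) ?_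
      rw [e2, Expr.eval_const]
      refine ⟨by simpa [Mem.update_eq] using a0, k + 1, by simp [Mem.update_eq],
        by simp [Mem.update_eq, pow_succ, mul_comm], by rw [pow_succ]; omega, Or.inr ?_⟩
      omega
    · rw [hc] at h
      exact ⟨a0, k, a2, a3, hk, Or.inl (by omega)⟩
  · rw [e0]
    rintro m' ⟨a0, k, a2, a3, hk, hki⟩
    have hlt : n < 2 ^ k := by
      rcases hki with h | rfl
      · exact h
      · exact Nat.lt_two_pow_self
    obtain ⟨j, rfl⟩ : ∃ j, k = j + 1 := ⟨k - 1, by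
      rcases k with _ | k
      · simp at hlt; omega
      · rfl⟩
    have hlog : Nat.log 2 n = j :=
      Nat.log_eq_of_pow_le_of_lt_pow (by rw [pow_succ] at hk; omega) hlt
    have hl : levels n = j + 1 := by rw [levels, hlog]
    exact ⟨a0, a2.trans hl.symm, a3.trans (by rw [hl])⟩

/-! ### The random part of the program -/

/-- Only the memory bounds for all outcomes are needed here; the distribution of the draws is
treated separately. -/
theorem Params.ensures_drawProg (P : Params n L N S V) {m : Mem} (hH : Header n L N m) :
    Prog.drawProg.Ensures S V (fun _ => True) m := by
  have hS := P.four_le_S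
  have hV := P.N_lt_V
  refine .forTo (fun _ _ => True) (L * numDraws L N) ?_ (by decide) (by omega) P.draws_lt_V
    (by decide) trivial ?_ fun _ _ _ => trivial
  · rw [Expr.eval_mul, (hH.congr (by simp [Mem.update_eq]) (by simp [Mem.update_eq])
      (by simp [Mem.update_eq]) : Header n L N _).eval_draws]
    simp [Expr.eval_var, Mem.update_eq, hH.L_eq]
  · intro i hi m' h18 hfr _
    have hiS : i < S := hi.trans_le P.draws_le_S
    have e2 : m' (2, 0) = L := (hfr 2 (by decide) (by decide) 0).trans hH.L_eq
    refine .seq (.write (by decide) (by rw [Expr.eval_var, h18]; exact hiS)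
      (by simp only [Expr.eval_const]; omega) ?_)
    rw [Expr.eval_var, h18, Expr.eval_const]
    have e2' : (Expr.var 2).eval (m'.update (4, i) 0) = L := by
      simpa [Expr.eval_var, Mem.update_eq] using e2
    refine .loop (fun k m'' => m'' (18, 0) = i ∧ m'' (4, i) < 2 ^ k)
      (by rw [e2']; have := P.L_lt_V; omega) ?_ ?_ fun _ _ => trivial
    · simp [Mem.update_eq, h18]
    · rw [e2']
      rintro k hk m'' ⟨b1, b2⟩
      refine .seq (.flip (by decide) (by simp only [Expr.eval_const]; omega) (by omega) fun b => ?_)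
      have hb : b.toNat ≤ 1 := Bool.toNat_le b
      have ev : (Expr.var 18).eval (m''.update (16, 0) b.toNat) = i := by
        simpa [Expr.eval_var, Mem.update_eq] using b1
      have ew : (Expr.add (.mul (.const 2) (.read 4 (.var 18))) (.var 16)).eval
          (m''.update (16, 0) b.toNat) = 2 * m'' (4, i) + b.toNat := by
        rw [Expr.eval_add, Expr.eval_mul, Expr.eval_read, ev]
        simp [Expr.eval_const, Expr.eval_var, Mem.update_eq]
      have hk' : 2 ^ (k + 1) ≤ N := by
        rw [P.N_eq]
        exact Nat.pow_le_pow_right (by norm_num) hk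
      have hk2 : 2 ^ (k + 1) = 2 * 2 ^ k := by ring
      refine .write (by decide) (by rw [Expr.eval_const, ev]; exact hiS) ?_ ?_
      · rw [Expr.eval_const, ew]; omega
      · rw [Expr.eval_const, ev, ew]
        refine ⟨by simpa [Mem.update_eq] using b1, ?_⟩
        simp only [Mem.update_eq, and_self, if_true]
        omega

/-- The list `h` of draws has been made, and the `h.length`-th draw is to be made. -/
structure Drawn (n L N S V : ℕ) (h : List ℕ) (s : Config n) : Prop where
  fits : s.mem.Fits S V
  passes : s.passes = 0
  header : Header n L N s.mem
  drawn : ∀ (i : ℕ) (hi : i < h.length), s.mem (4, i) = h[i]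
  zero : ∀ a, a ∉ [0, 2, 3, 4, 16, 18] → ∀ i, s.mem (a, i) = 0

theorem Drawn.update {h : List ℕ} {s : Config n} (hs : Drawn n L N S V h s) {a i x : ℕ}
    (ha : a = 4 ∧ h.length ≤ i ∨ a = 16 ∨ a = 18) (hi : i < S) (hx : x < V) :
    Drawn n L N S V h { s with mem := s.mem.update (a, i) x } where
  fits := hs.fits.update (by omega) hi hx
  passes := hs.passes
  header := hs.header.congr (by simp [Mem.update_eq]; omega) (by simp [Mem.update_eq]; omega)
    (by simp [Mem.update_eq]; omega)
  drawn := fun j hj => by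
    rw [Mem.update_eq, if_neg (by omega)]
    exact hs.drawn j hj
  zero := fun b hb j => by
    rw [Mem.update_eq, if_neg]
    · exact hs.zero b hb j
    · rintro ⟨rfl, -⟩
      simp only [List.mem_cons, List.not_mem_nil, or_false, not_or] at hb
      omega

/-- With the leading bits `y` fixed and k bits to come, the draw is uniform on the block of length
2^k starting at y · 2^k. One flip chooses between the two halves of the block, and the average over
a block is the mean of the averages over its halves. -/
theorem Params.expect_bitProg_le (P : Params n L N S V) (σ : ℕ → List (Fin n × Fin n)) {h : List ℕ}
    (hS : h.length < S) (F : Config n → ℝ≥0∞) (c : ℕ → ℝ≥0∞) (k y : ℕ) (s : Config n)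
    (hs : Drawn n L N S V h s) (h18 : s.mem (18, 0) = h.length) (hy : s.mem (4, h.length) = y)
    (hk : (y + 1) * 2 ^ k ≤ N)
    (hF : ∀ x < 2 ^ k, ∀ s', Drawn n L N S V h s' → s'.mem (18, 0) = h.length →
      s'.mem (4, h.length) = y * 2 ^ k + x → F s' ≤ c (y * 2 ^ k + x)) :
    (Action.repeated (Prog.bitProg.exec σ) k).expect F s ≤
      (∑ x ∈ Finset.range (2 ^ k), c (y * 2 ^ k + x)) / ((2 ^ k : ℕ) : ℝ≥0∞) := by
  have hSV := P.four_le_S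
  have hV := P.N_lt_V
  induction k generalizing y s with
  | zero =>
    rw [Action.repeated, Action.expect_step, PMF.tsum_pure_mul]
    simpa using hF 0 (by simp) s hs h18 (by simpa using hy)
  | succ k ih =>
    have hb : ∀ b : ℕ, b < 2 → (Action.repeated (Prog.bitProg.exec σ) k).expect F
        { s with mem := (s.mem.update (16, 0) b).update (4, h.length) (2 * y + b) } ≤
        (∑ x ∈ Finset.range (2 ^ k), c ((2 * y + b) * 2 ^ k + x)) / ((2 ^ k : ℕ) : ℝ≥0∞) := by
      intro b hb
      have h1 : (2 * y + b + 1) * 2 ^ k ≤ N := by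
        refine le_trans ?_ hk
        rw [pow_succ, mul_comm (2 ^ k) 2, ← mul_assoc]
        exact Nat.mul_le_mul_right _ (by omega)
      have h2 : 2 * y + b < V := by
        have : (2 * y + b + 1) * 1 ≤ (2 * y + b + 1) * 2 ^ k :=
          Nat.mul_le_mul_left _ Nat.one_le_two_pow
        omega
      refine ih (2 * y + b) _ ((hs.update (a := 16) (i := 0) (x := b) (by omega) (by omega)
        (by omega)).update (a := 4) (i := h.length) (x := 2 * y + b) (by omega) hS h2)
        (by simpa [Mem.update_eq] using h18) (by simp [Mem.update_eq]) h1 ?_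
      intro x hx s' hs' h18' hx'
      have e : (2 * y + b) * 2 ^ k + x = y * 2 ^ (k + 1) + (b * 2 ^ k + x) := by ring
      rw [e] at hx' ⊢
      refine hF _ ?_ s' hs' h18' hx'
      have h3 : b * 2 ^ k ≤ 1 * 2 ^ k := Nat.mul_le_mul_right _ (by omega)
      rw [pow_succ]
      omega
    rw [Action.repeated, Action.expect_andThen]
    have hstep : ∀ b : ℕ, ((Prog.write 4 (.var 18) (.add (.mul (.const 2) (.read 4 (.var 18)))
        (.var 16))).exec σ).expect ((Action.repeated (Prog.bitProg.exec σ) k).expect F)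
        { s with mem := s.mem.update (16, 0) b } =
        (Action.repeated (Prog.bitProg.exec σ) k).expect F
        { s with mem := (s.mem.update (16, 0) b).update (4, h.length) (2 * y + b) } := by
      intro b
      rw [Prog.exec, Action.expect_pure]
      have ev : (Expr.var 18).eval (s.mem.update (16, 0) b) = h.length := by
        simpa [Expr.eval_var, Mem.update_eq] using h18
      have ew : (Expr.add (.mul (.const 2) (.read 4 (.var 18))) (.var 16)).eval
          (s.mem.update (16, 0) b) = 2 * y + b := by
        rw [Expr.eval_add, Expr.eval_mul, Expr.eval_read, ev]
        simp [Expr.eval_const, Expr.eval_var, Mem.update_eq, hy]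
      simp only [ev, ew]
    have h0 := hb 0 (by omega)
    have h1 := hb 1 (by omega)
    generalize (Action.repeated (Prog.bitProg.exec σ) k).expect F = F' at hstep h0 h1 ⊢
    rw [Prog.bitProg, Prog.exec, Action.expect_andThen, Prog.expect_flip]
    simp only [Expr.eval_const]
    rw [hstep 0, hstep 1]
    refine (ENNReal.div_le_div_right (add_le_add h0 h1) 2).trans (le_of_eq ?_)
    rw [← ENNReal.add_div, pow_succ, mul_two, Finset.sum_range_add, ← mul_two, Nat.cast_mul,
      div_eq_mul_inv, div_eq_mul_inv, div_eq_mul_inv, ENNReal.mul_inv (by simp) (by simp), mul_assoc]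
    congr 2
    · refine Finset.sum_congr rfl fun x _ => congrArg c ?_
      ring
    · refine Finset.sum_congr rfl fun x _ => congrArg c ?_
      ring

theorem Prog.exec_seq (σ : ℕ → List (Fin n × Fin n)) (p q : Prog) :
    (p.seq q).exec σ = Action.andThen (p.exec σ) (q.exec σ) := rfl

theorem Prog.exec_write (σ : ℕ → List (Fin n × Fin n)) (a : ℕ) (i e : Expr) :
    (Prog.write a i e).exec σ = Action.step fun s =>
      PMF.pure { s with mem := s.mem.update (a, i.eval s.mem) (e.eval s.mem) } := rfl

/-- The draws are independent and uniformly distributed. -/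
theorem Params.expect_drawProg_le (P : Params n L N S V) (σ : ℕ → List (Fin n × Fin n))
    {F : Config n → ℝ≥0∞} {c : List ℕ → ℝ≥0∞} {s : Config n} (hs : Drawn n L N S V [] s)
    (hF : ∀ l, l.length = L * numDraws L N → ∀ s', Drawn n L N S V l s' → F s' ≤ c l) :
    (Prog.drawProg.exec σ).expect F s ≤ avg N (L * numDraws L N) c := by
  have hS4 := P.four_le_S
  have hSV := P.N_lt_V
  have hcount : (Expr.mul (.var 2) .draws).eval (s.mem.update (18, 0) 0) = L * numDraws L N := by
    rw [Expr.eval_mul, (hs.header.congr (by simp [Mem.update_eq]) (by simp [Mem.update_eq])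
      (by simp [Mem.update_eq]) : Header n L N _).eval_draws]
    simp [Expr.eval_var, Mem.update_eq, hs.header.L_eq]
  rw [Prog.drawProg, Prog.forTo, Prog.exec, Action.expect_andThen, Prog.exec, Action.expect_pure]
  simp only [Expr.eval_const]
  change (Action.withExtra _ _).expect F _ ≤ _
  rw [Action.expect_withExtra, hcount]
  refine Action.expect_repeated_le (fun h s => Drawn n L N S V h s ∧ s.mem (18, 0) = h.length)
    (L * numDraws L N) [] c ?_ _ ⟨hs.update (by omega) (by omega) (by omega),
      by simp [Mem.update_eq]⟩ fun l hl _ s' hs' => hF l hl s' hs'.1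
  rintro h s₁ F' c' hlen ⟨hs₁, h18⟩ hF'
  rw [List.length_nil, zero_add] at hlen
  have hlS : h.length < S := hlen.trans_le P.draws_le_S
  have hlV : h.length + 1 < V := by
    have := P.draws_lt_V
    omega
  rw [Prog.exec_seq, Action.expect_andThen, Prog.exec_seq, Action.expect_andThen, Prog.exec_write,
    Action.expect_pure]
  have ev : (Expr.var 18).eval s₁.mem = h.length := h18
  simp only [ev, Expr.eval_const]
  have eL : (Expr.var 2).eval (s₁.mem.update (4, h.length) 0) = L := by
    simpa [Expr.eval_var, Mem.update_eq] using hs₁.header.L_eq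
  change (Action.withExtra _ _).expect _ _ ≤ _
  rw [Action.expect_withExtra, eL]
  refine (P.expect_bitProg_le σ hlS _ c' L 0 _ (hs₁.update (by omega) hlS (by omega))
    (by simpa [Mem.update_eq] using h18) (by simp [Mem.update_eq]) (by rw [P.N_eq]; omega) ?_).trans
    (le_of_eq ?_)
  · intro x hx s₂ hs₂ h18' hx'
    rw [zero_mul, zero_add] at hx' ⊢
    rw [Prog.exec_write, Action.expect_pure]
    refine hF' x (by rw [P.N_eq]; exact hx) _ ?_
    have e1 : (Expr.add (.read 18 (.const 0)) (.const 1)).eval s₂.mem = h.length + 1 := by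
      rw [← Expr.var, Expr.eval_add, Expr.eval_var, h18', Expr.eval_const]
    simp only [e1, Expr.eval_const]
    have hs₃ := hs₂.update (a := 18) (i := 0) (x := h.length + 1) (by omega) (by omega) hlV
    refine ⟨⟨hs₃.fits, hs₃.passes, hs₃.header, fun i hi => ?_, hs₃.zero⟩, by simp [Mem.update_eq]⟩
    rw [List.length_append, List.length_singleton] at hi
    rcases Nat.lt_succ_iff_lt_or_eq.1 hi with hi' | rfl
    · rw [hs₃.drawn i hi', List.getElem_append_left hi']
    · simpa [Mem.update_eq] using hx'
  · simp only [zero_mul, zero_add]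
    rw [P.N_eq]

/-! ### The whole program -/

theorem drawn_start (hn : 1 ≤ n) (σ : ℕ → List (Fin n × Fin n)) :
    Prog.initProg.Leads (indexBound n) (valueBound n) σ
      (fun s => s.passes = 0 ∧ Header n (levels n) (2 ^ levels n) s.mem ∧
        ∀ a, a ∉ [0, 2, 3, 4, 16, 18] → ∀ i, s.mem (a, i) = 0)
      { mem := Finsupp.single (0, 0) n, unread := [], passes := 0 } := by
  refine .of_ensures (ensures_initProg hn (by simp) (by simp)) ?_
  intro m hm hfr
  refine ⟨rfl, hm, fun a ha i => ?_⟩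
  simp only [List.mem_cons, List.not_mem_nil, or_false, not_or] at ha
  rw [hfr a (by simp [Prog.initProg, Prog.mods]; omega)]
  refine Finsupp.single_eq_of_ne ?_
  intro h
  exact ha.1 (Prod.mk.inj h).1

theorem start_fits (hn : 1 ≤ n) :
    Mem.Fits (indexBound n) (valueBound n) (Finsupp.single (0, 0) n) := by
  have P := params hn
  have h1 := P.four_le_S
  have h2 := P.sq_lt_V
  have h3 := Nat.le_mul_self n
  intro ai hai
  obtain rfl : ai = (0, 0) := by
    by_contra h
    exact hai (Finsupp.single_eq_of_ne h)
  simp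
  omega

theorem leads_clusterProg (hn : 1 ≤ n) {G : SimpleGraph (Fin n)} {σ : ℕ → List (Fin n × Fin n)}
    (hσ : ∀ j, IsEdgeStream G (σ j)) :
    Prog.clusterProg.Leads (indexBound n) (valueBound n) σ (fun s => s.passes = 3)
      { mem := Finsupp.single (0, 0) n, unread := [], passes := 0 } := by
  have P := params hn
  refine .seq ((drawn_start hn σ).mono ?_)
  rintro s ⟨hp, hH, hz⟩
  refine .seq (.of_ensures (P.ensures_drawProg hH) ?_)
  intro m _ hfr
  refine (P.leads_restProg hσ (hH.congr (hfr 0 (by decide) 0) (hfr 2 (by decide) 0)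
    (hfr 3 (by decide) 0)) ?_).mono fun s' hs' => hs'.1.trans (by simp [hp])
  intro a ha i
  have h1 : a ∉ [0, 2, 3, 4, 16, 18] := by
    simp only [List.mem_cons, List.not_mem_nil, or_false] at ha ⊢
    omega
  have h2 : a ∉ Prog.drawProg.mods := by
    simp only [Prog.drawProg, Prog.forTo, Prog.mods, Prog.bitProg, List.mem_append,
      List.mem_cons, List.not_mem_nil, or_false] at ha ⊢
    omega
  exact (hfr a h2 i).trans (hz a h1 i)

theorem isSemiStreaming_clusterProg : Prog.clusterProg.IsSemiStreaming := by
  refine ⟨200000, 3, fun n hn G σ hσ r hr => ?_⟩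
  have h1 := (leads_clusterProg hn hσ (start_fits hn) r hr).2.2
  have hd : Prog.clusterProg.depth ≤ 10 := by decide
  have hl : 1 ≤ levels n := by simp [levels]
  have hn2 : n < 2 ^ levels n := Nat.lt_pow_succ_log_self (by norm_num) n
  have hl2 : levels n < 2 ^ levels n := Nat.lt_two_pow_self
  -- Here 2000 < 2^11, both n and l are below 2^l, and 11 + 4l ≤ 15l because l ≥ 1.
  have hV : Nat.size (valueBound n) ≤ 15 * levels n := by
    rw [Nat.size_le]
    calc valueBound n < 2 ^ 11 * (2 ^ levels n * 2 ^ levels n) ^ 2 := by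
          unfold valueBound
          refine Nat.mul_lt_mul_of_lt_of_le (by norm_num) ?_ (by positivity)
          gcongr
      _ = 2 ^ (11 + 4 * levels n) := by rw [pow_add]; congr 1; ring
      _ ≤ _ := Nat.pow_le_pow_right (by norm_num) (by omega)
  have hSV : indexBound n ≤ valueBound n := by
    unfold indexBound valueBound
    have : n * levels n ^ 2 ≤ (n * levels n) ^ 2 := by
      rw [mul_pow]
      exact Nat.mul_le_mul_right _ (Nat.le_self_pow (by norm_num) n)
    rw [mul_assoc]
    omega
  have hS : Nat.size (indexBound n) ≤ 15 * levels n := (Nat.size_le_size hSV).trans hV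
  calc r.2 ≤ fitBits (indexBound n) (valueBound n) +
        Prog.clusterProg.depth * Nat.size (valueBound n) := h1
    _ ≤ 30 * indexBound n * (15 * levels n + 15 * levels n) + 10 * (15 * levels n) := by
        unfold fitBits
        gcongr
    _ ≤ 180000 * (n * levels n ^ 3) + 150 * (n * levels n ^ 3) := by
        refine add_le_add (le_of_eq (by unfold indexBound; ring)) ?_
        have : levels n ≤ n * levels n ^ 3 :=
          (Nat.le_self_pow (by norm_num) _).trans (Nat.le_mul_of_pos_left _ hn)
        omega
    _ ≤ 200000 * n * levels n ^ 3 := by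
        rw [mul_assoc]
        omega

theorem exists_cost_le (G : SimpleGraph (Fin n)) : ∃ Q, ∀ Q', cost G Q ≤ cost G Q' := by
  obtain ⟨Q, hQ⟩ := Nat.sInf_mem (Set.range_nonempty (cost G))
  exact ⟨Q, fun Q' => hQ ▸ Nat.sInf_le ⟨Q', rfl⟩⟩

-- For fixed draws the failure indicator of the output is at most the indicator that every block of
-- M draws fails, since a single good block already gives cost at most 48 times the optimum. The
-- blocks are independent, and 2^(-L) ≤ 1/n.
open Classical in
theorem expect_clusterProg_le (hn : 1 ≤ n) {G : SimpleGraph (Fin n)} {σ : ℕ → List (Fin n × Fin n)}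
    (hσ : ∀ j, IsEdgeStream G (σ j)) :
    (Prog.clusterProg.exec σ).expect (fun s => if IsApprox 48 G s.clustering then 0 else 1)
      { mem := Finsupp.single (0, 0) n, unread := [], passes := 0 } ≤ (n : ℝ≥0∞)⁻¹ := by
  have P := params hn
  obtain ⟨Q, hQ⟩ := exists_cost_le G
  rw [Prog.clusterProg, Prog.exec, Action.expect_andThen]
  refine Action.expect_le_of_support _ _ _ _ fun r hr => ?_
  obtain ⟨hfit, ⟨hp, hH, hz⟩, -⟩ := drawn_start hn σ (start_fits hn) r hr
  rw [Prog.exec, Action.expect_andThen]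
  set M := numDraws (levels n) (2 ^ levels n) with hM
  refine (P.expect_drawProg_le σ ⟨hfit, hp, hH, fun i hi => absurd hi (by simp), hz⟩
    (c := fun l => if ∀ t < levels n, FailRun G M (48 * cost G Q) (maxStored n (levels n))
      ((l.drop (t * M)).take M) then 1 else 0) ?_).trans ?_
  · intro l hl s hs
    replace hl : l.length = levels n * M := hl
    have hlead := P.leads_restProg hσ hs.header (fun a ha i => hs.zero a (by
      simp only [List.mem_cons, List.not_mem_nil, or_false] at ha ⊢
      omega) i) hs.fits
    refine Action.expect_le_of_support _ _ _ _ fun r' hr' => ?_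
    have h1 := (hlead r' hr').2.1.2 (48 * cost G Q)
    by_cases hall : ∀ t < levels n, FailRun G M (48 * cost G Q) (maxStored n (levels n))
      ((l.drop (t * M)).take M)
    · rw [if_pos hall]
      split_ifs <;> simp
    · push Not at hall
      obtain ⟨t, ht, hf⟩ := hall
      have hchunk : ((List.range M).map fun j => s.mem (4, t * M + j)) =
          (l.drop (t * M)).take M := by
        have hle : (t + 1) * M ≤ levels n * M := Nat.mul_le_mul_right _ ht
        rw [add_mul, one_mul] at hle
        refine List.ext_getElem (by simp; omega) fun j hj _ => ?_
        replace hj : j < M := by simpa using hj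
        simp only [List.getElem_map, List.getElem_range, List.getElem_take, List.getElem_drop]
        exact hs.drawn _ (by omega)
      have h2 := h1 ⟨t, ht, by rwa [hchunk]⟩
      rw [if_pos]
      · exact zero_le
      · intro Q'
        exact h2.trans (Nat.mul_le_mul_left _ (hQ Q'))
  · refine (avg_blocks_le _ 2⁻¹ (avg_failRun_le hn P.L_pos rfl P.n_le rfl Q) _).trans ?_
    rw [← ENNReal.inv_pow, ENNReal.inv_le_inv]
    exact_mod_cast P.n_le

end CorrClust

/-! ### The theorem, with three passes and ratio 48. -/

theorem mainTheorem2 :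
    ∃ A : CorrClust.Prog, A.IsSemiStreaming ∧
      ∃ p c : ℕ, ∀ n : ℕ, 1 ≤ n →
        ∀ (G : SimpleGraph (Fin n)) (σ : ℕ → List (Fin n × Fin n)),
          (∀ j, CorrClust.IsEdgeStream G (σ j)) →
          (∀ r ∈ (A.run σ).support, r.1.passes ≤ p) ∧
          1 - (n : ENNReal)⁻¹ ≤
            (A.run σ).toOuterMeasure {r | CorrClust.IsApprox c G r.1.clustering} := by
  classical
  refine ⟨CorrClust.Prog.clusterProg, CorrClust.isSemiStreaming_clusterProg, 3, 48,
    fun n hn G σ hσ => ⟨fun r hr => ?_, ?_⟩⟩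
  · exact (CorrClust.leads_clusterProg hn hσ (CorrClust.start_fits hn) r hr).2.1.le
  · have h1 := CorrClust.expect_clusterProg_le hn hσ
    rw [tsub_le_iff_right]
    -- Pointwise, each outcome lies in the success set or has failure indicator 1, so the two masses
    -- together are at least the total mass 1.
    refine le_trans ?_ (add_le_add le_rfl h1)
    rw [PMF.toOuterMeasure_apply, CorrClust.Action.expect, ← ENNReal.tsum_add]
    rw [← PMF.tsum_coe (CorrClust.Prog.clusterProg.run σ)]
    refine ENNReal.tsum_le_tsum fun r => ?_
    by_cases h : CorrClust.IsApprox 48 G r.1.clustering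
    · simp [Set.indicator, h]
    · simp [Set.indicator, h, CorrClust.Prog.run]
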